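/- Fix masses $m_0,m_1,m_2>0$ and put $\frac1{\sigma_0}=1+\frac{m_1}{m_0}$, $\frac1{\sigma_1}=1+\frac{m_0}{m_1}$, $\frac1{\mu_1}=\frac1{m_0}+\frac1{m_1}$, $\frac1{\mu_2}=\frac1{m_0+m_1}+\frac1{m_2}$, $M_1=m_0+m_1$, $M_2=m_0+m_1+m_2$. In Jacobi coordinates $(P_i,Q_i)_{i=1,2}$, $P_i,Q_i\in\mathbb R^3$, the Hamiltonian of the spatial three-body problem is $F=F_{Kep}+F_{pert}$ with $$F_{Kep}=\frac{\|P_1\|^2}{2\mu_1}+\frac{\|P_2\|^2}{2\mu_2}-\frac{\mu_1M_1}{\|Q_1\|}-\frac{\mu_2M_2}{\|Q_2\|},$$ $$F_{pert}=-\mu_1m_2\Bigl[\frac1{\sigma_0}\Bigl(\frac1{\|Q_2-\sigma_0Q_1\|}-\frac1{\|Q_2\|}\Bigr)+\frac1{\sigma_1}\Bigl(\frac1{\|Q_2+\sigma_1Q_1\|}-\frac1{\|Q_2\|}\Bigr)\Bigr].$$ Regard $F$ as a function of the Delaunay variables $(l_i,g_i,h_i,L_i,G_i,H_i)_{i=1,2}\in\mathbb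 T^6\times\mathbb R^6$, $\mathbb T=\mathbb R/2\pi\mathbb Z$, of the two Kepler ellipses: $l_i$ is the mean anomaly, $g_i$ the argument of the pericentre, $h_i$ the longitude of the node, $L_i=\mu_i\sqrt{M_ia_i}$, $G_i=L_i\sqrt{1-e_i^2}$, $H_i=G_i\cos\iota_i$, where $a_i,e_i,\iota_i$ are the semi major axis, the eccentricity and the inclination. Let $\alpha=a_1/a_2$. Fix $0<a_1^\vee<a_1^\wedge$, $0<e_i^\vee<e_i^\wedge<1$ and $0<\iota_i^\vee<\iota_i^\wedge<\pi$ $(i=1,2)$, and let $\mathcal P^*\subset\mathbb T^6\times\mathbb R^6$ be the set of points with $L_i,G_i>0$, $a_1^\vee<a_1<a_1^\wedge$, $e_i^\vee<e_i<e_i^\wedge$, $\iota_i^\vee<\iota_i<\iota_i^\wedge$ and $$\alpha<\min\Bigl\{\frac{1-e_2^\wedge}{80},\frac{1-e_2^\wedge}{2\sigma_0},\frac{1-e_2^\wedge}{2\sigma_1}\Bigr\}.$$ For $A\subset\mathbb T^6\times\mathbb R^6$ let $T_{A,s}$ be its $s$-neighbourhood in $(\mathbb C/2\pi\mathbb Z)^6\times\mathbb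 C^6$, for the maximum of the moduli of the components; the analytic extensions of functions and maps are denoted by the same letters. There is $s>0$ such that $F$ extends analytically from $\mathcal P^*$ to $T_{\mathcal P^*,s}$ and, for every $n\in\mathbb N$, there are * an analytic function $F^n:\mathcal P^*\to\mathbb R$, independent of the fast angles $l_1,l_2$; * an open set $\tilde{\mathcal P}\subset\mathcal P^*$, a number $0<s''<s$ and constants $C,C_0$ (independent of $\alpha$) such that $F^n$ extends analytically to $T_{\mathcal P^*,s''}$; * an analytic map $\phi^n:T_{\tilde{\mathcal P},s''}\to T_{\mathcal P^*,s}$ that is injective, preserves the symplectic form $\sum_{i}(dL_i\wedge dl_i+dG_i\wedge dg_i+dH_i\wedge dh_i)$, and maps $\tilde{\mathcal P}$ into $\mathcal P^*$, so that it restricts to a real analytic symplectomorphism of $\tilde{\mathcal P}$ onto its image; such that on $T_{\tilde{\mathcal P},s''}$ $$|\phi^n-\mathrm{Id}|\le C\,|\alpha|^{3/2},\qquad |F\circ\phi^n-F^n|\le C_0\,|\alpha|^{\frac{3(n+2)}2}.$$ Moreover, the relative measure of $\tilde{\mathcal P}$ in $\mathcal P^*$ tends to $1$ as $\alpha\to0$: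 with Lebesgue measure, $$\frac{\operatorname{vol}\bigl(\tilde{\mathcal P}\cap\{t_1<\alpha<t_2\}\bigr)}{\operatorname{vol}\bigl(\mathcal P^*\cap\{t_1<\alpha<t_2\}\bigr)}\longrightarrow1\qquad\text{as }(t_1,t_2)\to(0,0),\ 0<t_1<t_2.$$ -/

import Mathlib

noncomputable section

namespace LunarThreeBody

open scoped Real

/-! ## Masses and the Hamiltonian in Jacobi coordinates -/

/-- The three masses. -/
structure Masses where
  m0 : ℝ
  m1 : ℝ
  m2 : ℝ

namespace Masses

variable (m : Masses)

def Positive : Prop := 0 < m.m0 ∧ 0 < m.m1 ∧ 0 < m.m2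

/-- `1 / σ₀ = 1 + m₁ / m₀`. -/
def σ0 : ℝ := 1 / (1 + m.m1 / m.m0)

/-- `1 / σ₁ = 1 + m₀ / m₁`. -/
def σ1 : ℝ := 1 / (1 + m.m0 / m.m1)

/-- Reduced masses `μ₁` (index `0`, inner) and `μ₂` (index `1`, outer). -/
def μ : Fin 2 → ℝ :=
  ![1 / (1 / m.m0 + 1 / m.m1), 1 / (1 / (m.m0 + m.m1) + 1 / m.m2)]

/-- The central masses `M₁ = m₀ + m₁` and `M₂ = m₀ + m₁ + m₂`. -/
def M : Fin 2 → ℝ := ![m.m0 + m.m1, m.m0 + m.m1 + m.m2]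

end Masses

/-- Euclidean three-space. -/
abbrev R3 := EuclideanSpace ℝ (Fin 3)

/-- The Keplerian part; `P i`, `Q i` are the Jacobi momenta and positions, with index `0` for the
inner and `1` for the outer fictitious body. -/
def FKep (m : Masses) (P Q : Fin 2 → R3) : ℝ :=
  ‖P 0‖ ^ 2 / (2 * m.μ 0) + ‖P 1‖ ^ 2 / (2 * m.μ 1)
    - m.μ 0 * m.M 0 / ‖Q 0‖ - m.μ 1 * m.M 1 / ‖Q 1‖

/-- The perturbing part. -/
def FPert (m : Masses) (Q : Fin 2 → R3) : ℝ :=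
  -(m.μ 0 * m.m2) *
    (1 / m.σ0 * (1 / ‖Q 1 - m.σ0 • Q 0‖ - 1 / ‖Q 1‖)
      + 1 / m.σ1 * (1 / ‖Q 1 + m.σ1 • Q 0‖ - 1 / ‖Q 1‖))

/-! ## Delaunay variables

A point is a pair (angles, actions). The first index is `0` for the pair `(l, L)`, `1` for `(g, G)`
and `2` for `(h, H)`; the second index is `0` for the inner and `1` for the outer ellipse.
The angles are lifted to the universal cover, so that objects on the torus are objects that are
`2π`-periodic in the angles. The norm is the maximum of the moduli of the components. -/

/-- The (lifted) phase space over `𝕜 = ℝ` or `ℂ`. -/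
abbrev Phase (𝕜 : Type) := (Fin 3 → Fin 2 → 𝕜) × (Fin 3 → Fin 2 → 𝕜)

/-- Mean anomaly `l`. -/
def ell (x : Phase ℝ) (i : Fin 2) : ℝ := x.1 0 i
/-- Argument of the pericentre `g`. -/
def argPeri (x : Phase ℝ) (i : Fin 2) : ℝ := x.1 1 i
/-- Longitude of the ascending node `h`. -/
def node (x : Phase ℝ) (i : Fin 2) : ℝ := x.1 2 i
/-- Circular angular momentum `L`. -/
def actL (x : Phase ℝ) (i : Fin 2) : ℝ := x.2 0 i
/-- Angular momentum `G`. -/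
def actG (x : Phase ℝ) (i : Fin 2) : ℝ := x.2 1 i
/-- Vertical component `H` of the angular momentum. -/
def actH (x : Phase ℝ) (i : Fin 2) : ℝ := x.2 2 i

/-- Semi major axis, from `L = μ √M √a`. -/
def semiAxis (m : Masses) (x : Phase ℝ) (i : Fin 2) : ℝ :=
  actL x i ^ 2 / (m.μ i ^ 2 * m.M i)

/-- Eccentricity, from `G = L √(1 - e²)`. -/
def ecc (x : Phase ℝ) (i : Fin 2) : ℝ := √(1 - (actG x i / actL x i) ^ 2)

/-- Inclination, from `H = G cos i`. -/
def incl (x : Phase ℝ) (i : Fin 2) : ℝ := Real.arccos (actH x i / actG x i)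

/-- The ratio `α = a₁ / a₂` of the semi major axes. -/
def alpha (m : Masses) (x : Phase ℝ) : ℝ := semiAxis m x 0 / semiAxis m x 1

/-- The complex extension of `α`. -/
def alphaC (m : Masses) (z : Phase ℂ) : ℂ :=
  (z.2 0 0 ^ 2 / ((m.μ 0 : ℂ) ^ 2 * (m.M 0 : ℂ))) /
    (z.2 0 1 ^ 2 / ((m.μ 1 : ℂ) ^ 2 * (m.M 1 : ℂ)))

/-- The eccentric anomaly `u`, i.e. the solution of Kepler's equation `u - e sin u = l`;
see `eccAnomaly_spec` and `eccAnomaly_unique`. -/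
def eccAnomaly (e l : ℝ) : ℝ := Function.invFun (fun u : ℝ => u - e * Real.sin u) l

theorem eccAnomaly_spec (e l : ℝ) :
    eccAnomaly e l - e * Real.sin (eccAnomaly e l) = l := by
  have hc : Continuous (fun u : ℝ => u - e * Real.sin u) := by fun_prop
  have hb : ∀ u : ℝ, |e * Real.sin u| ≤ |e| := fun u => by
    rw [abs_mul]
    exact mul_le_of_le_one_right (abs_nonneg e) (Real.abs_sin_le_one u)
  have hs : ∃ u : ℝ, u - e * Real.sin u = l := by
    have h := intermediate_value_Icc (a := l - |e|) (b := l + |e|)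
      (by linarith [abs_nonneg e]) hc.continuousOn
    have h1 := abs_le.mp (hb (l - |e|))
    have h2 := abs_le.mp (hb (l + |e|))
    obtain ⟨u, -, hu⟩ := h (show l ∈ Set.Icc _ _ from ⟨by linarith, by linarith⟩)
    exact ⟨u, hu⟩
  exact Function.invFun_eq (f := fun u : ℝ => u - e * Real.sin u) hs

theorem eccAnomaly_unique {e l u : ℝ} (h0 : 0 ≤ e) (h1 : e < 1) (hu : u - e * Real.sin u = l) :
    u = eccAnomaly e l := by
  have hv := eccAnomaly_spec e l
  set v := eccAnomaly e l
  have hl : |Real.sin u - Real.sin v| ≤ |u - v| := by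
    have := Real.lipschitzWith_sin.dist_le_mul u v
    simpa [Real.dist_eq] using this
  have hd : u - v = e * (Real.sin u - Real.sin v) := by linarith
  have h2 : |u - v| ≤ e * |u - v| := by
    calc |u - v| = e * |Real.sin u - Real.sin v| := by
          rw [hd, abs_mul, abs_of_nonneg h0]
      _ ≤ e * |u - v| := mul_le_mul_of_nonneg_left hl h0
  have h3 : |u - v| = 0 := by nlinarith [abs_nonneg (u - v)]
  exact sub_eq_zero.mp (abs_eq_zero.mp h3)

/-- The orbital frame `R_z(h) R_x(i) R_z(g)`: the unit vector towards the pericentre. -/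
def periVec (x : Phase ℝ) (i : Fin 2) : R3 :=
  let g := argPeri x i; let h := node x i; let ι := incl x i
  !₂[Real.cos h * Real.cos g - Real.sin h * Real.cos ι * Real.sin g,
     Real.sin h * Real.cos g + Real.cos h * Real.cos ι * Real.sin g,
     Real.sin ι * Real.sin g]

/-- The unit vector of the orbital plane orthogonal to the pericentre direction, in the direction
of motion. -/
def perpVec (x : Phase ℝ) (i : Fin 2) : R3 :=
  let g := argPeri x i; let h := node x i; let ι := incl x i
  !₂[-(Real.cos h * Real.sin g) - Real.sin h * Real.cos ι * Real.cos g,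
     -(Real.sin h * Real.sin g) + Real.cos h * Real.cos ι * Real.cos g,
     Real.sin ι * Real.cos g]

/-- The position on the ellipse with given Delaunay variables. -/
def posQ (m : Masses) (x : Phase ℝ) (i : Fin 2) : R3 :=
  let a := semiAxis m x i; let e := ecc x i; let u := eccAnomaly e (ell x i)
  (a * (Real.cos u - e)) • periVec x i + (a * √(1 - e ^ 2) * Real.sin u) • perpVec x i

/-- The corresponding momentum `μ dQ/dt`, where `dl/dt = √(M / a³)`. -/
def momP (m : Masses) (x : Phase ℝ) (i : Fin 2) : R3 :=
  let a := semiAxis m x i; let e := ecc x i; let u := eccAnomaly e (ell x i)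
  (m.μ i * √(m.M i / a ^ 3) * a / (1 - e * Real.cos u)) •
    ((-Real.sin u) • periVec x i + (√(1 - e ^ 2) * Real.cos u) • perpVec x i)

/-- The Hamiltonian `F = F_Kep + F_pert` in Delaunay variables. -/
def F (m : Masses) (x : Phase ℝ) : ℝ :=
  FKep m (momP m x) (posQ m x) + FPert m (posQ m x)

/-! ## The asynchronous region -/

/-- Lower and upper bounds for the inner semi major axis, the eccentricities and the
inclinations. -/
structure Bounds where
  aLo : ℝ
  aHi : ℝ
  eLo : Fin 2 → ℝ
  eHi : Fin 2 → ℝ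
  iLo : Fin 2 → ℝ
  iHi : Fin 2 → ℝ

/-- Ellipses are bounded away from circular, rectilinear and horizontal ones. -/
def Bounds.Admissible (b : Bounds) : Prop :=
  0 < b.aLo ∧ b.aLo < b.aHi ∧
  (∀ i, 0 < b.eLo i ∧ b.eLo i < b.eHi i ∧ b.eHi i < 1) ∧
  (∀ i, 0 < b.iLo i ∧ b.iLo i < b.iHi i ∧ b.iHi i < π)

/-- The upper bound `α^∧` for the ratio of the semi major axes. -/
def alphaMax (m : Masses) (b : Bounds) : ℝ :=
  min ((1 - b.eHi 1) / 80) (min ((1 - b.eHi 1) / (2 * m.σ0)) ((1 - b.eHi 1) / (2 * m.σ1)))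

/-- The asynchronous region `P*` in (lifted) Delaunay variables. -/
def PStar (m : Masses) (b : Bounds) : Set (Phase ℝ) :=
  {x | (∀ i, 0 < actL x i ∧ 0 < actG x i) ∧
    (b.aLo < semiAxis m x 0 ∧ semiAxis m x 0 < b.aHi) ∧
    (∀ i, b.eLo i < ecc x i ∧ ecc x i < b.eHi i) ∧
    (∀ i, b.iLo i < incl x i ∧ incl x i < b.iHi i) ∧
    alpha m x < alphaMax m b}

/-! ## Complex neighbourhoods, extensions, symplectic maps -/

/-- The inclusion of the real phase space in the complex one. -/
def toC (x : Phase ℝ) : Phase ℂ := (fun k i => (x.1 k i : ℂ), fun k i => (x.2 k i : ℂ))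

/-- The complex `s`-neighbourhood `T_{A,s}` of a set `A` of real points. -/
def T (A : Set (Phase ℝ)) (s : ℝ) : Set (Phase ℂ) := Metric.thickening s (toC '' A)

/-- Translation of the angles by integer multiples of `2π`. -/
def shift {𝕜 : Type} [RCLike 𝕜] (k : Fin 3 → Fin 2 → ℤ) (z : Phase 𝕜) : Phase 𝕜 :=
  (fun j i => z.1 j i + 2 * ((π : ℝ) : 𝕜) * (k j i : 𝕜), z.2)

/-- `fc` is the analytic extension of the real function `f` on `A` to `T_{A,s}`. It is unique on
`T_{A,s}` if `A` is open. -/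
def IsAnalyticExtension (f : Phase ℝ → ℝ) (A : Set (Phase ℝ)) (s : ℝ) (fc : Phase ℂ → ℂ) : Prop :=
  AnalyticOnNhd ℂ fc (T A s) ∧ ∀ x ∈ A, fc (toC x) = (f x : ℂ)

/-- The symplectic form `∑ dL ∧ dl + dG ∧ dg + dH ∧ dh`. -/
def omega (v w : Phase ℂ) : ℂ := ∑ k, ∑ i, (v.2 k i * w.1 k i - v.1 k i * w.2 k i)

/-- `φ` is an analytic symplectomorphism from `T_{A,s}` onto its image, commuting with the
translations of the angles by multiples of `2π` (so that it lives on the torus). -/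
structure IsSymplecto (A : Set (Phase ℝ)) (s : ℝ) (φ : Phase ℂ → Phase ℂ) : Prop where
  analytic : AnalyticOnNhd ℂ φ (T A s)
  equivariant : ∀ k, ∀ z ∈ T A s, φ (shift k z) = shift k (φ z)
  injective : Set.InjOn φ (T A s)
  symplectic : ∀ z ∈ T A s, ∀ v w, omega (fderiv ℂ φ z v) (fderiv ℂ φ z w) = omega v w

/-- The part of `A`, counted once modulo `2π` in the angles, on which `a < α < b`. -/
def shell (m : Masses) (A : Set (Phase ℝ)) (a b : ℝ) : Set (Phase ℝ) :=
  {x | x ∈ A ∧ (∀ k i, x.1 k i ∈ Set.Ico 0 (2 * π)) ∧ a < alpha m x ∧ alpha m x < b}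

/-- The relative Lebesgue (equivalently Liouville) measure of `A` in `B` within `a < α < b`. -/
def relMeasure (m : Masses) (A B : Set (Phase ℝ)) (a b : ℝ) : ENNReal :=
  MeasureTheory.volume (shell m A a b) / MeasureTheory.volume (shell m B a b)

end LunarThreeBody

end

noncomputable section

namespace LunarThreeBody

open scoped Real Nat Topology ContDiff
open Set Filter Metric

/-! The proof is averaging by generating functions in the limit L₂ → ∞. On P* the action L₁ is
bounded and bounded away from 0, so α is comparable to L₂⁻², and all orders are counted in powers of
1/|L₂| by `wt`. Estimates hold eventually along the filter `far` of complex neighbourhoods of the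
part with large L₂. By Cauchy's estimate (`isBigO_fderiv`) a derivative costs no order; only the
width of the neighbourhood shrinks.

The perturbation has order 6. In Jacobi coordinates the terms linear in α cancel, and what remains
is α²/a₂, a multiple of L₁⁴/L₂⁶, times a function of the angles, G/L, H/G and L₁/L₂ (`pertC_eq`).
This function is analytic up to L₁/L₂ = 0, and its arguments, with angles modulo 2π, fill a
relatively compact set, so the analytic extension has a uniform width (`exists_uniform`).

The Kepler frequency ν₁ has order 0 and ν₂ has order 3. One looks for K and Z, with Z free of l₁ and
l₂, such that F(θ, I + ∂K/∂θ) = F_Kep(I) + Z(θ + ∂K/∂I, I). If the defect R has order 3n + 6, K is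
corrected by κ₁, which removes the l₁-oscillation of R, and by κ₂, which removes the l₂-oscillation
of the l₁-mean of R; the double mean goes into Z. The two angles are averaged one after the other,
each with its own frequency, so there are no small divisors. The only linear term left over is ν₂
∂κ₁/∂l₂, which is three orders smaller than R because ν₂ has order 3. Each step thus gains three
orders (`IsNormalForm.succ`).

Since K has order 3, it generates a symplectic map φ with φ − Id of order 3, that is O(α^(3/2))
(`exists_generatedMap`), and F ∘ φ − F_Kep − Z is the defect read at the mixed point of angles and
actions.

Two matters remain. Z lives only where L₂ is large, whereas F^n is wanted on all of P*: Z is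
composed with a translation into the far part that is the identity up to high order at infinity
(`exists_transport`). And φ must map P̃ into P*: in the actions P* is cut out by affine walls
(`PStar_eq_region`), and P̃ consists of far points whose wall functions exceed D/L₂³. A homothety of
ratio 1 − ε towards an interior point maps each shell of P* with small α into P̃, so the relative
measure tends to 1 (`tendsto_volume_core`). -/

/-! ## Holomorphic functions of several variables -/

section Holomorphic

variable {E F : Type} [NormedAddCommGroup E] [NormedSpace ℂ E]
  [NormedAddCommGroup F] [NormedSpace ℂ F]

/-- Cauchy's estimate for the Fréchet derivative. -/
theorem norm_fderiv_le_of_bound {f : E → F} {c : E} {R M : ℝ} (hR : 0 < R)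
    (hd : DifferentiableOn ℂ f (ball c R)) (hM : ∀ z ∈ ball c R, ‖f z‖ ≤ M) :
    ‖fderiv ℂ f c‖ ≤ 2 * M / R := by
  refine Complex.norm_fderiv_le_div_of_mapsTo_ball hd (fun z hz => ?_) hR
  rw [mem_closedBall, dist_eq_norm]
  linarith [norm_sub_le (f z) (f c), hM z hz, hM c (mem_ball_self hR)]

/-- Each derivative costs a factor 2/δ by Cauchy's estimate on balls of radius δ, and a loss δ in
the radius. -/
theorem norm_iteratedFDeriv_le_of_bound {f : E → F} {x : E} {R M δ : ℝ} (hδ : 0 < δ)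
    (hd : ContDiffOn ℂ ∞ f (ball x R)) (hM : ∀ z ∈ ball x R, ‖f z‖ ≤ M) (n : ℕ) :
    ∀ z ∈ ball x (R - n * δ), ‖iteratedFDeriv ℂ n f z‖ ≤ M * (2 / δ) ^ n := by
  induction n with
  | zero => simpa using hM
  | succ n ih =>
    intro z hz
    push_cast at hz
    rw [← norm_fderiv_iteratedFDeriv]
    have hsub : ball z δ ⊆ ball x (R - n * δ) := by
      apply ball_subset_ball'
      rw [mem_ball] at hz
      linarith
    have hsub' : ball z δ ⊆ ball x R :=
      hsub.trans (ball_subset_ball (by nlinarith [Nat.cast_nonneg (α := ℝ) n]))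
    have h := norm_fderiv_le_of_bound (f := iteratedFDeriv ℂ n f) (c := z) hδ ?_
      (fun w hw => ih w (hsub hw))
    · refine h.trans (le_of_eq ?_)
      rw [pow_succ]; field_simp
    · intro w hw
      have : ContDiffAt ℂ ∞ f w := hd.contDiffAt (isOpen_ball.mem_nhds (hsub' hw))
      exact (this.differentiableAt_iteratedFDeriv (by exact_mod_cast WithTop.coe_lt_top _)).differentiableWithinAt

/-- This identifies the one-variable Taylor coefficients along a complex line with the diagonal
values of the candidate power series. -/
theorem iteratedDeriv_line {f : E → F} {x v : E} {r : ℝ}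
    (hd : ∀ τ ∈ ball (0 : ℂ) r, ContDiffAt ℂ ∞ f (x + τ • v)) (n : ℕ) :
    ∀ τ ∈ ball (0 : ℂ) r, iteratedDeriv n (fun τ : ℂ => f (x + τ • v)) τ =
      iteratedFDeriv ℂ n f (x + τ • v) (fun _ => v) := by
  induction n with
  | zero => simp
  | succ n ih =>
    intro τ hτ
    rw [iteratedDeriv_succ]
    have he : iteratedDeriv n (fun τ : ℂ => f (x + τ • v)) =ᶠ[𝓝 τ]
        fun τ => iteratedFDeriv ℂ n f (x + τ • v) (fun _ => v) :=
      Filter.eventually_of_mem (isOpen_ball.mem_nhds hτ) ih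
    rw [he.deriv_eq]
    have hD : DifferentiableAt ℂ (iteratedFDeriv ℂ n f) (x + τ • v) :=
      (hd τ hτ).differentiableAt_iteratedFDeriv (by exact_mod_cast WithTop.coe_lt_top _)
    have hl : HasDerivAt (fun τ : ℂ => x + τ • v) v τ := by
      simpa using ((hasDerivAt_id τ).smul_const v).const_add x
    have h1 := hD.hasFDerivAt.comp_hasDerivAt τ hl
    have h2 := ((ContinuousMultilinearMap.apply ℂ (fun _ : Fin n => E) F
      (fun _ => v)).hasFDerivAt).comp_hasDerivAt τ h1
    have h3 := h2.deriv
    simp only [Function.comp_def, ContinuousMultilinearMap.apply_apply] at h3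
    rw [h3, iteratedFDeriv_succ_apply_left]
    rfl

/-- A complex smooth function is analytic. -/
theorem analyticAt_of_contDiffOn [CompleteSpace F] {f : E → F} {x : E} {U : Set E}
    (hU : U ∈ 𝓝 x) (hd : ContDiffOn ℂ ∞ f U) : AnalyticAt ℂ f x := by
  have hc : ContinuousAt f x := (hd.contDiffAt hU).continuousAt
  obtain ⟨R, hR, hsub⟩ : ∃ R > 0, ball x R ⊆ U ∩ {z | ‖f z‖ < ‖f x‖ + 1} := by
    apply Metric.mem_nhds_iff.1
    refine inter_mem hU ?_
    exact hc.norm.eventually (gt_mem_nhds (lt_add_one _))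
  set M := ‖f x‖ + 1 with hMdef
  have hM : ∀ z ∈ ball x R, ‖f z‖ ≤ M := fun z hz => (hsub hz).2.le
  have hM0 : 0 ≤ M := by positivity
  have hdR : ContDiffOn ℂ ∞ f (ball x R) := hd.mono fun z hz => (hsub hz).1
  have hat : ∀ z ∈ ball x R, ContDiffAt ℂ ∞ f z := fun z hz =>
    hdR.contDiffAt (isOpen_ball.mem_nhds hz)
  have hbound : ∀ n : ℕ, ‖iteratedFDeriv ℂ n f x‖ ≤ M * ((4 / R) ^ n * (n : ℝ) ^ n) := by
    intro n
    rcases Nat.eq_zero_or_pos n with rfl | hn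
    · simpa using hM x (mem_ball_self hR)
    have hn' : (0 : ℝ) < n := by exact_mod_cast hn
    -- With δ = R/(2n) the total loss of radius is R/2 for every n, at the price of a factor nⁿ.
    have h := norm_iteratedFDeriv_le_of_bound (δ := R / (2 * n)) (by positivity) hdR hM n x (by
      apply mem_ball_self
      have : (n : ℝ) * (R / (2 * n)) = R / 2 := by field_simp
      rw [this]; linarith)
    refine h.trans (le_of_eq ?_)
    rw [← mul_pow]
    congr 2
    field_simp
    norm_num
  let p : FormalMultilinearSeries ℂ E F := fun n => ((n ! : ℂ)⁻¹) • iteratedFDeriv ℂ n f x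
  -- Since nⁿ/n! ≤ eⁿ, the coefficients grow at most like (4e/R)ⁿ, which fixes this radius.
  set ρ : ℝ := R / (4 * Real.exp 1) with hρ
  have hρ0 : 0 < ρ := by positivity
  have hpb : ∀ n, ‖p n‖ * ρ ^ n ≤ M := by
    intro n
    have h1 : ‖p n‖ = (n ! : ℝ)⁻¹ * ‖iteratedFDeriv ℂ n f x‖ := by
      simp only [p, norm_smul, norm_inv, Complex.norm_natCast]
    have h2 := Real.pow_div_factorial_le_exp (n : ℝ) (Nat.cast_nonneg n) n
    have h3 : Real.exp (n : ℝ) = Real.exp 1 ^ n := by rw [← Real.exp_nat_mul]; simp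
    rw [h1]
    calc (n ! : ℝ)⁻¹ * ‖iteratedFDeriv ℂ n f x‖ * ρ ^ n
        ≤ (n ! : ℝ)⁻¹ * (M * ((4 / R) ^ n * (n : ℝ) ^ n)) * ρ ^ n := by
          gcongr; exact hbound n
      _ = M * ((n : ℝ) ^ n / n !) * ((4 / R) * ρ) ^ n := by rw [mul_pow]; ring
      _ ≤ M * Real.exp 1 ^ n * ((4 / R) * ρ) ^ n := by
          rw [← h3]; gcongr
      _ = M * (Real.exp 1 * ((4 / R) * ρ)) ^ n := by rw [mul_pow (Real.exp 1), mul_assoc]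
      _ = M := by
          have : Real.exp 1 * ((4 / R) * ρ) = 1 := by rw [hρ]; field_simp
          rw [this]; simp
  have hρR : ρ < R := by
    rw [hρ]
    apply div_lt_self hR
    have := Real.add_one_le_exp 1
    linarith
  clear_value ρ
  lift ρ to NNReal using hρ0.le
  refine ⟨p, (ρ : ENNReal), ?_⟩
  refine ⟨?_, by exact_mod_cast hρ0, ?_⟩
  · exact p.le_radius_of_bound M hpb
  · intro y hy
    have hy' : ‖y‖ < ρ := by simpa [← ENNReal.coe_lt_coe, enorm] using hy
    -- The sum of the series is found on the complex line through x and x + y: the one-variable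
    -- Taylor series converges at τ = 1 because ρ < R.
    have hline : ∀ τ ∈ ball (0 : ℂ) (R / ρ), x + τ • y ∈ ball x R := by
      intro τ hτ
      rw [mem_ball_zero_iff, lt_div_iff₀ hρ0] at hτ
      rw [mem_ball, dist_eq_norm, add_sub_cancel_left, norm_smul]
      exact lt_of_le_of_lt (by gcongr) hτ
    have hdl : DifferentiableOn ℂ (fun τ : ℂ => f (x + τ • y)) (ball 0 (R / ρ)) := by
      intro τ hτ
      have h1 : DifferentiableAt ℂ f (x + τ • y) :=
        (hat _ (hline τ hτ)).differentiableAt (by simp)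
      exact (DifferentiableAt.comp (f := fun τ : ℂ => x + τ • y) τ h1
        (by fun_prop)).differentiableWithinAt
    have h1R : (1 : ℂ) ∈ ball (0 : ℂ) (R / ρ) := by
      rw [mem_ball_zero_iff, norm_one, lt_div_iff₀ hρ0]; linarith
    have hs := Complex.hasSum_taylorSeries_on_ball hdl h1R
    have h0 : (0 : ℂ) ∈ ball (0 : ℂ) (R / ρ) := mem_ball_self (by positivity)
    simp only [sub_zero, one_pow, one_smul] at hs
    convert hs using 1
    funext n
    rw [iteratedDeriv_line (fun τ hτ => hat _ (hline τ hτ)) n 0 h0]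
    simp [p]

/-- The weighted mean of `g` along the real direction `e`. -/
def lineMean (k : ℝ → ℂ) (e : E) (g : E → F) (z : E) : F :=
  ∫ t in (0 : ℝ)..2 * π, k t • g (z + (t : ℂ) • e)

theorem continuous_line {e : E} {D : Set E} (hD : ∀ z ∈ D, ∀ t : ℝ, z + (t : ℂ) • e ∈ D) {F : Type}
    [TopologicalSpace F] {g : E → F}
    (hg : ContinuousOn g D) {z : E} (hz : z ∈ D) : Continuous fun t : ℝ => g (z + (t : ℂ) • e) :=
  hg.comp_continuous (by fun_prop) fun t => hD z hz t

variable [FiniteDimensional ℂ E] [CompleteSpace F] {k : ℝ → ℂ} {e : E} {D : Set E}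

theorem hasFDerivAt_lineMean (hk : Continuous k) (hO : IsOpen D)
    (hD : ∀ z ∈ D, ∀ t : ℝ, z + (t : ℂ) • e ∈ D) {g : E → F} (hg : AnalyticOnNhd ℂ g D)
    {z : E} (hz : z ∈ D) :
    HasFDerivAt (lineMean k e g) (lineMean k e (fderiv ℂ g) z) z := by
  have : ProperSpace E := FiniteDimensional.proper ℂ E
  have hg' : ContinuousOn (fderiv ℂ g) D := hg.fderiv.continuousOn
  obtain ⟨r, hr, hsub⟩ := Metric.nhds_basis_closedBall.mem_iff.1 (hO.mem_nhds hz)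
  -- The segments swept by a small closed ball form a compact set, which supplies the constant
  -- dominating function.
  have hcomp : IsCompact ((fun p : E × ℝ => p.1 + (p.2 : ℂ) • e) ''
      (closedBall z r ×ˢ Icc 0 (2 * π))) :=
    ((isCompact_closedBall z r).prod isCompact_Icc).image (by fun_prop)
  have hin : (fun p : E × ℝ => p.1 + (p.2 : ℂ) • e) '' (closedBall z r ×ˢ Icc 0 (2 * π)) ⊆ D := by
    rintro _ ⟨p, ⟨hp, -⟩, rfl⟩
    exact hD _ (hsub hp) _
  obtain ⟨B, hB⟩ := hcomp.exists_bound_of_continuousOn (hg'.mono hin)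
  obtain ⟨Bk, hBk⟩ := (isCompact_Icc (a := (0 : ℝ)) (b := 2 * π)).exists_bound_of_continuousOn
    hk.continuousOn
  refine intervalIntegral.hasFDerivAt_integral_of_dominated_of_fderiv_le
    (F := fun z t => k t • g (z + (t : ℂ) • e))
    (F' := fun z t => k t • fderiv ℂ g (z + (t : ℂ) • e))
    (bound := fun _ => Bk * B) (closedBall_mem_nhds z hr) ?_ ?_ ?_ ?_ ?_ ?_
  · filter_upwards [hO.mem_nhds hz] with w hw
    exact (hk.smul (continuous_line hD hg.continuousOn hw)).aestronglyMeasurable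
  · exact (hk.smul (continuous_line hD hg.continuousOn hz)).intervalIntegrable _ _
  · exact (hk.smul (continuous_line hD hg' hz)).aestronglyMeasurable
  · refine Filter.Eventually.of_forall fun t ht w hw => ?_
    rw [uIoc_of_le (by positivity)] at ht
    have ht' : t ∈ Icc 0 (2 * π) := ⟨ht.1.le, ht.2⟩
    rw [norm_smul]
    have h1 := hBk t ht'
    have h2 := hB _ ⟨(w, t), ⟨hw, ht'⟩, rfl⟩
    have h3 : 0 ≤ Bk := (norm_nonneg _).trans h1
    exact mul_le_mul h1 h2 (norm_nonneg _) h3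
  · exact intervalIntegrable_const
  · refine Filter.Eventually.of_forall fun t _ w hw => ?_
    have h1 : HasFDerivAt g (fderiv ℂ g (w + (t : ℂ) • e)) (w + (t : ℂ) • e) :=
      (hg _ (hD w (hsub hw) t)).differentiableAt.hasFDerivAt
    have h2 : HasFDerivAt (fun w : E => w + (t : ℂ) • e) (ContinuousLinearMap.id ℂ E) w :=
      (hasFDerivAt_id w).add_const _
    exact (h1.comp w h2).const_smul (k t)

/-- The derivative of a mean is the mean of the derivative, whose values are linear maps; hence the
induction runs over all target spaces at once. -/
theorem contDiffOn_lineMean (hk : Continuous k) (hO : IsOpen D)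
    (hD : ∀ z ∈ D, ∀ t : ℝ, z + (t : ℂ) • e ∈ D) (n : ℕ) :
    ∀ {F : Type} [NormedAddCommGroup F] [NormedSpace ℂ F] [CompleteSpace F] {g : E → F},
      AnalyticOnNhd ℂ g D → ContDiffOn ℂ n (lineMean k e g) D := by
  induction n with
  | zero =>
    intro F _ _ _ g hg
    exact contDiffOn_zero.2 fun z hz =>
      (hasFDerivAt_lineMean hk hO hD hg hz).continuousAt.continuousWithinAt
  | succ n ih =>
    intro F _ _ _ g hg
    push_cast
    refine (contDiffOn_succ_iff_fderiv_of_isOpen hO).2 ⟨fun z hz =>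
      (hasFDerivAt_lineMean hk hO hD hg hz).differentiableAt.differentiableWithinAt, by simp, ?_⟩
    exact (ih hg.fderiv).congr fun z hz => (hasFDerivAt_lineMean hk hO hD hg hz).fderiv

theorem analyticOnNhd_lineMean (hk : Continuous k) (hO : IsOpen D)
    (hD : ∀ z ∈ D, ∀ t : ℝ, z + (t : ℂ) • e ∈ D) {g : E → F} (hg : AnalyticOnNhd ℂ g D) :
    AnalyticOnNhd ℂ (lineMean k e g) D := fun _ hz =>
  analyticAt_of_contDiffOn (hO.mem_nhds hz)
    (contDiffOn_infty.2 fun n => contDiffOn_lineMean hk hO hD n hg)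

end Holomorphic

end LunarThreeBody

namespace LunarThreeBody

open scoped Real Topology
open Set Filter Metric Asymptotics

/-! ## The end of the phase space where the outer body is far away -/

section Far

/-- The part of `A` where the outer action `L₂` exceeds `N`. -/
def farPart (A : Set (Phase ℝ)) (N : ℝ) : Set (Phase ℝ) := {x | x ∈ A ∧ N < x.2 0 1}

/-- Complex neighbourhoods of the far parts of `A`. -/
def dom (A : Set (Phase ℝ)) (N : ℕ) : Set (Phase ℂ) := T (farPart A N) (1 / ((N : ℝ) + 1))

/-- The filter generated by the complex neighbourhoods of the far parts of `A`. -/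
def far (A : Set (Phase ℝ)) : Filter (Phase ℂ) := ⨅ N : ℕ, 𝓟 (dom A N)

variable {A : Set (Phase ℝ)}

theorem mem_T {s : ℝ} {z : Phase ℂ} : z ∈ T A s ↔ ∃ x ∈ A, ‖z - toC x‖ < s := by
  rw [T, mem_thickening_iff, exists_mem_image]
  simp only [dist_eq_norm]

theorem isOpen_T {s : ℝ} : IsOpen (T A s) := isOpen_thickening

theorem T_mono {A B : Set (Phase ℝ)} {s s' : ℝ} (h : A ⊆ B) (hs : s ≤ s') : T A s ⊆ T B s' := by
  intro z hz
  obtain ⟨x, hx, hxz⟩ := mem_T.1 hz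
  exact mem_T.2 ⟨x, h hx, hxz.trans_le hs⟩

theorem T_add {s s' : ℝ} {z v : Phase ℂ} (hz : z ∈ T A s) (hv : ‖v‖ + s ≤ s') :
    z + v ∈ T A s' := by
  obtain ⟨x, hx, hxz⟩ := mem_T.1 hz
  refine mem_T.2 ⟨x, hx, ?_⟩
  have : z + v - toC x = (z - toC x) + v := by abel
  rw [this]
  linarith [norm_add_le (z - toC x) v]

theorem isOpen_dom {N : ℕ} : IsOpen (dom A N) := isOpen_T

theorem dom_antitone : Antitone (dom A) := by
  intro M N h
  have h' : (M : ℝ) ≤ N := by exact_mod_cast h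
  refine T_mono (fun x hx => ⟨hx.1, lt_of_le_of_lt h' hx.2⟩) ?_
  gcongr

theorem hasBasis_far : (far A).HasBasis (fun _ : ℕ => True) (dom A) :=
  hasBasis_iInf_principal dom_antitone.directed_ge

theorem eventually_far {p : Phase ℂ → Prop} :
    (∀ᶠ z in far A, p z) ↔ ∃ N : ℕ, ∀ z ∈ dom A N, p z := by
  simpa using hasBasis_far.eventually_iff

/-- The radius of `dom A (2 * N + 1)` is half that of `dom A N`, which leaves room for a
displacement of the same size. -/
theorem dom_add {N : ℕ} {z v : Phase ℂ} (hz : z ∈ dom A (2 * N + 1))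
    (hv : ‖v‖ ≤ 1 / (2 * ((N : ℝ) + 1))) : z + v ∈ dom A N := by
  have h1 : z ∈ T (farPart A N) (1 / (((2 * N + 1 : ℕ) : ℝ) + 1)) := by
    have hN : (N : ℝ) ≤ ((2 * N + 1 : ℕ) : ℝ) := by exact_mod_cast (by omega)
    exact T_mono (A := farPart A ((2 * N + 1 : ℕ) : ℝ)) (B := farPart A N)
      (fun x hx => ⟨hx.1, lt_of_le_of_lt hN hx.2⟩) le_rfl hz
  refine T_add h1 ?_
  push_cast
  have h2 : (2 * (N : ℝ) + 1 + 1) = 2 * (N + 1) := by ring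
  rw [h2]
  have h3 : 1 / (2 * ((N : ℝ) + 1)) + 1 / (2 * ((N : ℝ) + 1)) = 1 / (N + 1) := by
    field_simp
    norm_num
  linarith

/-- An eventual property holds eventually on balls of a fixed radius. -/
theorem eventually_far_ball {p : Phase ℂ → Prop} (h : ∀ᶠ z in far A, p z) :
    ∃ r > 0, ∀ᶠ z in far A, ∀ v, ‖v‖ ≤ r → p (z + v) := by
  obtain ⟨N, hN⟩ := eventually_far.1 h
  exact ⟨1 / (2 * ((N : ℝ) + 1)), by positivity,
    eventually_far.2 ⟨2 * N + 1, fun z hz v hv => hN _ (dom_add hz hv)⟩⟩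

/-- A displacement tending to zero is eventually smaller than the room left by
`eventually_far_ball`. This is what allows composition with maps close to the identity. -/
theorem tendsto_far_add {d : Phase ℂ → Phase ℂ} (hd : Tendsto d (far A) (𝓝 0)) :
    Tendsto (fun z => z + d z) (far A) (far A) := by
  intro s hs
  obtain ⟨r, hr, h⟩ := eventually_far_ball (p := fun z => z ∈ s) hs
  have h0 : ∀ᶠ z in far A, ‖d z‖ < r := by
    simpa using hd.eventually (ball_mem_nhds (0 : Phase ℂ) hr)
  exact (h.and h0).mono fun z hz => hz.1 _ hz.2.le

theorem eventually_far_nhds {p : Phase ℂ → Prop} (h : ∀ᶠ z in far A, p z) :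
    ∀ᶠ z in far A, ∀ᶠ w in 𝓝 z, p w := by
  obtain ⟨N, hN⟩ := eventually_far.1 h
  exact eventually_far.2 ⟨N, fun z hz => Filter.eventually_of_mem (isOpen_dom.mem_nhds hz) hN⟩

/-- The set is invariant under changes of the angles. -/
def AngleInvariant (A : Set (Phase ℝ)) : Prop := ∀ x ∈ A, ∀ θ, (θ, x.2) ∈ A

theorem T_translate (hA : AngleInvariant A) {s : ℝ} {z : Phase ℂ} (hz : z ∈ T A s)
    (θ : Fin 3 → Fin 2 → ℝ) : z + toC (θ, 0) ∈ T A s := by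
  obtain ⟨x, hx, hxz⟩ := mem_T.1 hz
  refine mem_T.2 ⟨(x.1 + θ, x.2), hA x hx _, ?_⟩
  convert hxz using 2
  ext k i <;> simp [toC]

theorem angleInvariant_farPart (hA : AngleInvariant A) (N : ℝ) : AngleInvariant (farPart A N) :=
  fun x hx θ => ⟨hA x hx.1 θ, hx.2⟩

/-- The sets `dom A N` are invariant under real translations of the angles, so one N serves all θ.
Means over an angle need the whole translated line. -/
theorem eventually_far_translate (hA : AngleInvariant A) {p : Phase ℂ → Prop}
    (h : ∀ᶠ z in far A, p z) : ∀ᶠ z in far A, ∀ θ, p (z + toC (θ, 0)) := by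
  obtain ⟨N, hN⟩ := eventually_far.1 h
  exact eventually_far.2 ⟨N, fun z hz θ =>
    hN _ (T_translate (angleInvariant_farPart hA N) hz θ)⟩

/-- The unit vector of the angle with index `k`, `i`. -/
def angDir (k : Fin 3) (i : Fin 2) : Phase ℂ := (Pi.single k (Pi.single i 1), 0)

/-- The unit vector of the action with index `k`, `i`. -/
def actDir (k : Fin 3) (i : Fin 2) : Phase ℂ := (0, Pi.single k (Pi.single i 1))

theorem smul_angDir (k : Fin 3) (i : Fin 2) (t : ℝ) :
    (t : ℂ) • angDir k i = toC (t • Pi.single k (Pi.single i 1), 0) := by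
  ext a c
  · by_cases ha : a = k
    · subst ha
      by_cases hc : c = i
      · subst hc; simp [angDir, toC]
      · simp [angDir, toC, hc]
    · simp [angDir, toC, ha]
  · simp [angDir, toC]

theorem shift_eq_add (k : Fin 3 → Fin 2 → ℤ) (z : Phase ℂ) :
    shift k z = z + toC (fun j i => 2 * π * k j i, 0) := by
  ext a c <;> simp [shift, toC]

theorem norm_coord_le (v : Phase ℂ) (k : Fin 3) (i : Fin 2) : ‖v.2 k i‖ ≤ ‖v‖ :=
  ((norm_le_pi_norm (v.2 k) i).trans (norm_le_pi_norm v.2 k)).trans (norm_snd_le v)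

theorem norm_coord_le' (v : Phase ℂ) (k : Fin 3) (i : Fin 2) : ‖v.1 k i‖ ≤ ‖v‖ :=
  ((norm_le_pi_norm (v.1 k) i).trans (norm_le_pi_norm v.1 k)).trans (norm_fst_le v)

theorem lt_norm_of_mem_dom {N : ℕ} {z : Phase ℂ} (hz : z ∈ dom A N) : (N : ℝ) - 1 < ‖z.2 0 1‖ := by
  obtain ⟨x, hx, hxz⟩ := mem_T.1 hz
  have h1 := norm_coord_le (z - toC x) 0 1
  have h2 : ‖z.2 0 1 - (x.2 0 1 : ℂ)‖ < 1 := by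
    have : 1 / ((N : ℝ) + 1) ≤ 1 := by
      rw [div_le_one (by positivity)]; linarith [Nat.cast_nonneg (α := ℝ) N]
    calc ‖z.2 0 1 - (x.2 0 1 : ℂ)‖ ≤ ‖z - toC x‖ := h1
      _ < 1 := hxz.trans_le this
  have h3 : x.2 0 1 ≤ ‖(x.2 0 1 : ℂ)‖ := by rw [Complex.norm_real]; exact le_abs_self _
  have h4 := norm_sub_norm_le (x.2 0 1 : ℂ) (z.2 0 1)
  rw [norm_sub_rev] at h4
  linarith [hx.2]

theorem eventually_norm_gt (B : ℝ) : ∀ᶠ z in far A, B < ‖z.2 0 1‖ := by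
  obtain ⟨N, hN⟩ := exists_nat_gt (B + 1)
  exact eventually_far.2 ⟨N, fun z hz => by linarith [lt_norm_of_mem_dom hz]⟩

/-- The weight `|L₂|⁻ᵏ`. -/
def wt (k : ℤ) (z : Phase ℂ) : ℝ := ‖z.2 0 1‖ ^ (-k)

theorem wt_nonneg (k : ℤ) (z : Phase ℂ) : 0 ≤ wt k z := zpow_nonneg (norm_nonneg _) _

theorem wt_mul (j k : ℤ) : ∀ᶠ z in far A, wt j z * wt k z = wt (j + k) z := by
  filter_upwards [eventually_norm_gt 0] with z hz
  rw [wt, wt, wt, ← zpow_add₀ hz.ne']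
  congr 1; ring

theorem isBigO_wt_of_le {j k : ℤ} (h : j ≤ k) : wt k =O[far A] wt j := by
  refine IsBigO.of_bound 1 ?_
  filter_upwards [eventually_norm_gt 1] with z hz
  rw [one_mul, Real.norm_of_nonneg (wt_nonneg _ _), Real.norm_of_nonneg (wt_nonneg _ _)]
  exact zpow_le_zpow_right₀ hz.le (by omega)

theorem tendsto_wt {k : ℤ} (hk : 0 < k) : Tendsto (wt k) (far A) (𝓝 0) := by
  have h1 : Tendsto (wt 1) (far A) (𝓝 0) := by
    have : Tendsto (fun z : Phase ℂ => ‖z.2 0 1‖) (far A) atTop :=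
      tendsto_atTop.2 fun B => (eventually_norm_gt B).mono fun z hz => hz.le
    have hw : wt 1 = (fun r : ℝ => r⁻¹) ∘ fun z : Phase ℂ => ‖z.2 0 1‖ := by
      funext z; simp [wt]
    rw [hw]
    exact tendsto_inv_atTop_zero.comp this
  exact (isBigO_wt_of_le (by omega : (1 : ℤ) ≤ k)).trans_tendsto h1

/-- When |L₂| > 2, a displacement of norm at most 1 changes |L₂| at most by a factor 2 in either
direction. -/
theorem wt_add_le (k : ℤ) : ∃ C > 0, ∀ᶠ z in far A, ∀ v : Phase ℂ, ‖v‖ ≤ 1 →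
    wt k (z + v) ≤ C * wt k z := by
  refine ⟨2 ^ |k|, by positivity, ?_⟩
  filter_upwards [eventually_norm_gt (A := A) 2] with z hz v hv
  have h1 := norm_coord_le v 0 1
  have hz0 : 0 < ‖z.2 0 1‖ := by linarith
  have h2 : ‖(z + v).2 0 1‖ ≤ 2 * ‖z.2 0 1‖ := by
    have := norm_add_le (z.2 0 1) (v.2 0 1)
    simp only [Prod.snd_add, Pi.add_apply]; linarith
  have h3 : ‖z.2 0 1‖ ≤ 2 * ‖(z + v).2 0 1‖ := by
    have := norm_sub_norm_le (z.2 0 1) (-(v.2 0 1))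
    simp only [Prod.snd_add, Pi.add_apply]
    rw [norm_neg, sub_neg_eq_add] at this; linarith
  have h0 : 0 < ‖(z + v).2 0 1‖ := by linarith
  unfold wt
  rcases le_or_gt 0 k with hk | hk
  · rw [abs_of_nonneg hk, zpow_neg, zpow_neg, ← div_eq_mul_inv, ← one_div,
      div_le_div_iff₀ (by positivity) (by positivity), one_mul, ← mul_zpow]
    exact zpow_le_zpow_left₀ hk hz0.le h3
  · rw [abs_of_neg hk, ← mul_zpow]
    exact zpow_le_zpow_left₀ (by omega) h0.le h2

variable {F : Type} [NormedAddCommGroup F]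

theorem IsBigO.wt_mul {f g : Phase ℂ → ℂ} {j k : ℤ} (hf : f =O[far A] wt j)
    (hg : g =O[far A] wt k) : (fun z => f z * g z) =O[far A] wt (j + k) :=
  (hf.mul hg).congr' EventuallyEq.rfl (LunarThreeBody.wt_mul j k)

/-- The bound is stated with the weight at the centre, so that Cauchy's estimate on balls of fixed
radius preserves the order. -/
theorem exists_bound_ball {f : Phase ℂ → F} {k : ℤ} (hb : f =O[far A] wt k) :
    ∃ C > 0, ∃ r > 0, ∀ᶠ z in far A, ∀ v, ‖v‖ ≤ r → ‖f (z + v)‖ ≤ C * wt k z := by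
  obtain ⟨C, hC, h⟩ := hb.exists_pos
  obtain ⟨r, hr, hr'⟩ := eventually_far_ball h.bound
  obtain ⟨C', hC', h'⟩ := wt_add_le (A := A) k
  refine ⟨C * C', by positivity, min r 1, by positivity, ?_⟩
  filter_upwards [hr', h'] with z h1 h2 v hv
  refine (h1 v (hv.trans (min_le_left _ _))).trans ?_
  rw [Real.norm_of_nonneg (wt_nonneg _ _), mul_assoc]
  gcongr
  exact h2 v (hv.trans (min_le_right _ _))

variable [NormedSpace ℂ F]

/-- Cauchy's estimate: derivatives have the order of the function. -/
theorem isBigO_fderiv {f : Phase ℂ → F} {k : ℤ} (hf : ∀ᶠ z in far A, AnalyticAt ℂ f z)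
    (hb : f =O[far A] wt k) : fderiv ℂ f =O[far A] wt k := by
  obtain ⟨C, hC, r, hr, h1⟩ := exists_bound_ball hb
  obtain ⟨r', hr', h2⟩ := eventually_far_ball hf
  set ρ := min r r' with hρ
  have hρ0 : 0 < ρ := by positivity
  refine IsBigO.of_bound (2 * C / ρ) ?_
  filter_upwards [h1, h2] with z h1 h2
  have key : ∀ w ∈ ball z ρ, ∃ v, w = z + v ∧ ‖v‖ ≤ r ∧ ‖v‖ ≤ r' := fun w hw => by
    rw [mem_ball, dist_eq_norm] at hw
    exact ⟨w - z, by abel, hw.le.trans (min_le_left _ _), hw.le.trans (min_le_right _ _)⟩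
  have := norm_fderiv_le_of_bound (f := f) (c := z) (M := C * wt k z) hρ0
    (fun w hw => by
      obtain ⟨v, rfl, -, hv⟩ := key w hw
      exact (h2 v hv).differentiableAt.differentiableWithinAt)
    (fun w hw => by
      obtain ⟨v, rfl, hv, -⟩ := key w hw
      exact h1 v hv)
  refine this.trans (le_of_eq ?_)
  rw [Real.norm_of_nonneg (wt_nonneg _ _)]
  ring

theorem exists_lipschitz {f : Phase ℂ → F} {k : ℤ} (hf : ∀ᶠ z in far A, AnalyticAt ℂ f z)
    (hb : fderiv ℂ f =O[far A] wt k) : ∃ C > 0, ∃ r > 0, ∀ᶠ z in far A, ∀ v v' : Phase ℂ,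
      ‖v‖ ≤ r → ‖v'‖ ≤ r → ‖f (z + v') - f (z + v)‖ ≤ C * wt k z * ‖v' - v‖ := by
  obtain ⟨C, hC, r, hr, h1⟩ := exists_bound_ball hb
  obtain ⟨r', hr', h2⟩ := eventually_far_ball hf
  refine ⟨C, hC, min r r', by positivity, ?_⟩
  filter_upwards [h1, h2] with z h1 h2 v v' hv hv'
  have key : ∀ w ∈ closedBall z (min r r'), ∃ v, w = z + v ∧ ‖v‖ ≤ r ∧ ‖v‖ ≤ r' := fun w hw => by
    rw [mem_closedBall, dist_eq_norm] at hw
    exact ⟨w - z, by abel, hw.trans (min_le_left _ _), hw.trans (min_le_right _ _)⟩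
  have := (convex_closedBall z (min r r')).norm_image_sub_le_of_norm_fderiv_le (𝕜 := ℂ) (f := f)
    (C := C * wt k z) (x := z + v) (y := z + v')
    (fun w hw => by
      obtain ⟨v, rfl, -, hv⟩ := key w hw
      exact (h2 v hv).differentiableAt)
    (fun w hw => by
      obtain ⟨v, rfl, hv, -⟩ := key w hw
      exact h1 v hv)
    (by simpa using hv) (by simpa using hv')
  simpa using this

theorem eventually_analyticAt_fderiv [CompleteSpace F] {f : Phase ℂ → F}
    (hf : ∀ᶠ z in far A, AnalyticAt ℂ f z) : ∀ᶠ z in far A, AnalyticAt ℂ (fderiv ℂ f) z :=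
  hf.mono fun _ hz => hz.fderiv

/-- The radius a is left free because the displacements to which this applies shrink at infinity;
the factor a then becomes a gain in order. -/
theorem exists_taylor [CompleteSpace F] {f : Phase ℂ → F} {k : ℤ}
    (hf : ∀ᶠ z in far A, AnalyticAt ℂ f z)
    (hb : fderiv ℂ f =O[far A] wt k) : ∃ C > 0, ∃ r > 0, ∀ᶠ z in far A, ∀ v v' : Phase ℂ, ∀ a,
      a ≤ r → ‖v‖ ≤ a → ‖v'‖ ≤ a →
      ‖f (z + v') - f (z + v) - fderiv ℂ f z (v' - v)‖ ≤ C * wt k z * a * ‖v' - v‖ := by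
  have hf' := eventually_analyticAt_fderiv hf
  obtain ⟨C, hC, r, hr, h1⟩ := exists_lipschitz hf' (isBigO_fderiv hf' hb)
  obtain ⟨r', hr', h2⟩ := eventually_far_ball hf
  refine ⟨C, hC, min r r', by positivity, ?_⟩
  filter_upwards [h1, h2] with z h1 h2 v v' a ha hv hv'
  have key : ∀ w ∈ closedBall z a, ∃ v, w = z + v ∧ ‖v‖ ≤ a ∧ ‖v‖ ≤ r ∧ ‖v‖ ≤ r' := fun w hw => by
    rw [mem_closedBall, dist_eq_norm] at hw
    exact ⟨w - z, by abel, hw, hw.trans (ha.trans (min_le_left _ _)),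
      hw.trans (ha.trans (min_le_right _ _))⟩
  -- The mean value inequality is applied to f minus its linear part at z, whose derivative is O(a)
  -- on the ball.
  have hd : ∀ w ∈ closedBall z a, HasFDerivAt (fun w => f w - fderiv ℂ f z w)
      (fderiv ℂ f w - fderiv ℂ f z) w := fun w hw => by
    obtain ⟨v, rfl, -, -, hv⟩ := key w hw
    exact (h2 v hv).differentiableAt.hasFDerivAt.sub (fderiv ℂ f z).hasFDerivAt
  have := (convex_closedBall z a).norm_image_sub_le_of_norm_hasFDerivWithin_le (𝕜 := ℂ)
    (f := fun w => f w - fderiv ℂ f z w) (C := C * wt k z * a) (x := z + v) (y := z + v')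
    (fun w hw => (hd w hw).hasFDerivWithinAt)
    (fun w hw => by
      obtain ⟨v, rfl, hva, hv, -⟩ := key w hw
      have h3 := h1 0 v (by simpa using hr.le) hv
      simp only [add_zero, sub_zero] at h3
      refine h3.trans ?_
      have := wt_nonneg k z
      gcongr)
    (by simpa using hv) (by simpa using hv')
  convert this using 2
  · simp only [map_sub, map_add]; abel
  · simp

end Far

end LunarThreeBody

namespace LunarThreeBody

open scoped Real Topology
open Set Filter Metric Asymptotics

/-! ## Regular functions near the end -/

section Regular

variable {A : Set (Phase ℝ)}

theorem toC_add (x y : Phase ℝ) : toC (x + y) = toC x + toC y := by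
  ext a c <;> simp [toC]

theorem toC_smul (t : ℝ) (x : Phase ℝ) : toC (t • x) = (t : ℂ) • toC x := by
  ext a c <;> simp [toC]

theorem mem_range_toC {z : Phase ℂ} :
    z ∈ range toC ↔ (∀ k i, (z.1 k i).im = 0) ∧ ∀ k i, (z.2 k i).im = 0 := by
  constructor
  · rintro ⟨x, rfl⟩
    simp [toC]
  · rintro ⟨h1, h2⟩
    refine ⟨(fun k i => (z.1 k i).re, fun k i => (z.2 k i).re), ?_⟩
    ext a c <;> apply Complex.ext <;> simp [toC, h1, h2]

theorem add_mem_range_toC {z w : Phase ℂ} (hz : z ∈ range toC) (hw : w ∈ range toC) :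
    z + w ∈ range toC := by
  obtain ⟨x, rfl⟩ := hz
  obtain ⟨y, rfl⟩ := hw
  exact ⟨x + y, toC_add x y⟩

theorem angDir_mem_range (k : Fin 3) (i : Fin 2) : angDir k i ∈ range toC := by
  have := smul_angDir k i 1
  rw [Complex.ofReal_one, one_smul] at this
  exact ⟨_, this.symm⟩

theorem actDir_mem_range (k : Fin 3) (i : Fin 2) : actDir k i ∈ range toC := by
  rw [mem_range_toC]
  refine ⟨fun a c => by simp [actDir], fun a c => ?_⟩
  by_cases ha : a = k
  · subst ha
    by_cases hc : c = i
    · subst hc; simp [actDir]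
    · simp [actDir, hc]
  · simp [actDir, ha]

theorem shift_add (k : Fin 3 → Fin 2 → ℤ) (z w : Phase ℂ) : shift k (z + w) = shift k z + w := by
  rw [shift_eq_add, shift_eq_add]; abel

theorem hasDerivAt_line {f : Phase ℂ → ℂ} {z e : Phase ℂ} {t : ℝ}
    (hf : AnalyticAt ℂ f (z + (t : ℂ) • e)) :
    HasDerivAt (fun t : ℝ => f (z + (t : ℂ) • e)) (fderiv ℂ f (z + (t : ℂ) • e) e) t := by
  have hl : HasDerivAt (fun t : ℝ => z + (t : ℂ) • e) e t := by
    simpa using ((Complex.ofRealCLM.hasDerivAt (x := t)).smul_const e).const_add z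
  exact (hf.differentiableAt.hasFDerivAt.restrictScalars ℝ).comp_hasDerivAt t hl

variable (A) in
/-- Functions that are analytic, real at real points and `2π`-periodic in the angles near the
end of the phase space. -/
structure Reg (f : Phase ℂ → ℂ) : Prop where
  analytic : ∀ᶠ z in far A, AnalyticAt ℂ f z
  real : ∀ᶠ z in far A, z ∈ range toC → (f z).im = 0
  periodic : ∀ᶠ z in far A, ∀ k, f (shift k z) = f z

variable (A) in
/-- Displacements that are analytic, real at real points and `2π`-periodic in the angles, and tend
to zero, near the end of the phase space. -/
structure RegDisp (d : Phase ℂ → Phase ℂ) : Prop where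
  analytic : ∀ᶠ z in far A, AnalyticAt ℂ d z
  real : ∀ᶠ z in far A, z ∈ range toC → d z ∈ range toC
  periodic : ∀ᶠ z in far A, ∀ k, d (shift k z) = d z
  tendsto : Tendsto d (far A) (𝓝 0)

namespace Reg

variable {f g : Phase ℂ → ℂ}

theorem const (c : ℝ) : Reg A fun _ => (c : ℂ) :=
  ⟨Eventually.of_forall fun _ => analyticAt_const, Eventually.of_forall fun _ _ => by simp,
    Eventually.of_forall fun _ _ => rfl⟩

theorem action (k : Fin 3) (i : Fin 2) : Reg A fun z => z.2 k i where
  analytic := Eventually.of_forall fun z =>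
    ((ContinuousLinearMap.proj (R := ℂ) (φ := fun _ : Fin 2 => ℂ) i).comp
      ((ContinuousLinearMap.proj (R := ℂ) (φ := fun _ : Fin 3 => Fin 2 → ℂ) k).comp
      (ContinuousLinearMap.snd ℂ (Fin 3 → Fin 2 → ℂ) (Fin 3 → Fin 2 → ℂ)))).analyticAt z
  real := Eventually.of_forall fun _ hz => (mem_range_toC.1 hz).2 k i
  periodic := Eventually.of_forall fun _ _ => rfl

theorem add (hf : Reg A f) (hg : Reg A g) : Reg A fun z => f z + g z where
  analytic := by filter_upwards [hf.analytic, hg.analytic] with z h1 h2 using h1.add h2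
  real := by
    filter_upwards [hf.real, hg.real] with z h1 h2 hz
    simp [h1 hz, h2 hz]
  periodic := by
    filter_upwards [hf.periodic, hg.periodic] with z h1 h2 k
    rw [h1, h2]

theorem mul (hf : Reg A f) (hg : Reg A g) : Reg A fun z => f z * g z where
  analytic := by filter_upwards [hf.analytic, hg.analytic] with z h1 h2 using h1.mul h2
  real := by
    filter_upwards [hf.real, hg.real] with z h1 h2 hz
    simp [h1 hz, h2 hz]
  periodic := by
    filter_upwards [hf.periodic, hg.periodic] with z h1 h2 k
    rw [h1, h2]

theorem neg (hf : Reg A f) : Reg A fun z => -f z := by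
  simpa using (const (-1)).mul hf

theorem sub (hf : Reg A f) (hg : Reg A g) : Reg A fun z => f z - g z := by
  simpa [sub_eq_add_neg] using hf.add hg.neg

theorem pow (hf : Reg A f) : ∀ n : ℕ, Reg A fun z => f z ^ n
  | 0 => by simpa using const (A := A) 1
  | n + 1 => by simpa only [pow_succ] using (pow hf n).mul hf

theorem inv (hf : Reg A f) (h0 : ∀ᶠ z in far A, f z ≠ 0) : Reg A fun z => (f z)⁻¹ where
  analytic := by filter_upwards [hf.analytic, h0] with z h1 h2 using h1.inv h2
  real := by
    filter_upwards [hf.real] with z h1 hz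
    simp [h1 hz]
  periodic := by
    filter_upwards [hf.periodic] with z h1 k
    rw [h1]

theorem pderiv (hf : Reg A f) {v : Phase ℂ} (hv : v ∈ range toC) :
    Reg A fun z => fderiv ℂ f z v where
  analytic := by
    filter_upwards [hf.analytic] with z h1
    exact ((ContinuousLinearMap.apply ℂ ℂ v).analyticAt _).comp h1.fderiv
  real := by
    filter_upwards [hf.analytic, eventually_far_nhds hf.real] with z h1 h2 hz
    have hl : HasDerivAt (fun t : ℝ => z + (t : ℂ) • v) v 0 := by
      simpa using ((Complex.ofRealCLM.hasDerivAt (x := (0 : ℝ))).smul_const v).const_add z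
    have h3 : HasDerivAt (fun t : ℝ => f (z + (t : ℂ) • v)) (fderiv ℂ f z v) 0 := by
      have := hasDerivAt_line (f := f) (z := z) (e := v) (t := 0) (by simpa using h1)
      simpa using this
    have h4 := Complex.imCLM.hasFDerivAt.comp_hasDerivAt (0 : ℝ) h3
    -- Along a real direction through a real point the imaginary part vanishes identically, hence so
    -- does its derivative.
    have h5 : (fun t : ℝ => (f (z + (t : ℂ) • v)).im) =ᶠ[𝓝 0] fun _ => 0 := by
      have hc : Tendsto (fun t : ℝ => z + (t : ℂ) • v) (𝓝 0) (𝓝 z) := by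
        simpa using hl.continuousAt.tendsto
      filter_upwards [hc.eventually h2] with t ht
      apply ht
      obtain ⟨y, rfl⟩ := hv
      exact add_mem_range_toC hz ⟨t • y, toC_smul t y⟩
    have h6 : HasDerivAt (fun t : ℝ => (f (z + (t : ℂ) • v)).im) 0 0 :=
      (hasDerivAt_const (0 : ℝ) (0 : ℝ)).congr_of_eventuallyEq h5
    exact h4.unique h6
  periodic := by
    filter_upwards [eventually_far_nhds hf.periodic] with z h1 k
    have h2 : (fun w => f (w + toC (fun j i => 2 * π * k j i, 0))) =ᶠ[𝓝 z] f := by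
      filter_upwards [h1] with w hw
      rw [← shift_eq_add, hw]
    rw [← h2.fderiv_eq, fderiv_comp_add_right, shift_eq_add]

theorem comp (hf : Reg A f) {d : Phase ℂ → Phase ℂ} (hd : RegDisp A d) :
    Reg A fun z => f (z + d z) where
  analytic := by
    filter_upwards [(tendsto_far_add hd.tendsto).eventually hf.analytic, hd.analytic] with z h1 h2
    exact AnalyticAt.comp (f := fun z => z + d z) h1 (analyticAt_id.add h2)
  real := by
    filter_upwards [(tendsto_far_add hd.tendsto).eventually hf.real, hd.real] with z h1 h2 hz
    exact h1 (add_mem_range_toC hz (h2 hz))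
  periodic := by
    filter_upwards [(tendsto_far_add hd.tendsto).eventually hf.periodic, hd.periodic]
      with z h1 h2 k
    rw [h2, ← shift_add, h1]

theorem lineMean (hA : AngleInvariant A) (hf : Reg A f) {κ : ℝ → ℝ} (hκ : Continuous κ)
    (k : Fin 3) (i : Fin 2) : Reg A (lineMean (fun t => (κ t : ℂ)) (angDir k i) f) where
  analytic := by
    obtain ⟨N, hN⟩ := eventually_far.1 hf.analytic
    refine eventually_far.2 ⟨N, analyticOnNhd_lineMean (by fun_prop) isOpen_dom
      (fun z hz t => ?_) hN⟩
    rw [smul_angDir]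
    exact T_translate (angleInvariant_farPart hA N) hz _
  real := by
    filter_upwards [eventually_far_translate hA hf.real] with z h1 hz
    have : ∀ t : ℝ, (κ t : ℂ) • f (z + (t : ℂ) • angDir k i) =
        ((κ t * (f (z + (t : ℂ) • angDir k i)).re : ℝ) : ℂ) := fun t => by
      have h2 : (f (z + (t : ℂ) • angDir k i)).im = 0 := by
        rw [smul_angDir]
        exact h1 _ (add_mem_range_toC hz ⟨_, rfl⟩)
      rw [smul_eq_mul, Complex.ofReal_mul]
      congr 1
      exact Complex.ext rfl h2
    simp only [LunarThreeBody.lineMean, this, intervalIntegral.integral_ofReal, Complex.ofReal_im]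
  periodic := by
    filter_upwards [eventually_far_translate hA hf.periodic] with z h1 j
    simp only [LunarThreeBody.lineMean]
    congr 1
    funext t
    rw [← shift_add, smul_angDir, h1]

end Reg

theorem isBigO_lineMean (hA : AngleInvariant A) {f : Phase ℂ → ℂ} {n : ℤ}
    (hb : f =O[far A] wt n) {κ : ℝ → ℝ} (hκ : Continuous κ) (k : Fin 3) (i : Fin 2) :
    lineMean (fun t => (κ t : ℂ)) (angDir k i) f =O[far A] wt n := by
  obtain ⟨C, hC, h⟩ := hb.exists_pos
  obtain ⟨B, hB⟩ := (isCompact_Icc (a := (0 : ℝ)) (b := 2 * π)).exists_bound_of_continuousOn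
    hκ.continuousOn
  refine IsBigO.of_bound (B * C * |2 * π - 0|) ?_
  filter_upwards [eventually_far_translate hA h.bound] with z hz
  have := intervalIntegral.norm_integral_le_of_norm_le_const (a := 0) (b := 2 * π)
    (f := fun t : ℝ => (κ t : ℂ) • f (z + (t : ℂ) • angDir k i)) (C := B * (C * wt n z)) ?_
  · refine this.trans (le_of_eq ?_)
    rw [Real.norm_of_nonneg (wt_nonneg _ _)]
    ring
  · intro t ht
    rw [uIoc_of_le (by positivity)] at ht
    have h1 := hB t ⟨ht.1.le, ht.2⟩
    rw [smul_angDir, norm_smul, Complex.norm_real]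
    have h2 := hz (t • Pi.single k (Pi.single i 1))
    have h3 : wt n (z + toC (t • Pi.single k (Pi.single i 1), 0)) = wt n z := by
      simp [wt, toC]
    rw [h3, Real.norm_of_nonneg (wt_nonneg _ _)] at h2
    have h4 : 0 ≤ B := (norm_nonneg _).trans h1
    gcongr

/-- The direction v is arbitrary: this also shows that averaging over one angle preserves
independence of the other. -/
theorem fderiv_lineMean_apply (hA : AngleInvariant A) {f : Phase ℂ → ℂ}
    (hf : ∀ᶠ z in far A, AnalyticAt ℂ f z) {κ : ℝ → ℝ} (hκ : Continuous κ) (k : Fin 3)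
    (i : Fin 2) : ∀ᶠ z in far A, ∀ v,
      fderiv ℂ (lineMean (fun t => (κ t : ℂ)) (angDir k i) f) z v =
        lineMean (fun t => (κ t : ℂ)) (angDir k i) (fun w => fderiv ℂ f w v) z := by
  obtain ⟨N, hN⟩ := eventually_far.1 hf
  have hD : ∀ z ∈ dom A N, ∀ t : ℝ, z + (t : ℂ) • angDir k i ∈ dom A N := fun z hz t => by
    rw [smul_angDir]
    exact T_translate (angleInvariant_farPart hA N) hz _
  refine eventually_far.2 ⟨N, fun z hz v => ?_⟩
  have hκ' : Continuous fun t => (κ t : ℂ) := by fun_prop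
  rw [(hasFDerivAt_lineMean hκ' isOpen_dom hD hN hz).fderiv, lineMean, lineMean,
    ContinuousLinearMap.intervalIntegral_apply]
  · rfl
  · refine (Continuous.smul hκ' (continuous_line hD ?_ hz)).intervalIntegrable _ _
    exact (AnalyticOnNhd.fderiv hN).continuousOn

/-- The mean over the angle with index `0`, `i`, that is, over `lᵢ`. -/
def avg (i : Fin 2) (g : Phase ℂ → ℂ) : Phase ℂ → ℂ :=
  lineMean (fun _ => (((2 * π)⁻¹ : ℝ) : ℂ)) (angDir 0 i) g

/-- The mean of `t g(lᵢ + t)` over one period, a primitive of `g` minus its average. -/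
def prim (i : Fin 2) (g : Phase ℂ → ℂ) : Phase ℂ → ℂ :=
  lineMean (fun t => (((2 * π)⁻¹ * t : ℝ) : ℂ)) (angDir 0 i) g

theorem two_pi_smul_angDir (z : Phase ℂ) (k : Fin 3) (i : Fin 2) :
    z + ((2 * π : ℝ) : ℂ) • angDir k i = shift (Pi.single k (Pi.single i 1)) z := by
  ext a c
  · by_cases ha : a = k
    · subst ha
      by_cases hc : c = i
      · subst hc; simp [angDir, shift]
      · simp [angDir, shift, hc]
    · simp [angDir, shift, ha]
  · simp [angDir, shift]

/-- Under the integral stands a total derivative over one period, and f is periodic. -/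
theorem fderiv_avg (hA : AngleInvariant A) {f : Phase ℂ → ℂ} (hf : Reg A f) (i : Fin 2) :
    ∀ᶠ z in far A, fderiv ℂ (avg i f) z (angDir 0 i) = 0 := by
  filter_upwards [fderiv_lineMean_apply hA hf.analytic (continuous_const (y := (2 * π)⁻¹)) 0 i,
    eventually_far_translate hA hf.analytic, hf.periodic] with z h1 h2 h3
  have h2' : ∀ t : ℝ, AnalyticAt ℂ f (z + (t : ℂ) • angDir 0 i) := fun t => by
    rw [smul_angDir]; exact h2 _
  rw [avg, h1, lineMean, intervalIntegral.integral_smul,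
    intervalIntegral.integral_eq_sub_of_hasDerivAt (fun t _ => hasDerivAt_line (h2' t)),
    two_pi_smul_angDir, h3]
  · simp
  · refine Continuous.intervalIntegrable (continuous_iff_continuousAt.2 fun t => ?_) _ _
    have : ContinuousAt (fun w => fderiv ℂ f w (angDir 0 i)) (z + (t : ℂ) • angDir 0 i) :=
      ((h2' t).fderiv.continuousAt).clm_apply continuousAt_const
    exact ContinuousAt.comp (f := fun t : ℝ => z + (t : ℂ) • angDir 0 i) this
      (by fun_prop)

/-- Integration by parts: the boundary term of t f(l + t)/(2π) at t = 2π is f(l) by periodicity, and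
the remaining integral is the mean. -/
theorem fderiv_prim (hA : AngleInvariant A) {f : Phase ℂ → ℂ} (hf : Reg A f) (i : Fin 2) :
    ∀ᶠ z in far A, fderiv ℂ (prim i f) z (angDir 0 i) = f z - avg i f z := by
  filter_upwards [fderiv_lineMean_apply hA hf.analytic
    (κ := fun t => (2 * π)⁻¹ * t) (by fun_prop) 0 i,
    eventually_far_translate hA hf.analytic, hf.periodic] with z h1 h2 h3
  have h2' : ∀ t : ℝ, AnalyticAt ℂ f (z + (t : ℂ) • angDir 0 i) := fun t => by
    rw [smul_angDir]; exact h2 _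
  have hc : Continuous fun t : ℝ => fderiv ℂ f (z + (t : ℂ) • angDir 0 i) (angDir 0 i) := by
    refine continuous_iff_continuousAt.2 fun t => ?_
    have : ContinuousAt (fun w => fderiv ℂ f w (angDir 0 i)) (z + (t : ℂ) • angDir 0 i) :=
      ((h2' t).fderiv.continuousAt).clm_apply continuousAt_const
    exact ContinuousAt.comp (f := fun t : ℝ => z + (t : ℂ) • angDir 0 i) this
      (by fun_prop)
  have hu : ∀ t : ℝ, HasDerivAt (fun t : ℝ => (((2 * π)⁻¹ * t : ℝ) : ℂ))
      (((2 * π)⁻¹ : ℝ) : ℂ) t := fun t => by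
    have := ((hasDerivAt_id t).const_mul (2 * π)⁻¹).ofReal_comp
    simpa using this
  rw [prim, h1, lineMean, avg, lineMean]
  simp only [smul_eq_mul]
  rw [intervalIntegral.integral_mul_deriv_eq_deriv_mul (fun t _ => hu t)
    (fun t _ => hasDerivAt_line (h2' t)) intervalIntegrable_const (hc.intervalIntegrable _ _),
    two_pi_smul_angDir, h3]
  have hpi : (π : ℂ) ≠ 0 := by exact_mod_cast Real.pi_ne_zero
  simp only [Complex.ofReal_zero, mul_zero, zero_mul, sub_zero]
  rw [Complex.ofReal_mul, sub_left_inj]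
  push_cast
  field_simp

end Regular

end LunarThreeBody

namespace LunarThreeBody

open scoped Real Topology
open Set Filter Metric Asymptotics

/-! ## The normal form -/

section NormalForm

variable {A : Set (Phase ℝ)}

/-- The gradient with respect to the angles. -/
def angGrad (K : Phase ℂ → ℂ) (z : Phase ℂ) : Fin 3 → Fin 2 → ℂ :=
  fun k i => fderiv ℂ K z (angDir k i)

/-- The gradient with respect to the actions. -/
def actGrad (K : Phase ℂ → ℂ) (z : Phase ℂ) : Fin 3 → Fin 2 → ℂ :=
  fun k i => fderiv ℂ K z (actDir k i)

/-- The displacement of the actions by the angular gradient. -/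
def actDisp (K : Phase ℂ → ℂ) (z : Phase ℂ) : Phase ℂ := (0, angGrad K z)

/-- The displacement of the angles by the gradient in the actions. -/
def angDisp (K : Phase ℂ → ℂ) (z : Phase ℂ) : Phase ℂ := (actGrad K z, 0)

theorem norm_single_le (k : Fin 3) (i : Fin 2) :
    ‖(Pi.single k (Pi.single i 1) : Fin 3 → Fin 2 → ℂ)‖ ≤ 1 := by
  rw [Pi.norm_single, Pi.norm_single, norm_one]

theorem norm_angDir_le (k : Fin 3) (i : Fin 2) : ‖angDir k i‖ ≤ 1 := by
  simpa [angDir, Prod.norm_def] using norm_single_le k i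

theorem norm_actDir_le (k : Fin 3) (i : Fin 2) : ‖actDir k i‖ ≤ 1 := by
  simpa [actDir, Prod.norm_def] using norm_single_le k i

theorem norm_le_of_coord {v : Fin 3 → Fin 2 → ℂ} {B : ℝ} (hB : 0 ≤ B)
    (h : ∀ k i, ‖v k i‖ ≤ B) : ‖v‖ ≤ B :=
  (pi_norm_le_iff_of_nonneg hB).2 fun k => (pi_norm_le_iff_of_nonneg hB).2 fun i => h k i

theorem norm_apply_le {L : Phase ℂ →L[ℂ] ℂ} {v : Phase ℂ} (hv : ‖v‖ ≤ 1) : ‖L v‖ ≤ ‖L‖ :=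
  (L.le_opNorm v).trans (mul_le_of_le_one_right (norm_nonneg _) hv)

theorem norm_actDisp_le (K : Phase ℂ → ℂ) (z : Phase ℂ) : ‖actDisp K z‖ ≤ ‖fderiv ℂ K z‖ := by
  rw [actDisp, Prod.norm_def, norm_zero, max_eq_right (norm_nonneg _)]
  exact norm_le_of_coord (norm_nonneg _) fun k i => norm_apply_le (norm_angDir_le k i)

theorem norm_angDisp_le (K : Phase ℂ → ℂ) (z : Phase ℂ) : ‖angDisp K z‖ ≤ ‖fderiv ℂ K z‖ := by
  rw [angDisp, Prod.norm_def, norm_zero, max_eq_left (norm_nonneg _)]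
  exact norm_le_of_coord (norm_nonneg _) fun k i => norm_apply_le (norm_actDir_le k i)

theorem isBigO_actDisp {K : Phase ℂ → ℂ} {j : ℤ} (hK : Reg A K) (hb : K =O[far A] wt j) :
    actDisp K =O[far A] wt j :=
  (IsBigO.of_norm_le (norm_actDisp_le K)).trans (isBigO_fderiv hK.analytic hb).norm_left

theorem isBigO_angDisp {K : Phase ℂ → ℂ} {j : ℤ} (hK : Reg A K) (hb : K =O[far A] wt j) :
    angDisp K =O[far A] wt j :=
  (IsBigO.of_norm_le (norm_angDisp_le K)).trans (isBigO_fderiv hK.analytic hb).norm_left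

theorem isBigO_pderiv {K : Phase ℂ → ℂ} {j : ℤ} (hK : Reg A K) (hb : K =O[far A] wt j)
    (k : Fin 3) (i : Fin 2) : (fun z => fderiv ℂ K z (angDir k i)) =O[far A] wt j :=
  (IsBigO.of_norm_le fun _ => norm_apply_le (norm_angDir_le k i)).trans
    (isBigO_fderiv hK.analytic hb).norm_left

theorem analyticAt_pi_pi {f : Phase ℂ → Fin 3 → Fin 2 → ℂ} {z : Phase ℂ}
    (h : ∀ k i, AnalyticAt ℂ (fun z => f z k i) z) : AnalyticAt ℂ f z :=
  analyticAt_pi_iff.2 fun k => analyticAt_pi_iff.2 fun i => h k i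

theorem eventually_all_index {p : Fin 3 → Fin 2 → Phase ℂ → Prop}
    (h : ∀ k i, ∀ᶠ z in far A, p k i z) : ∀ᶠ z in far A, ∀ k i, p k i z :=
  eventually_all.2 fun k => eventually_all.2 fun i => h k i

theorem Reg.actDisp {K : Phase ℂ → ℂ} {j : ℤ} (hK : Reg A K) (hb : K =O[far A] wt j)
    (hj : 0 < j) : RegDisp A (actDisp K) where
  analytic := by
    filter_upwards [eventually_all_index fun k i => (hK.pderiv (angDir_mem_range k i)).analytic]
      with z h
    exact analyticAt_const.prod (analyticAt_pi_pi h)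
  real := by
    filter_upwards [eventually_all_index fun k i => (hK.pderiv (angDir_mem_range k i)).real]
      with z h hz
    exact mem_range_toC.2 ⟨fun k i => rfl, fun k i => h k i hz⟩
  periodic := by
    filter_upwards [eventually_all_index fun k i => (hK.pderiv (angDir_mem_range k i)).periodic]
      with z h k
    ext a c
    · rfl
    · exact h a c k
  tendsto := (isBigO_actDisp hK hb).trans_tendsto (tendsto_wt hj)

theorem Reg.angDisp {K : Phase ℂ → ℂ} {j : ℤ} (hK : Reg A K) (hb : K =O[far A] wt j)
    (hj : 0 < j) : RegDisp A (angDisp K) where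
  analytic := by
    filter_upwards [eventually_all_index fun k i => (hK.pderiv (actDir_mem_range k i)).analytic]
      with z h
    exact (analyticAt_pi_pi h).prod analyticAt_const
  real := by
    filter_upwards [eventually_all_index fun k i => (hK.pderiv (actDir_mem_range k i)).real]
      with z h hz
    exact mem_range_toC.2 ⟨fun k i => h k i hz, fun k i => rfl⟩
  periodic := by
    filter_upwards [eventually_all_index fun k i => (hK.pderiv (actDir_mem_range k i)).periodic]
      with z h k
    ext a c
    · exact h a c k
    · rfl
  tendsto := (isBigO_angDisp hK hb).trans_tendsto (tendsto_wt hj)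

theorem eventually_le_of_tendsto {d : Phase ℂ → Phase ℂ} (hd : Tendsto d (far A) (𝓝 0)) {r : ℝ}
    (hr : 0 < r) : ∀ᶠ z in far A, ‖d z‖ ≤ r := by
  have : ∀ᶠ z in far A, ‖d z‖ < r := by
    simpa using hd.eventually (ball_mem_nhds (0 : Phase ℂ) hr)
  exact this.mono fun _ h => h.le

theorem isBigO_comp_sub {f : Phase ℂ → ℂ} {k j : ℤ} (hf : ∀ᶠ z in far A, AnalyticAt ℂ f z)
    (hb : fderiv ℂ f =O[far A] wt k) {d d' : Phase ℂ → Phase ℂ} (hd : Tendsto d (far A) (𝓝 0))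
    (hd' : Tendsto d' (far A) (𝓝 0)) (hdd : (fun z => d' z - d z) =O[far A] wt j) :
    (fun z => f (z + d' z) - f (z + d z)) =O[far A] wt (k + j) := by
  obtain ⟨C, hC, r, hr, h⟩ := exists_lipschitz hf hb
  have h1 : (fun z => f (z + d' z) - f (z + d z)) =O[far A] fun z => wt k z * ‖d' z - d z‖ := by
    refine IsBigO.of_bound C ?_
    filter_upwards [h, eventually_le_of_tendsto hd hr, eventually_le_of_tendsto hd' hr]
      with z h1 h2 h3
    rw [Real.norm_of_nonneg (mul_nonneg (wt_nonneg _ _) (norm_nonneg _)), ← mul_assoc]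
    exact h1 _ _ h2 h3
  exact h1.trans (((isBigO_refl _ _).mul hdd.norm_left).congr' EventuallyEq.rfl (wt_mul k j))

/-- The three exponents are those of the derivative of f, of the size of the displacements, and of
their difference. -/
theorem isBigO_comp_taylor {f : Phase ℂ → ℂ} {k l j : ℤ} (hl : 0 < l)
    (hf : ∀ᶠ z in far A, AnalyticAt ℂ f z)
    (hb : fderiv ℂ f =O[far A] wt k) {d d' : Phase ℂ → Phase ℂ} (hd : d =O[far A] wt l)
    (hd' : d' =O[far A] wt l) (hdd : (fun z => d' z - d z) =O[far A] wt j) :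
    (fun z => f (z + d' z) - f (z + d z) - fderiv ℂ f z (d' z - d z)) =O[far A]
      wt (k + l + j) := by
  obtain ⟨C, hC, r, hr, h⟩ := exists_taylor hf hb
  obtain ⟨B, hB, hB1⟩ := hd.exists_pos
  obtain ⟨B', hB', hB2⟩ := hd'.exists_pos
  have ht : ∀ᶠ z in far A, (B + B') * wt l z < r := by
    have := (tendsto_wt (A := A) hl).const_mul (B + B')
    rw [mul_zero] at this
    exact this.eventually (gt_mem_nhds hr)
  have h1 : (fun z => f (z + d' z) - f (z + d z) - fderiv ℂ f z (d' z - d z)) =O[far A]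
      fun z => wt k z * wt l z * ‖d' z - d z‖ := by
    refine IsBigO.of_bound (C * (B + B')) ?_
    filter_upwards [h, hB1.bound, hB2.bound, ht] with z h1 h2 h3 h4
    have hw := wt_nonneg l z
    rw [Real.norm_of_nonneg hw] at h2 h3
    rw [Real.norm_of_nonneg (mul_nonneg (mul_nonneg (wt_nonneg _ _) hw) (norm_nonneg _))]
    refine (h1 _ _ _ h4.le (h2.trans ?_) (h3.trans ?_)).trans (le_of_eq (by ring))
    · nlinarith
    · nlinarith
  refine h1.trans ?_
  refine ((((isBigO_refl _ _).mul (isBigO_refl _ _)).congr' EventuallyEq.rfl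
    (wt_mul k l)).mul hdd.norm_left).congr' EventuallyEq.rfl (wt_mul (k + l) j)

/-- The Kepler energy `-c / (2 Lᵢ²)`. -/
def keplerE (c : Fin 2 → ℝ) (i : Fin 2) (z : Phase ℂ) : ℂ := -(c i : ℂ) / (2 * z.2 0 i ^ 2)

/-- The Kepler frequency `c / Lᵢ³`. -/
def freq (c : Fin 2 → ℝ) (i : Fin 2) (z : Phase ℂ) : ℂ := (c i : ℂ) * (z.2 0 i ^ 3)⁻¹

/-- The Kepler period `Lᵢ³ / c` (up to the factor `2π`). -/
def period (c : Fin 2 → ℝ) (i : Fin 2) (z : Phase ℂ) : ℂ := ((c i)⁻¹ : ℝ) * z.2 0 i ^ 3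

/-- The coordinate `Lᵢ` as a continuous linear map. -/
def coordL (i : Fin 2) : Phase ℂ →L[ℂ] ℂ :=
  (ContinuousLinearMap.proj (R := ℂ) (φ := fun _ : Fin 2 => ℂ) i).comp
    ((ContinuousLinearMap.proj (R := ℂ) (φ := fun _ : Fin 3 => Fin 2 → ℂ) 0).comp
    (ContinuousLinearMap.snd ℂ (Fin 3 → Fin 2 → ℂ) (Fin 3 → Fin 2 → ℂ)))

@[simp]
theorem coordL_apply (i : Fin 2) (z : Phase ℂ) : coordL i z = z.2 0 i := rfl

theorem hasFDerivAt_keplerE (c : Fin 2 → ℝ) (i : Fin 2) {z : Phase ℂ} (hz : z.2 0 i ≠ 0) :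
    HasFDerivAt (keplerE c i) (freq c i z • coordL i) z := by
  have h1 : HasDerivAt (fun L : ℂ => -(c i : ℂ) / (2 * L ^ 2)) (freq c i z) (coordL i z) := by
    have h2 : HasDerivAt (fun L : ℂ => 2 * L ^ 2) (2 * (2 * z.2 0 i)) (z.2 0 i) := by
      simpa using ((hasDerivAt_pow 2 (z.2 0 i)).const_mul 2)
    have h3 := (hasDerivAt_const (z.2 0 i) (-(c i : ℂ))).div h2
      (mul_ne_zero two_ne_zero (pow_ne_zero 2 hz))
    have h4 : freq c i z = (0 * (2 * z.2 0 i ^ 2) - -(c i : ℂ) * (2 * (2 * z.2 0 i))) /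
        (2 * z.2 0 i ^ 2) ^ 2 := by
      rw [freq]
      field_simp
      ring
    rw [h4]
    exact h3
  have := h1.comp_hasFDerivAt z (coordL i).hasFDerivAt
  exact this

/-- The Kepler energy sees only the component of the displacement along its own `L`, so the order of
that single component governs the estimate. -/
theorem keplerE_add (c : Fin 2 → ℝ) (i : Fin 2) (z v : Phase ℂ) :
    keplerE c i (z + v) = keplerE c i (z + (v.2 0 i) • actDir 0 i) := by
  simp [keplerE, actDir]

variable (A) in
/-- The inner action `L₁` is bounded and bounded away from zero. -/
def InnerBounded : Prop := ∃ a > 0, ∃ B, ∀ x ∈ A, a < x.2 0 0 ∧ x.2 0 0 < B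

theorem InnerBounded.eventually (h : InnerBounded A) :
    ∃ a > 0, ∃ B > 0, ∀ᶠ z in far A, a ≤ ‖z.2 0 0‖ ∧ ‖z.2 0 0‖ ≤ B := by
  obtain ⟨a, ha, B, hB⟩ := h
  obtain ⟨N, hN⟩ := exists_nat_gt (2 / a)
  refine ⟨a / 2, by positivity, |B| + a, by positivity, eventually_far.2 ⟨N, fun z hz => ?_⟩⟩
  obtain ⟨x, hx, hxz⟩ := mem_T.1 hz
  have h1 := (norm_coord_le (z - toC x) 0 0).trans_lt hxz
  have h2 : 1 / ((N : ℝ) + 1) ≤ a / 2 := by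
    rw [div_le_div_iff₀ (by positivity) two_pos]
    rw [div_lt_iff₀ ha] at hN
    nlinarith
  have h3 : ‖z.2 0 0 - (x.2 0 0 : ℂ)‖ < a / 2 := h1.trans_le h2
  obtain ⟨h4, h5⟩ := hB x hx.1
  have h6 : ‖(x.2 0 0 : ℂ)‖ = x.2 0 0 := by
    rw [Complex.norm_real, Real.norm_of_nonneg (by linarith)]
  have h7 := norm_sub_norm_le (x.2 0 0 : ℂ) (z.2 0 0)
  have h8 := norm_sub_norm_le (z.2 0 0) (x.2 0 0 : ℂ)
  rw [norm_sub_rev] at h7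
  constructor
  · linarith
  · linarith [le_abs_self B]

theorem eventually_L_ne (h : InnerBounded A) (i : Fin 2) : ∀ᶠ z in far A, z.2 0 i ≠ 0 := by
  fin_cases i
  · obtain ⟨a, ha, B, -, hB⟩ := h.eventually
    filter_upwards [hB] with z hz h0
    simp only [Fin.zero_eta] at h0
    rw [h0, norm_zero] at hz
    linarith [hz.1]
  · filter_upwards [eventually_norm_gt 0] with z hz
    exact norm_pos_iff.1 hz

theorem reg_period (c : Fin 2 → ℝ) (i : Fin 2) : Reg A (period c i) :=
  (Reg.const _).mul ((Reg.action 0 i).pow 3)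

theorem reg_keplerE (h : InnerBounded A) (c : Fin 2 → ℝ) (i : Fin 2) : Reg A (keplerE c i) := by
  have := (Reg.const (A := A) (-(c i) / 2)).mul (((Reg.action 0 i).pow 2).inv
    ((eventually_L_ne h i).mono fun _ hz => pow_ne_zero 2 hz))
  convert this using 2 with z
  rw [keplerE]
  push_cast
  rw [div_mul_eq_div_div, div_eq_mul_inv]

/-- The order of the frequencies: `ν₁` is of order `0`, `ν₂` of order `3`. -/
def freqOrder (i : Fin 2) : ℤ := ![0, 3] i

theorem isBigO_freq (h : InnerBounded A) (c : Fin 2 → ℝ) (i : Fin 2) :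
    freq c i =O[far A] wt (freqOrder i) := by
  fin_cases i
  · obtain ⟨a, ha, B, -, hB⟩ := h.eventually
    refine IsBigO.of_bound (|c 0| * (a ^ 3)⁻¹) ?_
    filter_upwards [hB] with z hz
    simp only [Fin.zero_eta, freq, wt, freqOrder, norm_mul, norm_inv, norm_pow, Complex.norm_real,
      Real.norm_eq_abs, Matrix.cons_val_zero, neg_zero, zpow_zero, norm_one, mul_one]
    gcongr
    exact hz.1
  · refine IsBigO.of_bound |c 1| (Eventually.of_forall fun z => ?_)
    simp only [Fin.mk_one, freq, wt, freqOrder, norm_mul, norm_inv, norm_pow, Complex.norm_real,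
      Real.norm_eq_abs, Matrix.cons_val_one, norm_zpow, abs_norm]
    rw [zpow_neg]
    rfl

theorem isBigO_period (h : InnerBounded A) (c : Fin 2 → ℝ) (i : Fin 2) :
    period c i =O[far A] wt (-freqOrder i) := by
  fin_cases i
  · obtain ⟨a, ha, B, hB0, hB⟩ := h.eventually
    refine IsBigO.of_bound (|(c 0)⁻¹| * B ^ 3) ?_
    filter_upwards [hB] with z hz
    simp only [Fin.zero_eta, period, wt, freqOrder, norm_mul, norm_pow, Complex.norm_real,
      Real.norm_eq_abs, Matrix.cons_val_zero, neg_zero, zpow_zero, norm_one, mul_one]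
    gcongr
    exact hz.2
  · refine IsBigO.of_bound |(c 1)⁻¹| (Eventually.of_forall fun z => ?_)
    simp only [Fin.mk_one, period, wt, freqOrder, norm_mul, norm_pow, Complex.norm_real,
      Real.norm_eq_abs, Matrix.cons_val_one, norm_zpow, neg_neg, abs_norm]
    rfl

theorem isBigO_fderiv_keplerE (h : InnerBounded A) (c : Fin 2 → ℝ) (i : Fin 2) :
    fderiv ℂ (keplerE c i) =O[far A] wt (freqOrder i) := by
  refine IsBigO.trans (IsBigO.of_bound ‖coordL i‖ ?_) (isBigO_freq h c i)
  filter_upwards [eventually_L_ne h i] with z hz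
  rw [(hasFDerivAt_keplerE c i hz).fderiv, norm_smul, mul_comm]

theorem freq_mul_period (h : InnerBounded A) {c : Fin 2 → ℝ} (hc : ∀ i, c i ≠ 0) (i : Fin 2) :
    ∀ᶠ z in far A, freq c i z * period c i z = 1 := by
  filter_upwards [eventually_L_ne h i] with z hz
  have : (c i : ℂ) ≠ 0 := by exact_mod_cast hc i
  rw [freq, period]
  push_cast
  field_simp

/-- The period depends on the actions only, so it acts as a constant for derivatives along the
angles. -/
theorem fderiv_period_mul {c : Fin 2 → ℝ} {i : Fin 2} {p : Phase ℂ → ℂ} {z : Phase ℂ}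
    (hp : AnalyticAt ℂ p z) (k : Fin 3) (j : Fin 2) :
    fderiv ℂ (fun z => -(period c i z * p z)) z (angDir k j) =
      -(period c i z * fderiv ℂ p z (angDir k j)) := by
  have h1 : HasFDerivAt (period c i)
      (((((c i)⁻¹ : ℝ) : ℂ) * (3 * z.2 0 i ^ 2)) • coordL i) z := by
    have h2 : HasDerivAt (fun L : ℂ => (((c i)⁻¹ : ℝ) : ℂ) * L ^ 3)
        ((((c i)⁻¹ : ℝ) : ℂ) * (3 * z.2 0 i ^ 2)) (coordL i z) := by
      simpa using ((hasDerivAt_pow 3 (z.2 0 i)).const_mul (((c i)⁻¹ : ℝ) : ℂ))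
    exact h2.comp_hasFDerivAt z (coordL i).hasFDerivAt
  have h3 := (h1.mul hp.differentiableAt.hasFDerivAt).neg
  have h4 : fderiv ℂ (fun z => -(period c i z * p z)) z = _ := h3.fderiv
  rw [h4]
  simp [angDir]

/-- The defect in the Hamilton-Jacobi equation of the generating function `K` and the normal
form `Z`. -/
def defect (c : Fin 2 → ℝ) (f K Z : Phase ℂ → ℂ) (z : Phase ℂ) : ℂ :=
  keplerE c 0 (z + actDisp K z) + keplerE c 1 (z + actDisp K z) + f (z + actDisp K z)
    - (keplerE c 0 z + keplerE c 1 z) - Z (z + angDisp K z)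

variable (A) in
/-- `K` and `Z` solve the Hamilton-Jacobi equation up to the order `3n + 6`. -/
structure IsNormalForm (c : Fin 2 → ℝ) (f : Phase ℂ → ℂ) (n : ℕ) (K Z : Phase ℂ → ℂ) : Prop where
  regK : Reg A K
  ordK : K =O[far A] wt 3
  ordK' : (fun z => fderiv ℂ K z (angDir 0 0)) =O[far A] wt 6
  regZ : Reg A Z
  ordZ : Z =O[far A] wt 6
  indep : ∀ i, ∀ᶠ z in far A, fderiv ℂ Z z (angDir 0 i) = 0
  ord : defect c f K Z =O[far A] wt (3 * n + 6)

theorem reg_defect (h : InnerBounded A) {c : Fin 2 → ℝ} {f K Z : Phase ℂ → ℂ} (hf : Reg A f)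
    (hK : Reg A K) (hK' : K =O[far A] wt 3) (hZ : Reg A Z) : Reg A (defect c f K Z) :=
  have hj := hK.actDisp hK' (by norm_num)
  have hi := hK.angDisp hK' (by norm_num)
  (((((reg_keplerE h c 0).comp hj).add ((reg_keplerE h c 1).comp hj)).add (hf.comp hj)).sub
    ((reg_keplerE h c 0).add (reg_keplerE h c 1))).sub (hZ.comp hi)

/-- With nothing removed yet, the defect is the perturbation itself. -/
theorem isNormalForm_zero (c : Fin 2 → ℝ) {f : Phase ℂ → ℂ} (hf' : f =O[far A] wt 6) :
    IsNormalForm A c f 0 (fun _ => 0) (fun _ => 0) where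
  regK := by simpa using Reg.const (A := A) 0
  ordK := isBigO_zero _ _
  ordK' := by simpa using isBigO_zero (wt 6) (far A)
  regZ := by simpa using Reg.const (A := A) 0
  ordZ := isBigO_zero _ _
  indep i := by simp
  ord := by
    have h0 : ∀ z, actDisp (fun _ => 0) z = 0 := fun z => by
      ext k i <;> simp [actDisp, angGrad]
    have : defect c f (fun _ => 0) (fun _ => 0) = f := by
      funext z; simp [defect, h0]
    rw [this]
    simpa using hf'

end NormalForm

end LunarThreeBody

namespace LunarThreeBody

open scoped Real Topology
open Set Filter Metric Asymptotics

/-! ### Improving the normal form by three orders -/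

section NormalFormStep

variable {A : Set (Phase ℝ)}

theorem isBigO_of_le {f : Phase ℂ → ℂ} {j k : ℤ} (hf : f =O[far A] wt k) (h : j ≤ k) :
    f =O[far A] wt j := hf.trans (isBigO_wt_of_le h)

theorem lineMean_eq_zero {k : ℝ → ℂ} {e : Phase ℂ} {g : Phase ℂ → ℂ} {z : Phase ℂ}
    (h : ∀ t : ℝ, g (z + (t : ℂ) • e) = 0) : lineMean k e g z = 0 := by
  simp only [lineMean, h, smul_zero, intervalIntegral.integral_zero]

theorem actDisp_add {K κ : Phase ℂ → ℂ} (hK : Reg A K) (hκ : Reg A κ) :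
    ∀ᶠ z in far A, actDisp (fun z => K z + κ z) z = actDisp K z + actDisp κ z := by
  filter_upwards [hK.analytic, hκ.analytic] with z h1 h2
  have : fderiv ℂ (fun z => K z + κ z) z = fderiv ℂ K z + fderiv ℂ κ z :=
    fderiv_add h1.differentiableAt h2.differentiableAt
  ext k i <;> simp [actDisp, angGrad, this]

theorem angDisp_add {K κ : Phase ℂ → ℂ} (hK : Reg A K) (hκ : Reg A κ) :
    ∀ᶠ z in far A, angDisp (fun z => K z + κ z) z = angDisp K z + angDisp κ z := by
  filter_upwards [hK.analytic, hκ.analytic] with z h1 h2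
  have : fderiv ℂ (fun z => K z + κ z) z = fderiv ℂ K z + fderiv ℂ κ z :=
    fderiv_add h1.differentiableAt h2.differentiableAt
  ext k i <;> simp [angDisp, actGrad, this]

/-- The change of a Kepler energy under a change `κ` of the generating function is, to first order,
the derivative of `κ` along the Kepler flow. -/
theorem isBigO_keplerE_step (h : InnerBounded A) (c : Fin 2 → ℝ) (i : Fin 2) {l j : ℤ}
    (hl : 0 < l) {K κ : Phase ℂ → ℂ} (hK : Reg A K) (hκ : Reg A κ)
    (h1 : (fun z => fderiv ℂ K z (angDir 0 i)) =O[far A] wt l)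
    (h2 : (fun z => fderiv ℂ κ z (angDir 0 i)) =O[far A] wt l)
    (h3 : (fun z => fderiv ℂ κ z (angDir 0 i)) =O[far A] wt j) :
    (fun z => keplerE c i (z + actDisp (fun z => K z + κ z) z) - keplerE c i (z + actDisp K z)
      - freq c i z * fderiv ℂ κ z (angDir 0 i)) =O[far A] wt (freqOrder i + l + j) := by
  have hs : ∀ {g : Phase ℂ → ℂ} {k : ℤ}, g =O[far A] wt k →
      (fun z => g z • actDir 0 i) =O[far A] wt k := fun {g k} hg => by
    refine (IsBigO.of_bound 1 (Eventually.of_forall fun z => ?_)).trans hg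
    rw [norm_smul, one_mul]
    exact mul_le_of_le_one_right (norm_nonneg _) (norm_actDir_le 0 i)
  -- Both displacements are replaced by their component along `L` before Taylor's formula is
  -- applied.
  have key := isBigO_comp_taylor (A := A) (f := keplerE c i) (j := j) hl
    (reg_keplerE h c i).analytic (isBigO_fderiv_keplerE h c i)
    (d := fun z => fderiv ℂ K z (angDir 0 i) • actDir 0 i)
    (d' := fun z => (fderiv ℂ K z (angDir 0 i) + fderiv ℂ κ z (angDir 0 i)) • actDir 0 i)
    (hs h1) (hs (h1.add h2)) (by
      have := hs h3
      refine this.congr_left fun z => ?_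
      rw [← sub_smul, add_sub_cancel_left])
  refine key.congr' ?_ EventuallyEq.rfl
  filter_upwards [actDisp_add hK hκ, eventually_L_ne h i] with z hz hz0
  rw [hz, keplerE_add c i z (actDisp K z + actDisp κ z), keplerE_add c i z (actDisp K z),
    (hasFDerivAt_keplerE c i hz0).fderiv]
  simp [actDisp, angGrad, actDir]

/-- The defect R is split as (R − R₁) + (R₁ − ζ) + ζ with R₁ its mean over l₁ and ζ the mean of R₁
over l₂. Dividing primitives by the frequencies gives κ₁ of order 3n + 6, since ν₁ has order 0, and
κ₂ of order 3n + 3, since ν₂ has order 3. They satisfy ν₁ ∂κ₁/∂l₁ = −(R − R₁) and ν₂ ∂κ₂/∂l₂ = −(R₁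
− ζ), so K + κ and Z + ζ cancel R to first order. All the remaining terms have order at least 3n +
9. -/
theorem IsNormalForm.succ (hA : AngleInvariant A) (h : InnerBounded A) {c : Fin 2 → ℝ}
    (hc : ∀ i, c i ≠ 0) {f : Phase ℂ → ℂ} (hf : Reg A f) (hf' : f =O[far A] wt 6) {n : ℕ}
    {K Z : Phase ℂ → ℂ} (hn : IsNormalForm A c f n K Z) :
    ∃ K' Z', IsNormalForm A c f (n + 1) K' Z' := by
  set R := defect c f K Z with hR
  have regR : Reg A R := reg_defect h hf hn.regK hn.ordK hn.regZ
  have ordR : R =O[far A] wt (3 * n + 6) := hn.ord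
  have ctsμ : Continuous fun _ : ℝ => (2 * π)⁻¹ := continuous_const
  have ctsι : Continuous fun t : ℝ => (2 * π)⁻¹ * t := by fun_prop
  set R₁ := avg 0 R
  have regR₁ : Reg A R₁ := regR.lineMean hA ctsμ 0 0
  have ordR₁ : R₁ =O[far A] wt (3 * n + 6) := isBigO_lineMean hA ordR ctsμ 0 0
  set ζ := avg 1 R₁
  have regζ : Reg A ζ := regR₁.lineMean hA ctsμ 0 1
  have ordζ : ζ =O[far A] wt (3 * n + 6) := isBigO_lineMean hA ordR₁ ctsμ 0 1
  set p₁ := prim 0 R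
  have regp₁ : Reg A p₁ := regR.lineMean hA ctsι 0 0
  have ordp₁ : p₁ =O[far A] wt (3 * n + 6) := isBigO_lineMean hA ordR ctsι 0 0
  set p₂ := prim 1 R₁
  have regp₂ : Reg A p₂ := regR₁.lineMean hA ctsι 0 1
  have ordp₂ : p₂ =O[far A] wt (3 * n + 6) := isBigO_lineMean hA ordR₁ ctsι 0 1
  set κ₁ : Phase ℂ → ℂ := fun z => -(period c 0 z * p₁ z) with hκ₁
  set κ₂ : Phase ℂ → ℂ := fun z => -(period c 1 z * p₂ z) with hκ₂
  have regκ₁ : Reg A κ₁ := ((reg_period c 0).mul regp₁).neg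
  have regκ₂ : Reg A κ₂ := ((reg_period c 1).mul regp₂).neg
  have ordκ₁ : κ₁ =O[far A] wt (3 * n + 6) := by
    have := (IsBigO.wt_mul (isBigO_period h c 0) ordp₁).neg_left
    have e : -freqOrder 0 + (3 * (n : ℤ) + 6) = 3 * n + 6 := by simp [freqOrder]
    rwa [e] at this
  -- The long outer period L₂³/c loses three orders here.
  have ordκ₂ : κ₂ =O[far A] wt (3 * n + 3) := by
    have := (IsBigO.wt_mul (isBigO_period h c 1) ordp₂).neg_left
    have e : -freqOrder 1 + (3 * (n : ℤ) + 6) = 3 * n + 3 := by simp [freqOrder]; ring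
    rwa [e] at this
  set κ : Phase ℂ → ℂ := fun z => κ₁ z + κ₂ z with hκ
  have regκ : Reg A κ := regκ₁.add regκ₂
  have ordκ : κ =O[far A] wt (3 * n + 3) := (isBigO_of_le ordκ₁ (by omega)).add ordκ₂
  -- derivatives along the fast angles
  have dκ : ∀ᶠ z in far A, ∀ v, fderiv ℂ κ z v = fderiv ℂ κ₁ z v + fderiv ℂ κ₂ z v := by
    filter_upwards [regκ₁.analytic, regκ₂.analytic] with z h1 h2 v
    have : fderiv ℂ κ z = fderiv ℂ κ₁ z + fderiv ℂ κ₂ z :=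
      fderiv_add h1.differentiableAt h2.differentiableAt
    rw [this]; rfl
  have dR₁ := fderiv_avg hA regR 0
  -- κ₂ inherits the independence of l₁ from R₁. So the larger correction κ₂ never meets the fast
  -- frequency ν₁, and the l₁-derivative of κ keeps the order 3n + 6.
  have d0κ₂ : ∀ᶠ z in far A, fderiv ℂ κ₂ z (angDir 0 0) = 0 := by
    filter_upwards [regp₂.analytic, fderiv_lineMean_apply hA regR₁.analytic ctsι 0 1,
      eventually_far_translate hA dR₁] with z h1 h2 h3
    rw [hκ₂, fderiv_period_mul h1]
    have : fderiv ℂ p₂ z (angDir 0 0) = 0 := by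
      change fderiv ℂ (lineMean _ _ _) z _ = 0
      rw [h2]
      exact lineMean_eq_zero fun t => by rw [smul_angDir]; exact h3 _
    rw [this]; simp
  have d0κ : ∀ᶠ z in far A, fderiv ℂ κ z (angDir 0 0) = -(period c 0 z * (R z - R₁ z)) := by
    filter_upwards [dκ, d0κ₂, regp₁.analytic, fderiv_prim hA regR 0] with z h1 h2 h3 h4
    rw [h1, h2, add_zero, hκ₁, fderiv_period_mul h3, h4]
  have d1κ₂ : ∀ᶠ z in far A, fderiv ℂ κ₂ z (angDir 0 1) = -(period c 1 z * (R₁ z - ζ z)) := by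
    filter_upwards [regp₂.analytic, fderiv_prim hA regR₁ 1] with z h3 h4
    rw [hκ₂, fderiv_period_mul h3, h4]
  have o0κ : (fun z => fderiv ℂ κ z (angDir 0 0)) =O[far A] wt (3 * n + 6) := by
    have := isBigO_pderiv regκ₁ ordκ₁ 0 0
    refine this.congr' ?_ EventuallyEq.rfl
    filter_upwards [dκ, d0κ₂] with z h1 h2
    rw [h1, h2, add_zero]
  have o1κ : (fun z => fderiv ℂ κ z (angDir 0 1)) =O[far A] wt (3 * n + 3) :=
    isBigO_pderiv regκ ordκ 0 1
  -- the five contributions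
  have t0 := isBigO_keplerE_step h c 0 (l := 6) (by norm_num) hn.regK regκ hn.ordK'
    (isBigO_of_le o0κ (by omega)) o0κ
  have t1 := isBigO_keplerE_step h c 1 (l := 3) (by norm_num) hn.regK regκ
    (isBigO_pderiv hn.regK hn.ordK 0 1) (isBigO_of_le o1κ (by omega)) o1κ
  set K' : Phase ℂ → ℂ := fun z => K z + κ z with hK'
  have regK' : Reg A K' := hn.regK.add regκ
  have ordK' : K' =O[far A] wt 3 := hn.ordK.add (isBigO_of_le ordκ (by omega))
  have jK := hn.regK.actDisp hn.ordK (by norm_num)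
  have jK' := regK'.actDisp ordK' (by norm_num)
  have iK := hn.regK.angDisp hn.ordK (by norm_num)
  have iK' := regK'.angDisp ordK' (by norm_num)
  have t2 := isBigO_comp_sub (j := 3 * n + 3) hf.analytic (isBigO_fderiv hf.analytic hf')
    jK.tendsto jK'.tendsto
    ((isBigO_actDisp regκ ordκ).congr' (by
      filter_upwards [actDisp_add hn.regK regκ] with z hz
      rw [hz, add_sub_cancel_left]) EventuallyEq.rfl)
  have t3 := isBigO_comp_sub (j := 3 * n + 3) hn.regZ.analytic
    (isBigO_fderiv hn.regZ.analytic hn.ordZ) iK.tendsto iK'.tendsto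
    ((isBigO_angDisp regκ ordκ).congr' (by
      filter_upwards [angDisp_add hn.regK regκ] with z hz
      rw [hz, add_sub_cancel_left]) EventuallyEq.rfl)
  -- The new term of Z is evaluated at the displaced angles, whereas the linear equation subtracts
  -- it at z.
  have t4 := isBigO_comp_sub (j := 3) regζ.analytic (isBigO_fderiv regζ.analytic ordζ)
    (d := fun _ => 0) (d' := angDisp K') tendsto_const_nhds iK'.tendsto
    (by simpa using isBigO_angDisp regK' ordK')
  -- The term ν₂ ∂κ₁/∂l₂ is not cancelled. It has order 3 + (3n + 6) because ν₂ is small; this is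
  -- where the asynchrony of the two motions enters.
  have t5 := IsBigO.wt_mul (isBigO_freq h c 1) (isBigO_pderiv regκ₁ ordκ₁ 0 1)
  have e : (3 * ((n + 1 : ℕ) : ℤ) + 6) = 3 * n + 9 := by push_cast; ring
  refine ⟨K', fun z => Z z + ζ z, regK', ordK', ?_, hn.regZ.add regζ,
    hn.ordZ.add (isBigO_of_le ordζ (by omega)), fun i => ?_, ?_⟩
  · refine (hn.ordK'.add (isBigO_of_le o0κ (by omega))).congr' ?_ EventuallyEq.rfl
    filter_upwards [hn.regK.analytic, regκ.analytic] with z h1 h2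
    have : fderiv ℂ K' z = fderiv ℂ K z + fderiv ℂ κ z :=
      fderiv_add h1.differentiableAt h2.differentiableAt
    rw [this]; rfl
  · have hζ : ∀ᶠ z in far A, fderiv ℂ ζ z (angDir 0 i) = 0 := by
      fin_cases i
      · filter_upwards [fderiv_lineMean_apply hA regR₁.analytic ctsμ 0 1,
          eventually_far_translate hA dR₁] with z h2 h3
        change fderiv ℂ (lineMean _ _ _) z _ = 0
        rw [h2]
        exact lineMean_eq_zero fun t => by rw [smul_angDir]; exact h3 _
      · exact fderiv_avg hA regR₁ 1
    filter_upwards [hn.indep i, hζ, hn.regZ.analytic, regζ.analytic] with z h1 h2 h3 h4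
    have : fderiv ℂ (fun z => Z z + ζ z) z = fderiv ℂ Z z + fderiv ℂ ζ z :=
      fderiv_add h3.differentiableAt h4.differentiableAt
    rw [this]
    simp [h1, h2]
  · rw [e]
    have s0 := isBigO_of_le (j := 3 * n + 9) t0 (by simp [freqOrder]; omega)
    have s1 := isBigO_of_le (j := 3 * n + 9) t1 (by simp [freqOrder]; omega)
    have s2 := isBigO_of_le (j := 3 * n + 9) t2 (by omega)
    have s3 := isBigO_of_le (j := 3 * n + 9) t3 (by omega)
    have s4 := isBigO_of_le (j := 3 * n + 9) t4 (by omega)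
    have s5 := isBigO_of_le (j := 3 * n + 9) t5 (by simp [freqOrder]; omega)
    refine ((((s0.add s1).add s2).sub s3).sub s4 |>.add s5).congr' ?_ EventuallyEq.rfl
    -- The linear parts cancel: R − (R − R₁) − (R₁ − ζ) − ζ = 0.
    filter_upwards [d0κ, d1κ₂, dκ, freq_mul_period h hc 0, freq_mul_period h hc 1]
      with z h1 h2 h3 h4 h5
    have e0 : freq c 0 z * fderiv ℂ κ z (angDir 0 0) = -(R z - R₁ z) := by
      rw [h1]; linear_combination -(R z - R₁ z) * h4
    have e1 : freq c 1 z * fderiv ℂ κ z (angDir 0 1) =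
        freq c 1 z * fderiv ℂ κ₁ z (angDir 0 1) - (R₁ z - ζ z) := by
      rw [h3, h2]; linear_combination -(R₁ z - ζ z) * h5
    have eR : R z = keplerE c 0 (z + actDisp K z) + keplerE c 1 (z + actDisp K z)
      + f (z + actDisp K z) - (keplerE c 0 z + keplerE c 1 z) - Z (z + angDisp K z) := rfl
    rw [e0, e1, eR, defect, add_zero]
    ring

/-- The Hamilton-Jacobi equation can be solved to any order. -/
theorem exists_isNormalForm (hA : AngleInvariant A) (h : InnerBounded A) {c : Fin 2 → ℝ}
    (hc : ∀ i, c i ≠ 0) {f : Phase ℂ → ℂ} (hf : Reg A f) (hf' : f =O[far A] wt 6) (n : ℕ) :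
    ∃ K Z, IsNormalForm A c f n K Z := by
  induction n with
  | zero => exact ⟨_, _, isNormalForm_zero c hf'⟩
  | succ n ih =>
    obtain ⟨K, Z, hn⟩ := ih
    exact hn.succ hA h hc hf hf'

end NormalFormStep

end LunarThreeBody

namespace LunarThreeBody

open scoped Real Topology NNReal ContDiff
open Set Filter Metric Asymptotics

/-! ## The symplectic map of a generating function -/

section LocalInverse

variable {E F : Type} [NormedAddCommGroup E] [NormedSpace ℂ E] [CompleteSpace E]
  [NormedAddCommGroup F] [NormedSpace ℂ F] [CompleteSpace F]

theorem exists_analytic_localInverse {f : E → F} {a : E} {f' : E ≃L[ℂ] F} (hf : AnalyticAt ℂ f a)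
    (hf' : HasFDerivAt f (f' : E →L[ℂ] F) a) :
    ∃ g : F → E, AnalyticAt ℂ g (f a) ∧ g (f a) = a ∧ ∀ᶠ y in 𝓝 (f a), f (g y) = y := by
  have hc : ContDiffAt ℂ ω f a := hf.contDiffAt
  refine ⟨hc.localInverse hf' (by simp), (hc.to_localInverse hf' (by simp)).analyticAt,
    hc.localInverse_apply_image hf' (by simp),
    (hc.hasStrictFDerivAt' hf' (by simp)).eventually_right_inverse⟩

theorem exists_equiv_one_add (L : E →L[ℂ] E) (hL : ‖L‖ < 1) :
    ∃ e : E ≃L[ℂ] E, (e : E →L[ℂ] E) = ContinuousLinearMap.id ℂ E + L := by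
  have h : ‖-L‖ < 1 := by rwa [norm_neg]
  refine ⟨ContinuousLinearEquiv.unitsEquiv ℂ E (Units.oneSub (-L) h), ?_⟩
  ext v
  simp

end LocalInverse

section Generating

variable {A : Set (Phase ℝ)}

/-- The linear map that sends a covector to the vector of its components along the actions,
in the place of the angles. -/
def actPart : (Phase ℂ →L[ℂ] ℂ) →L[ℂ] Phase ℂ :=
  LinearMap.toContinuousLinearMap
    { toFun := fun L => (fun k i => L (actDir k i), 0)
      map_add' := fun L L' => by ext <;> simp
      map_smul' := fun c L => by ext <;> simp }

/-- The linear map that sends a covector to the vector of its components along the angles,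
in the place of the actions. -/
def angPart : (Phase ℂ →L[ℂ] ℂ) →L[ℂ] Phase ℂ :=
  LinearMap.toContinuousLinearMap
    { toFun := fun L => (0, fun k i => L (angDir k i))
      map_add' := fun L L' => by ext <;> simp
      map_smul' := fun c L => by ext <;> simp }

theorem hasFDerivAt_angDisp {K : Phase ℂ → ℂ} {w : Phase ℂ} (hK : AnalyticAt ℂ K w) :
    HasFDerivAt (angDisp K) (actPart.comp (fderiv ℂ (fderiv ℂ K) w)) w :=
  actPart.hasFDerivAt.comp w hK.fderiv.differentiableAt.hasFDerivAt

theorem hasFDerivAt_actDisp {K : Phase ℂ → ℂ} {w : Phase ℂ} (hK : AnalyticAt ℂ K w) :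
    HasFDerivAt (actDisp K) (angPart.comp (fderiv ℂ (fderiv ℂ K) w)) w :=
  angPart.hasFDerivAt.comp w hK.fderiv.differentiableAt.hasFDerivAt

theorem sum_single_eq (v : Fin 3 → Fin 2 → ℂ) :
    v = ∑ k, ∑ i, v k i • (Pi.single k (Pi.single i 1) : Fin 3 → Fin 2 → ℂ) := by
  ext a c
  simp only [Finset.sum_apply, Pi.smul_apply, smul_eq_mul]
  rw [Finset.sum_eq_single a, Finset.sum_eq_single c]
  · simp
  · intro i _ hi; simp [hi.symm]
  · simp
  · intro k _ hk
    refine Finset.sum_eq_zero fun i _ => ?_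
    simp [hk.symm]
  · simp

theorem apply_eq_sum (L : Phase ℂ →L[ℂ] ℂ) (v : Phase ℂ) :
    L v = (∑ k, ∑ i, v.1 k i * L (angDir k i)) + ∑ k, ∑ i, v.2 k i * L (actDir k i) := by
  have h1 : v = (∑ k, ∑ i, v.1 k i • angDir k i) + ∑ k, ∑ i, v.2 k i • actDir k i := by
    ext1
    · simp only [Prod.fst_add, Prod.fst_sum, Prod.smul_fst, angDir, actDir, smul_zero,
        Finset.sum_const_zero, add_zero]
      exact sum_single_eq v.1
    · simp only [Prod.snd_add, Prod.snd_sum, Prod.smul_snd, angDir, actDir, smul_zero,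
        Finset.sum_const_zero, zero_add]
      exact sum_single_eq v.2
  conv_lhs => rw [h1]
  simp only [map_add, map_sum, map_smul, smul_eq_mul]

/-- A symmetric bilinear form acts in the same way on the symplectic form through its action
components as through its angle components. -/
theorem omega_add_parts (B : Phase ℂ →L[ℂ] Phase ℂ →L[ℂ] ℂ) (hB : ∀ a b, B a b = B b a)
    (a b : Phase ℂ) :
    omega (a + angPart (B a)) (b + angPart (B b)) =
      omega (a + actPart (B a)) (b + actPart (B b)) := by
  have h := hB a b
  rw [apply_eq_sum (B a) b, apply_eq_sum (B b) a] at h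
  have e1 : omega (a + angPart (B a)) (b + angPart (B b)) = omega a b
      + (∑ k, ∑ i, b.1 k i * B a (angDir k i)) - ∑ k, ∑ i, a.1 k i * B b (angDir k i) := by
    simp only [omega, ← Finset.sum_add_distrib, ← Finset.sum_sub_distrib]
    refine Finset.sum_congr rfl fun k _ => Finset.sum_congr rfl fun i _ => ?_
    simp [angPart]
    ring
  have e2 : omega (a + actPart (B a)) (b + actPart (B b)) = omega a b
      + (∑ k, ∑ i, a.2 k i * B b (actDir k i)) - ∑ k, ∑ i, b.2 k i * B a (actDir k i) := by
    simp only [omega, ← Finset.sum_add_distrib, ← Finset.sum_sub_distrib]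
    refine Finset.sum_congr rfl fun k _ => Finset.sum_congr rfl fun i _ => ?_
    simp [actPart]
    ring
  rw [e1, e2]
  linear_combination h

/-- The real part of a point of the complex phase space. -/
def rePart (v : Phase ℂ) : Phase ℝ := (fun k i => (v.1 k i).re, fun k i => (v.2 k i).re)

theorem norm_phase_le {v : Phase ℂ} {B : ℝ} (hB : 0 ≤ B) (h1 : ∀ k i, ‖v.1 k i‖ ≤ B)
    (h2 : ∀ k i, ‖v.2 k i‖ ≤ B) : ‖v‖ ≤ B := by
  rw [Prod.norm_def]
  exact max_le (norm_le_of_coord hB h1) (norm_le_of_coord hB h2)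

theorem norm_toC_rePart_le (v : Phase ℂ) : ‖toC (rePart v)‖ ≤ ‖v‖ := by
  refine norm_phase_le (norm_nonneg _) (fun k i => ?_) fun k i => ?_
  · refine le_trans ?_ (norm_coord_le' v k i)
    simpa [toC, rePart] using Complex.abs_re_le_norm (v.1 k i)
  · refine le_trans ?_ (norm_coord_le v k i)
    simpa [toC, rePart] using Complex.abs_re_le_norm (v.2 k i)

/-- Coordinatewise the real part is the nearest real number. This is used to show that the solution
of a fixed point equation with real data is real. -/
theorem norm_sub_rePart_le (v : Phase ℂ) {y : Phase ℂ} (hy : y ∈ range toC) :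
    ‖v - toC (rePart v)‖ ≤ ‖v - y‖ := by
  obtain ⟨y, rfl⟩ := hy
  have key : ∀ (a : ℂ) (t : ℝ), ‖a - (a.re : ℂ)‖ ≤ ‖a - t‖ := fun a t => by
    have : a - (a.re : ℂ) = (a.im : ℂ) * Complex.I := by
      apply Complex.ext <;> simp
    rw [this, norm_mul, Complex.norm_I, mul_one, Complex.norm_real]
    simpa using Complex.abs_im_le_norm (a - t)
  refine norm_phase_le (norm_nonneg _) (fun k i => ?_) fun k i => ?_
  · exact (key _ _).trans (norm_coord_le' (v - toC y) k i)
  · exact (key _ _).trans (norm_coord_le (v - toC y) k i)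

/-- A small Lipschitz displacement has exactly one preimage nearby. -/
theorem exists_unique_displacement {η : Phase ℂ → Phase ℂ} {z : Phase ℂ} {r : ℝ} (hr : 0 < r)
    (hlip : ∀ v v' : Phase ℂ, ‖v‖ ≤ r → ‖v'‖ ≤ r → ‖η (z + v') - η (z + v)‖ ≤ 1 / 2 * ‖v' - v‖)
    (hz : ‖η z‖ ≤ r / 4) : ∃ v, ‖v‖ ≤ r ∧ v + η (z + v) = 0 ∧ ‖v‖ ≤ 2 * ‖η z‖ := by
  have h0 : ∀ v : Phase ℂ, ‖v‖ ≤ r → ‖η (z + v)‖ ≤ ‖η z‖ + 1 / 2 * ‖v‖ := fun v hv => by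
    have := hlip 0 v (by simpa using hr.le) hv
    simp only [add_zero, sub_zero] at this
    linarith [norm_sub_norm_le (η (z + v)) (η z)]
  -- The sought v is a fixed point of v ↦ −η(z + v), which contracts the ball because r/4 + r/2 ≤ r.
  have hm : MapsTo (fun v => -η (z + v)) (closedBall 0 r) (closedBall 0 r) := fun v hv => by
    rw [mem_closedBall_zero_iff] at hv ⊢
    rw [norm_neg]
    linarith [h0 v hv]
  have hc : ContractingWith (1 / 2 : ℝ≥0) (hm.restrict _ _ _) := by
    refine ⟨by norm_num, LipschitzWith.of_dist_le_mul fun v v' => ?_⟩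
    have := hlip v' v (mem_closedBall_zero_iff.1 v'.2) (mem_closedBall_zero_iff.1 v.2)
    rw [Subtype.dist_eq, Subtype.dist_eq, dist_eq_norm, dist_eq_norm]
    simp only [MapsTo.val_restrict_apply]
    rw [neg_sub_neg, norm_sub_rev]
    simpa using this
  obtain ⟨v, hv, hfix, -⟩ := hc.exists_fixedPoint' isClosed_closedBall.isComplete hm
    (mem_closedBall_self hr.le) (edist_ne_top _ _)
  rw [mem_closedBall_zero_iff] at hv
  have hfix' : -η (z + v) = v := hfix
  refine ⟨v, hv, by nth_rewrite 1 [← hfix']; exact neg_add_cancel _, ?_⟩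
  have h1 := h0 v hv
  rw [← norm_neg, hfix'] at h1
  linarith

/-- The identity plus a map of Lipschitz constant 1/2 is injective. -/
theorem eq_of_displacement {η : Phase ℂ → Phase ℂ} {z : Phase ℂ} {r : ℝ}
    (hlip : ∀ v v' : Phase ℂ, ‖v‖ ≤ r → ‖v'‖ ≤ r → ‖η (z + v') - η (z + v)‖ ≤ 1 / 2 * ‖v' - v‖)
    {v v' : Phase ℂ} (hv : ‖v‖ ≤ r) (hv' : ‖v'‖ ≤ r) (h : v + η (z + v) = v' + η (z + v')) :
    v = v' := by
  have h1 := hlip v v' hv hv'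
  have h2 : η (z + v') - η (z + v) = -(v' - v) := by
    rw [eq_comm, ← sub_eq_zero] at h
    rw [← sub_eq_zero, ← h]; abel
  rw [h2, norm_neg] at h1
  have h3 : ‖v' - v‖ = 0 := by linarith [norm_nonneg (v' - v)]
  exact (sub_eq_zero.1 (norm_eq_zero.1 h3)).symm

end Generating

end LunarThreeBody

namespace LunarThreeBody

open scoped Real Topology NNReal
open Set Filter Metric Asymptotics

/-! ### Construction of the symplectic map from its generating function -/

section GeneratedMap

variable {A : Set (Phase ℝ)}

theorem eventually_half_lipschitz {η : Phase ℂ → Phase ℂ} (hη : RegDisp A η)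
    (hb : η =O[far A] wt 3) : ∃ r > 0, ∀ᶠ z in far A, ∀ v v' : Phase ℂ, ‖v‖ ≤ r → ‖v'‖ ≤ r →
      ‖η (z + v') - η (z + v)‖ ≤ 1 / 2 * ‖v' - v‖ := by
  obtain ⟨C, hC, r, hr, h⟩ := exists_lipschitz hη.analytic (isBigO_fderiv hη.analytic hb)
  have ht : ∀ᶠ z in far A, C * wt 3 z < 1 / 2 := by
    have := (tendsto_wt (A := A) (k := 3) (by norm_num)).const_mul C
    rw [mul_zero] at this
    exact this.eventually (gt_mem_nhds (by norm_num))
  refine ⟨r, hr, ?_⟩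
  filter_upwards [h, ht] with z h1 h2 v v' hv hv'
  exact (h1 v v' hv hv').trans (by gcongr)

/-- A generating function of order `3` defines a symplectic map near the end of the phase space. -/
theorem exists_generatedMap (hA : AngleInvariant A) {K : Phase ℂ → ℂ} (hK : Reg A K)
    (hb : K =O[far A] wt 3) {p : Phase ℂ → Prop} (hp : ∀ᶠ z in far A, p z) :
    ∃ (N : ℕ) (φ χ : Phase ℂ → Phase ℂ) (C : ℝ),
      AnalyticOnNhd ℂ φ (dom A N) ∧
      (∀ k, ∀ z ∈ dom A N, φ (shift k z) = shift k (φ z)) ∧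
      InjOn φ (dom A N) ∧
      (∀ z ∈ dom A N, ∀ v w, omega (fderiv ℂ φ z v) (fderiv ℂ φ z w) = omega v w) ∧
      (∀ z ∈ dom A N, z ∈ range toC → φ z ∈ range toC) ∧
      (∀ z ∈ dom A N, ‖φ z - z‖ ≤ C * wt 3 z) ∧
      ∀ z ∈ dom A N, p (χ z) ∧ χ z + angDisp K (χ z) = z ∧ φ z = χ z + actDisp K (χ z) := by
  set η₁ := angDisp K with hη₁
  set η₂ := actDisp K with hη₂
  have R₁ : RegDisp A η₁ := hK.angDisp hb (by norm_num)
  have R₂ : RegDisp A η₂ := hK.actDisp hb (by norm_num)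
  have B₁ : η₁ =O[far A] wt 3 := isBigO_angDisp hK hb
  have B₂ : η₂ =O[far A] wt 3 := isBigO_actDisp hK hb
  obtain ⟨r₁, hr₁, L₁⟩ := eventually_half_lipschitz R₁ B₁
  obtain ⟨r₂, hr₂, L₂⟩ := eventually_half_lipschitz R₂ B₂
  obtain ⟨C₁, hC₁, c₁⟩ := B₁.exists_pos
  obtain ⟨C₂, hC₂, c₂⟩ := B₂.exists_pos
  have D₁ : ∀ᶠ z in far A, ‖fderiv ℂ η₁ z‖ < 1 := by
    have h := ((isBigO_fderiv R₁.analytic B₁).trans_tendsto (tendsto_wt (by norm_num))).norm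
    rw [norm_zero] at h
    exact h.eventually (gt_mem_nhds one_pos)
  set r := min r₁ r₂ with hr
  have hr0 : 0 < r := by positivity
  -- All properties are needed at the displaced point z + δ z too, so they are collected on balls of
  -- a fixed radius ρ. N is then taken so large that ‖δ z‖ ≤ 2‖η₁ z‖ ≤ ρ.
  obtain ⟨ρ, hρ, hQ⟩ := eventually_far_ball ((((hK.analytic.and (L₁.and L₂)).and
    ((eventually_le_of_tendsto R₁.tendsto (r := r / 4) (by positivity)).and
      (eventually_le_of_tendsto R₂.tendsto (r := r / 4) (by positivity)))).and
    (D₁.and (R₁.periodic.and R₂.periodic))).and ((R₁.real.and R₂.real).and hp))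
  obtain ⟨N, hN⟩ := eventually_far.1 ((hQ.and (eventually_le_of_tendsto R₁.tendsto
    (r := ρ / 2) (by positivity))).and (c₁.bound.and c₂.bound))
  -- properties of a point near the domain
  have ana : ∀ z ∈ dom A N, ∀ v, ‖v‖ ≤ ρ → AnalyticAt ℂ K (z + v) := fun z hz v hv =>
    ((hN z hz).1.1 v hv).1.1.1.1
  have lip₁ : ∀ z ∈ dom A N, ∀ v v' : Phase ℂ, ‖v‖ ≤ r → ‖v'‖ ≤ r →
      ‖η₁ (z + v') - η₁ (z + v)‖ ≤ 1 / 2 * ‖v' - v‖ := fun z hz v v' hv hv' => by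
    have := ((hN z hz).1.1 0 (by simpa using hρ.le)).1.1.1.2.1 v v'
      (hv.trans (min_le_left _ _)) (hv'.trans (min_le_left _ _))
    simpa using this
  have lip₂ : ∀ z ∈ dom A N, ∀ u, ‖u‖ ≤ ρ → ∀ v v' : Phase ℂ, ‖v‖ ≤ r → ‖v'‖ ≤ r →
      ‖η₂ (z + u + v') - η₂ (z + u + v)‖ ≤ 1 / 2 * ‖v' - v‖ := fun z hz u hu v v' hv hv' =>
    ((hN z hz).1.1 u hu).1.1.1.2.2 v v' (hv.trans (min_le_right _ _))
      (hv'.trans (min_le_right _ _))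
  have sm₁ : ∀ z ∈ dom A N, ‖η₁ z‖ ≤ r / 4 := fun z hz => by
    simpa using ((hN z hz).1.1 0 (by simpa using hρ.le)).1.1.2.1
  have sm₂ : ∀ z ∈ dom A N, ∀ v, ‖v‖ ≤ ρ → ‖η₂ (z + v)‖ ≤ r / 4 := fun z hz v hv =>
    ((hN z hz).1.1 v hv).1.1.2.2
  have bd₁ : ∀ z ∈ dom A N, ‖η₁ z‖ ≤ C₁ * wt 3 z := fun z hz => by
    simpa [abs_of_nonneg (wt_nonneg 3 z)] using (hN z hz).2.1
  have bd₂ : ∀ z ∈ dom A N, ‖η₂ z‖ ≤ C₂ * wt 3 z := fun z hz => by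
    simpa [abs_of_nonneg (wt_nonneg 3 z)] using (hN z hz).2.2
  -- The point z + δ z is the mixed point of the generating function: it has the actions of z and
  -- the angles of φ z.
  have hex : ∀ z ∈ dom A N, ∃ v, ‖v‖ ≤ r ∧ v + η₁ (z + v) = 0 ∧ ‖v‖ ≤ 2 * ‖η₁ z‖ :=
    fun z hz => exists_unique_displacement hr0 (lip₁ z hz) (sm₁ z hz)
  choose! δ hδr hδ hδ2 using hex
  have hδρ : ∀ z ∈ dom A N, ‖δ z‖ ≤ ρ := fun z hz => by
    linarith [hδ2 z hz, (hN z hz).1.2]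
  have huniq : ∀ z ∈ dom A N, ∀ v, ‖v‖ ≤ r → v + η₁ (z + v) = 0 → v = δ z := fun z hz v hv h =>
    eq_of_displacement (lip₁ z hz) hv (hδr z hz) (h.trans (hδ z hz).symm)
  have hχ : ∀ z ∈ dom A N, z + δ z + η₁ (z + δ z) = z := fun z hz => by
    rw [add_assoc, hδ z hz, add_zero]
  have hshift : ∀ k, ∀ z ∈ dom A N, shift k z ∈ dom A N := fun k z hz => by
    rw [shift_eq_add]
    exact T_translate (angleInvariant_farPart hA N) hz _
  have hδs : ∀ k, ∀ z ∈ dom A N, δ (shift k z) = δ z := fun k z hz => by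
    refine (huniq _ (hshift k z hz) (δ z) (hδr z hz) ?_).symm
    rw [← shift_add, ((hN z hz).1.1 _ (hδρ z hz)).1.2.2.1 k, hδ z hz]
  -- analyticity of the inverse
  have hana : ∀ z ∈ dom A N, AnalyticAt ℂ δ z := by
    intro z hz
    have hw := ana z hz _ (hδρ z hz)
    have hη := hasFDerivAt_angDisp hw
    have hηlt : ‖actPart.comp (fderiv ℂ (fderiv ℂ K) (z + δ z))‖ < 1 := by
      rw [← hη.fderiv]
      exact ((hN z hz).1.1 _ (hδρ z hz)).1.2.1
    obtain ⟨e, he⟩ := exists_equiv_one_add _ hηlt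
    have hηa : AnalyticAt ℂ η₁ (z + δ z) := (actPart.analyticAt _).comp hw.fderiv
    have hΨ : HasFDerivAt (fun w => w + η₁ w) (e : Phase ℂ →L[ℂ] Phase ℂ) (z + δ z) := by
      rw [he]
      exact (hasFDerivAt_id _).add hη
    obtain ⟨g, hg, hg0, hgr⟩ := exists_analytic_localInverse
      (f := fun w => w + η₁ w) (analyticAt_id.add hηa) hΨ
    rw [hχ z hz] at hg hg0 hgr
    -- Near z the analytic local inverse g stays within the radius of uniqueness, so it coincides
    -- with y + δ y.
    have hsmall : ∀ᶠ y in 𝓝 z, ‖g y - y‖ < r := by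
      have hc : Tendsto (fun y => ‖g y - y‖) (𝓝 z) (𝓝 ‖g z - z‖) :=
        (hg.continuousAt.sub continuousAt_id).norm
      refine hc.eventually (gt_mem_nhds ?_)
      rw [hg0, add_sub_cancel_left]
      linarith [hδ2 z hz, sm₁ z hz]
    refine (hg.sub analyticAt_id).congr ?_
    filter_upwards [hsmall, hgr, isOpen_dom.mem_nhds hz] with y h1 h2 h3
    refine huniq y h3 _ h1.le ?_
    have h4 : y + (g y - y) = g y := by abel
    change g y - y + η₁ (y + (g y - y)) = 0
    rw [h4, sub_add_eq_add_sub, h2, sub_self]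
  have hφana : ∀ z ∈ dom A N, AnalyticAt ℂ (fun z => z + δ z + η₂ (z + δ z)) z := by
    intro z hz
    have h1 : AnalyticAt ℂ η₂ (z + δ z) :=
      (angPart.analyticAt _).comp (ana z hz _ (hδρ z hz)).fderiv
    have h2 : AnalyticAt ℂ (fun z => z + δ z) z := analyticAt_id.add (hana z hz)
    exact h2.add (AnalyticAt.comp (f := fun z => z + δ z) h1 h2)
  refine ⟨N, fun z => z + δ z + η₂ (z + δ z), fun z => z + δ z, 2 * C₁ + (C₂ + C₁), hφana,
    fun k z hz => ?_, fun z hz z' hz' heq => ?_, fun z hz v w => ?_, fun z hz hreal => ?_,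
    fun z hz => ?_, fun z hz => ⟨((hN z hz).1.1 _ (hδρ z hz)).2.2, hχ z hz, rfl⟩⟩
  · simp only [hδs k z hz, ← shift_add]
    rw [((hN z hz).1.1 _ (hδρ z hz)).1.2.2.2 k]
  -- If φ z = φ z', the two mixed points differ by a difference of values of η₂, hence by at most r.
  -- The map id + η₂ is injective at that scale, so the mixed points agree, and they determine z and
  -- z' through id + η₁.
  · have h1 : z' + δ z' = z + δ z + (z' + δ z' - (z + δ z)) := by abel
    simp only at heq
    have h2 : z' + δ z' - (z + δ z) = η₂ (z + δ z) - η₂ (z' + δ z') := by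
      rw [sub_eq_sub_iff_add_eq_add, ← heq, add_comm]
    have h3 : ‖z' + δ z' - (z + δ z)‖ ≤ r := by
      rw [h2]
      linarith [norm_sub_le (η₂ (z + δ z)) (η₂ (z' + δ z')), sm₂ z hz _ (hδρ z hz),
        sm₂ z' hz' _ (hδρ z' hz')]
    have h4 := eq_of_displacement (η := η₂) (z := z + δ z) (lip₂ z hz _ (hδρ z hz))
      (v := 0) (v' := z' + δ z' - (z + δ z)) (by simpa using hr0.le) h3 (by
        rw [← h1, h2, zero_add, add_zero]; abel)
    have h5 : z' + δ z' = z + δ z := by rw [h1, ← h4, add_zero]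
    rw [← hχ z hz, ← h5, hχ z' hz']
  · have hw := ana z hz _ (hδρ z hz)
    have d0 : HasFDerivAt (fun z => z + δ z) (fderiv ℂ (fun z => z + δ z) z) z :=
      (analyticAt_id.add (hana z hz)).differentiableAt.hasFDerivAt
    set L := fderiv ℂ (fun z => z + δ z) z with hL
    have d1 := d0.add (HasFDerivAt.comp (f := fun z => z + δ z) z (hasFDerivAt_angDisp hw) d0)
    have d2 := d0.add (HasFDerivAt.comp (f := fun z => z + δ z) z (hasFDerivAt_actDisp hw) d0)
    -- With L the derivative of the mixed point and B the Hessian of K there, this gives (1 +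
    -- `actPart` B) L = id, while the derivative of φ is (1 + `angPart` B) L. Symmetry of B makes
    -- both pull back the form in the same way.
    have d3 : HasFDerivAt (fun z => z + δ z + η₁ (z + δ z)) (ContinuousLinearMap.id ℂ _) z := by
      refine (hasFDerivAt_id z).congr_of_eventuallyEq ?_
      filter_upwards [isOpen_dom.mem_nhds hz] with y hy using hχ y hy
    have e1 := d1.unique d3
    have e2 : fderiv ℂ (fun z => z + δ z + η₂ (z + δ z)) z = _ := d2.fderiv
    set B := fderiv ℂ (fderiv ℂ K) (z + δ z)
    have hB : ∀ a b, B a b = B b a := fun a b =>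
      (hw.contDiffAt.isSymmSndFDerivAt_of_omega).eq a b
    have e3 : ∀ v, L v + actPart (B (L v)) = v := fun v => by
      have := congrArg (fun T : Phase ℂ →L[ℂ] Phase ℂ => T v) e1
      simpa using this
    have e4 : ∀ v, fderiv ℂ (fun z => z + δ z + η₂ (z + δ z)) z v =
        L v + angPart (B (L v)) := fun v => by rw [e2]; rfl
    rw [e4, e4, omega_add_parts B hB, e3, e3]
  -- Reality: the real part of v almost solves the same equation. The distance from v to its real
  -- part is at most ‖η₁(z + Re v) − η₁(z + v)‖, hence at most half of itself, hence zero.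
  · set v := δ z
    have hvr : ‖toC (rePart v)‖ ≤ ‖v‖ := norm_toC_rePart_le v
    have h1 : η₁ (z + toC (rePart v)) ∈ range toC :=
      ((hN z hz).1.1 _ (hvr.trans (hδρ z hz))).2.1.1 (add_mem_range_toC hreal ⟨_, rfl⟩)
    have h2 : -η₁ (z + toC (rePart v)) ∈ range toC := by
      obtain ⟨y, hy⟩ := h1
      refine ⟨-y, ?_⟩
      rw [← hy]
      ext <;> simp [toC]
    have h3 := norm_sub_rePart_le v h2
    have h4 : v - -η₁ (z + toC (rePart v)) = η₁ (z + toC (rePart v)) - η₁ (z + v) := by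
      have := hδ z hz
      rw [sub_neg_eq_add, ← sub_eq_zero]
      rw [← this]; abel
    have h5 := lip₁ z hz v (toC (rePart v)) (hδr z hz) (hvr.trans (hδr z hz))
    rw [h4] at h3
    rw [norm_sub_rev (toC (rePart v)) v] at h5
    have h6 : ‖v - toC (rePart v)‖ = 0 := by linarith [norm_nonneg (v - toC (rePart v))]
    have h7 : z + v ∈ range toC :=
      add_mem_range_toC hreal ⟨_, (sub_eq_zero.1 (norm_eq_zero.1 h6)).symm⟩
    exact add_mem_range_toC h7 (((hN z hz).1.1 _ (hδρ z hz)).2.1.2 h7)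
  · have h1 := bd₁ z hz
    have h2 := bd₂ z hz
    have h3 := hδ2 z hz
    -- The constant is a sum of 2C₁ for δ, C₂ for η₂ at z, and C₁ for the change of η₂ over the
    -- displacement δ.
    have h4 : ‖η₂ (z + δ z)‖ ≤ ‖η₂ z‖ + 1 / 2 * ‖δ z‖ := by
      have := lip₂ z hz 0 (by simpa using hρ.le) 0 (δ z) (by simpa using hr0.le) (hδr z hz)
      simp only [add_zero, sub_zero] at this
      linarith [norm_sub_norm_le (η₂ (z + δ z)) (η₂ z)]
    have h5 : z + δ z + η₂ (z + δ z) - z = δ z + η₂ (z + δ z) := by abel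
    simp only [h5]
    linarith [norm_add_le (δ z) (η₂ (z + δ z))]

end GeneratedMap

end LunarThreeBody

namespace LunarThreeBody

open scoped Real Topology NNReal
open Set Filter Metric

/-! ## Kepler's equation over the complex numbers -/

section Kepler

theorem norm_cos_le (u : ℂ) : ‖Complex.cos u‖ ≤ Real.cosh u.im := by
  rw [Complex.cos]
  have h1 : ‖Complex.exp (u * Complex.I)‖ = Real.exp (-u.im) := by
    rw [Complex.norm_exp]; simp
  have h2 : ‖Complex.exp (-u * Complex.I)‖ = Real.exp u.im := by
    rw [Complex.norm_exp]; simp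
  rw [norm_div, Complex.norm_ofNat, Real.cosh_eq]
  have := norm_add_le (Complex.exp (u * Complex.I)) (Complex.exp (-u * Complex.I))
  rw [h1, h2] at this
  linarith

/-- The domain on which `u - e sin u` is injective. -/
def keplerDomain (e : ℂ) : Set ℂ := {u | ‖e‖ * Real.cosh u.im < 1}

/-- The domain is a strip because cosh is even and increasing in the modulus of the imaginary part.
On a segment inside it |e cos u| stays below a constant less than 1, so e sin u is a strict
contraction there. -/
theorem kepler_injOn (e : ℂ) : InjOn (fun u => u - e * Complex.sin u) (keplerDomain e) := by
  intro u hu v hv huv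
  set κ := max (‖e‖ * Real.cosh u.im) (‖e‖ * Real.cosh v.im) with hκ
  have hκ1 : κ < 1 := max_lt hu hv
  have hs : Convex ℝ (segment ℝ u v) := convex_segment u v
  have key := hs.norm_image_sub_le_of_norm_hasDerivWithin_le (𝕜 := ℂ)
    (f := fun u => e * Complex.sin u) (f' := fun u => e * Complex.cos u) (C := κ)
    (fun x _ => ((Complex.hasDerivAt_sin x).const_mul e).hasDerivWithinAt)
    (fun x hx => by
      obtain ⟨a, b, ha, hb, hab, rfl⟩ := hx
      have him : (a • u + b • v).im = a * u.im + b * v.im := by simp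
      have h1 : |(a • u + b • v).im| ≤ max |u.im| |v.im| := by
        rw [him]
        have h2 := abs_add_le (a * u.im) (b * v.im)
        rw [abs_mul, abs_mul, abs_of_nonneg ha, abs_of_nonneg hb] at h2
        have h3 := le_max_left |u.im| |v.im|
        have h4 := le_max_right |u.im| |v.im|
        calc _ ≤ a * |u.im| + b * |v.im| := h2
          _ ≤ a * max |u.im| |v.im| + b * max |u.im| |v.im| := by gcongr
          _ = max |u.im| |v.im| := by rw [← add_mul, hab, one_mul]
      rw [norm_mul]
      have h5 : Real.cosh (a • u + b • v).im ≤ max (Real.cosh u.im) (Real.cosh v.im) := by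
        rcases le_total |u.im| |v.im| with h | h
        · rw [max_eq_right h] at h1
          exact (Real.cosh_le_cosh.2 h1).trans (le_max_right _ _)
        · rw [max_eq_left h] at h1
          exact (Real.cosh_le_cosh.2 h1).trans (le_max_left _ _)
      calc ‖e‖ * ‖Complex.cos (a • u + b • v)‖
          ≤ ‖e‖ * max (Real.cosh u.im) (Real.cosh v.im) := by
            gcongr; exact (norm_cos_le _).trans h5
        _ = κ := by rw [hκ, mul_max_of_nonneg _ _ (norm_nonneg _)])
    (left_mem_segment ℝ u v) (right_mem_segment ℝ u v)
  have h6 : e * Complex.sin v - e * Complex.sin u = v - u := by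
    simp only at huv
    linear_combination huv
  rw [h6] at key
  have h7 : ‖v - u‖ = 0 := by nlinarith [norm_nonneg (v - u)]
  exact (sub_eq_zero.1 (norm_eq_zero.1 h7)).symm

/-- The eccentric anomaly for complex eccentricity and mean anomaly. -/
def keplerU (e l : ℂ) : ℂ := Function.invFunOn (fun u => u - e * Complex.sin u) (keplerDomain e) l

theorem keplerU_eq {e l u : ℂ} (hu : u ∈ keplerDomain e) (h : u - e * Complex.sin u = l) :
    keplerU e l = u := by
  have hex : ∃ u ∈ keplerDomain e, (fun u => u - e * Complex.sin u) u = l := ⟨u, hu, h⟩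
  exact kepler_injOn e (Function.invFunOn_mem hex) hu ((Function.invFunOn_eq hex).trans h.symm)

theorem ofReal_mem_keplerDomain {e : ℝ} (h0 : 0 ≤ e) (h1 : e < 1) (u : ℝ) :
    (u : ℂ) ∈ keplerDomain e := by
  simpa [keplerDomain, abs_of_nonneg h0] using h1

theorem keplerU_ofReal {e : ℝ} (h0 : 0 ≤ e) (h1 : e < 1) (l : ℝ) :
    keplerU e l = eccAnomaly e l := by
  refine keplerU_eq (ofReal_mem_keplerDomain h0 h1 _) ?_
  exact_mod_cast eccAnomaly_spec e l

/-- Stated for sine and cosine and for all e, l, without a solvability condition, so that the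
Hamiltonian built from them is periodic everywhere. -/
theorem keplerU_add_two_pi (e l : ℂ) (k : ℤ) :
    Complex.sin (keplerU e (l + 2 * π * k)) = Complex.sin (keplerU e l) ∧
      Complex.cos (keplerU e (l + 2 * π * k)) = Complex.cos (keplerU e l) := by
  have hper : ∀ (u : ℂ) (k : ℤ), Complex.sin (u + 2 * π * k) = Complex.sin u := fun u k => by
    rw [mul_comm (2 * (π : ℂ))]; exact Complex.sin_periodic.int_mul k u
  have hper' : ∀ (u : ℂ) (k : ℤ), Complex.cos (u + 2 * π * k) = Complex.cos u := fun u k => by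
    rw [mul_comm (2 * (π : ℂ))]; exact Complex.cos_periodic.int_mul k u
  have hmove : ∀ (u l : ℂ) (k : ℤ), u ∈ keplerDomain e → u - e * Complex.sin u = l →
      u + 2 * π * k ∈ keplerDomain e ∧
        u + 2 * π * k - e * Complex.sin (u + 2 * π * k) = l + 2 * π * k := fun u l k hu h => by
    refine ⟨?_, by rw [hper, ← h]; ring⟩
    have : (u + 2 * π * k).im = u.im := by
      have : (2 * π * k : ℂ) = ((2 * π * k : ℝ) : ℂ) := by push_cast; ring
      rw [this, Complex.add_im, Complex.ofReal_im, add_zero]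
    simpa only [keplerDomain, mem_ofPred_eq, this] using hu
  by_cases hex : ∃ u ∈ keplerDomain e, u - e * Complex.sin u = l
  · obtain ⟨u, hu, h⟩ := hex
    obtain ⟨h1, h2⟩ := hmove u l k hu h
    rw [keplerU_eq hu h, keplerU_eq h1 h2, hper, hper']
    exact ⟨rfl, rfl⟩
  · have hex' : ¬ ∃ u ∈ keplerDomain e, u - e * Complex.sin u = l + 2 * π * k := by
      rintro ⟨u, hu, h⟩
      obtain ⟨h1, h2⟩ := hmove u _ (-k) hu h
      refine hex ⟨_, h1, h2.trans ?_⟩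
      push_cast; ring
    -- Without a solution `Function.invFunOn` takes the same default value at both points.
    have : keplerU e (l + 2 * π * k) = keplerU e l := by
      rw [keplerU, keplerU, Function.invFunOn_neg hex', Function.invFunOn_neg hex]
    rw [this]
    exact ⟨rfl, rfl⟩

/-- The derivative of `(e, u) ↦ (e, u - e sin u)`. -/
def keplerDeriv (e u : ℂ) (h : 1 - e * Complex.cos u ≠ 0) : (ℂ × ℂ) ≃L[ℂ] (ℂ × ℂ) :=
  LinearEquiv.toContinuousLinearEquiv
    { toFun := fun v => (v.1, (1 - e * Complex.cos u) * v.2 - Complex.sin u * v.1)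
      invFun := fun v => (v.1, (v.2 + Complex.sin u * v.1) / (1 - e * Complex.cos u))
      map_add' := fun v w => by ext <;> simp; ring
      map_smul' := fun c v => by ext <;> simp; ring
      left_inv := fun v => by ext <;> simp [h]
      right_inv := fun v => by
        ext
        · simp
        · simp only; field_simp; ring }

/-- The inverse function theorem for (e, u) ↦ (e, u − e sin u) gives joint analyticity in e and l;
the derivative is invertible because 1 − e cos u ≠ 0. -/
theorem analyticAt_keplerU {e : ℝ} (h0 : 0 ≤ e) (h1 : e < 1) (l : ℝ) :
    AnalyticAt ℂ (fun p : ℂ × ℂ => keplerU p.1 p.2) ((e : ℂ), (l : ℂ)) := by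
  set u : ℝ := eccAnomaly e l with hu
  have hmem := ofReal_mem_keplerDomain h0 h1 u
  have hul : (u : ℂ) - e * Complex.sin u = l := by exact_mod_cast eccAnomaly_spec e l
  have hne : (1 : ℂ) - e * Complex.cos u ≠ 0 := by
    intro h
    have h2 : (1 : ℂ) = e * Complex.cos u := sub_eq_zero.1 h
    have h3 : (1 : ℝ) = e * Real.cos u := by exact_mod_cast h2
    nlinarith [Real.cos_le_one u]
  have han : AnalyticAt ℂ (fun p : ℂ × ℂ => (p.1, p.2 - p.1 * Complex.sin p.2))
      ((e : ℂ), (u : ℂ)) := by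
    have hsin : AnalyticAt ℂ (fun p : ℂ × ℂ => Complex.sin p.2) ((e : ℂ), (u : ℂ)) :=
      AnalyticAt.comp (Complex.analyticAt_sin) analyticAt_snd
    exact analyticAt_fst.prod (analyticAt_snd.sub (analyticAt_fst.mul hsin))
  have hd : HasFDerivAt (fun p : ℂ × ℂ => (p.1, p.2 - p.1 * Complex.sin p.2))
      ((keplerDeriv e u hne : (ℂ × ℂ) ≃L[ℂ] (ℂ × ℂ)) : (ℂ × ℂ) →L[ℂ] (ℂ × ℂ))
      ((e : ℂ), (u : ℂ)) := by
    have hf : HasFDerivAt (fun p : ℂ × ℂ => p.1) (ContinuousLinearMap.fst ℂ ℂ ℂ)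
      ((e : ℂ), (u : ℂ)) := hasFDerivAt_fst
    have hs : HasFDerivAt (fun p : ℂ × ℂ => p.2) (ContinuousLinearMap.snd ℂ ℂ ℂ)
      ((e : ℂ), (u : ℂ)) := hasFDerivAt_snd
    have hsin := (Complex.hasDerivAt_sin (u : ℂ)).comp_hasFDerivAt ((e : ℂ), (u : ℂ)) hs
    refine (hf.prodMk (hs.sub (hf.mul hsin))).congr_fderiv ?_
    ext <;> simp [keplerDeriv]
  obtain ⟨g, hg, hg0, hgr⟩ := exists_analytic_localInverse han hd
  simp only [hul] at hg hg0 hgr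
  have hopen : IsOpen {p : ℂ × ℂ | ‖p.1‖ * Real.cosh p.2.im < 1} :=
    isOpen_lt (by fun_prop) continuous_const
  have hin : ∀ᶠ y in 𝓝 ((e : ℂ), (l : ℂ)), g y ∈ {p : ℂ × ℂ | ‖p.1‖ * Real.cosh p.2.im < 1} := by
    refine hg.continuousAt.eventually (hopen.mem_nhds ?_)
    rw [hg0]
    exact hmem
  -- The second component of the local inverse stays in the strip of injectivity, so it is
  -- `keplerU`.
  refine (AnalyticAt.comp (analyticAt_snd (p := g (e, l))) hg).congr ?_
  filter_upwards [hin, hgr] with y h2 h3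
  have h4 : (g y).1 = y.1 := (Prod.ext_iff.1 h3).1
  have h5 : (g y).2 - (g y).1 * Complex.sin (g y).2 = y.2 := (Prod.ext_iff.1 h3).2
  rw [h4] at h5
  refine (keplerU_eq ?_ h5).symm
  have h6 : ‖(g y).1‖ * Real.cosh (g y).2.im < 1 := h2
  rwa [h4] at h6

end Kepler

end LunarThreeBody

namespace LunarThreeBody

open scoped Real Topology
open Set Filter Metric

/-! ## The perturbing function in reduced parameters -/

section Orbit

/-- The position on the ellipse in units of the semi major axis. -/
def unitPos (x : Phase ℝ) (i : Fin 2) : R3 :=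
  (Real.cos (eccAnomaly (ecc x i) (ell x i)) - ecc x i) • periVec x i +
    (√(1 - ecc x i ^ 2) * Real.sin (eccAnomaly (ecc x i) (ell x i))) • perpVec x i

/-- The distance to the focus in units of the semi major axis. -/
def unitDist (x : Phase ℝ) (i : Fin 2) : ℝ :=
  1 - ecc x i * Real.cos (eccAnomaly (ecc x i) (ell x i))

theorem posQ_eq (m : Masses) (x : Phase ℝ) (i : Fin 2) :
    posQ m x i = semiAxis m x i • unitPos x i := by
  simp only [posQ, unitPos, smul_add, smul_smul]
  rw [mul_assoc (semiAxis m x i)]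

theorem inner_peri_peri (x : Phase ℝ) (i : Fin 2) : inner ℝ (periVec x i) (periVec x i) = 1 := by
  simp only [periVec, PiLp.inner_apply, Fin.sum_univ_three, RCLike.inner_apply, conj_trivial]
  simp
  have hA := Real.sin_sq_add_cos_sq (node x i)
  have hB := Real.sin_sq_add_cos_sq (argPeri x i)
  have hC := Real.sin_sq_add_cos_sq (incl x i)
  linear_combination (Real.cos (argPeri x i) ^ 2 + Real.cos (incl x i) ^ 2 *
    Real.sin (argPeri x i) ^ 2) * hA + hB + Real.sin (argPeri x i) ^ 2 * hC

theorem inner_perp_perp (x : Phase ℝ) (i : Fin 2) : inner ℝ (perpVec x i) (perpVec x i) = 1 := by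
  simp only [perpVec, PiLp.inner_apply, Fin.sum_univ_three, RCLike.inner_apply, conj_trivial]
  simp
  have hA := Real.sin_sq_add_cos_sq (node x i)
  have hB := Real.sin_sq_add_cos_sq (argPeri x i)
  have hC := Real.sin_sq_add_cos_sq (incl x i)
  linear_combination (Real.sin (argPeri x i) ^ 2 + Real.cos (incl x i) ^ 2 *
    Real.cos (argPeri x i) ^ 2) * hA + hB + Real.cos (argPeri x i) ^ 2 * hC

theorem inner_peri_perp (x : Phase ℝ) (i : Fin 2) : inner ℝ (periVec x i) (perpVec x i) = 0 := by
  simp only [periVec, perpVec, PiLp.inner_apply, Fin.sum_univ_three, RCLike.inner_apply,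
    conj_trivial]
  simp
  have hA := Real.sin_sq_add_cos_sq (node x i)
  have hC := Real.sin_sq_add_cos_sq (incl x i)
  linear_combination (Real.cos (incl x i) ^ 2 - 1) * Real.cos (argPeri x i) *
    Real.sin (argPeri x i) * hA + Real.cos (argPeri x i) * Real.sin (argPeri x i) * hC

theorem norm_sq_comb (x : Phase ℝ) (i : Fin 2) (a b : ℝ) :
    ‖a • periVec x i + b • perpVec x i‖ ^ 2 = a ^ 2 + b ^ 2 := by
  rw [← real_inner_self_eq_norm_sq]
  simp only [inner_add_left, inner_add_right, inner_smul_left, inner_smul_right,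
    inner_peri_peri, inner_perp_perp, inner_peri_perp, real_inner_comm (periVec x i),
    conj_trivial]
  ring

theorem ecc_sq_le (x : Phase ℝ) (i : Fin 2) : ecc x i ^ 2 ≤ 1 := by
  rw [ecc]
  rcases le_or_gt 0 (1 - (actG x i / actL x i) ^ 2) with h | h
  · rw [Real.sq_sqrt h]; nlinarith [sq_nonneg (actG x i / actL x i)]
  · rw [Real.sqrt_eq_zero_of_nonpos h.le]; norm_num

theorem ecc_nonneg (x : Phase ℝ) (i : Fin 2) : 0 ≤ ecc x i := Real.sqrt_nonneg _

theorem ecc_le_one (x : Phase ℝ) (i : Fin 2) : ecc x i ≤ 1 := by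
  have := ecc_sq_le x i
  nlinarith [ecc_nonneg x i]

/-- The polar equation of the ellipse: (cos u − e)² + (1 − e²) sin² u = (1 − e cos u)². -/
theorem norm_unitPos (x : Phase ℝ) (i : Fin 2) : ‖unitPos x i‖ = unitDist x i := by
  have h1 : ‖unitPos x i‖ ^ 2 = unitDist x i ^ 2 := by
    rw [unitPos, norm_sq_comb, unitDist, mul_pow, Real.sq_sqrt (by linarith [ecc_sq_le x i])]
    linear_combination (1 - ecc x i ^ 2) *
      Real.sin_sq_add_cos_sq (eccAnomaly (ecc x i) (ell x i))
  have h2 : 0 ≤ unitDist x i := by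
    rw [unitDist]
    nlinarith [Real.cos_le_one (eccAnomaly (ecc x i) (ell x i)), ecc_nonneg x i, ecc_le_one x i]
  exact (sq_eq_sq₀ (norm_nonneg _) h2).1 h1

theorem unitDist_le (x : Phase ℝ) (i : Fin 2) : unitDist x i ≤ 1 + ecc x i := by
  rw [unitDist]
  nlinarith [Real.neg_one_le_cos (eccAnomaly (ecc x i) (ell x i)), ecc_nonneg x i]

theorem le_unitDist (x : Phase ℝ) (i : Fin 2) : 1 - ecc x i ≤ unitDist x i := by
  rw [unitDist]
  nlinarith [Real.cos_le_one (eccAnomaly (ecc x i) (ell x i)), ecc_nonneg x i]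

/-- The ellipses are neither circular nor rectilinear, and not horizontal. -/
def NonDegenerate (x : Phase ℝ) : Prop :=
  ∀ i, (0 < actG x i / actL x i ∧ actG x i / actL x i < 1) ∧
    (-1 < actH x i / actG x i ∧ actH x i / actG x i < 1)

end Orbit

section Reduced

/-- The reduced parameters: the angles, the quotients `G / L` and `H / G`, and `L₁ / L₂`. -/
abbrev Reduced (𝕜 : Type) := (Fin 3 → Fin 2 → 𝕜) × (Fin 2 → 𝕜) × (Fin 2 → 𝕜) × 𝕜

/-- The principal square root. -/
def csqrt (w : ℂ) : ℂ := w ^ (1 / 2 : ℂ)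

theorem csqrt_ofReal {t : ℝ} (ht : 0 ≤ t) : csqrt t = (√t : ℝ) := by
  rw [csqrt, Real.sqrt_eq_rpow, Complex.ofReal_cpow ht]
  push_cast
  rfl

theorem analyticAt_csqrt_comp {E : Type} [NormedAddCommGroup E] [NormedSpace ℂ E] {f : E → ℂ}
    {p : E} (hf : AnalyticAt ℂ f p) (h : f p ∈ Complex.slitPlane) :
    AnalyticAt ℂ (fun p => csqrt (f p)) p :=
  hf.cpow analyticAt_const h

def rEcc (p : Reduced ℂ) (i : Fin 2) : ℂ := csqrt (1 - p.2.1 i ^ 2)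

def rSin (p : Reduced ℂ) (i : Fin 2) : ℂ := csqrt (1 - p.2.2.1 i ^ 2)

def rAnomaly (p : Reduced ℂ) (i : Fin 2) : ℂ := keplerU (rEcc p i) (p.1 0 i)

def rPeri (p : Reduced ℂ) (i : Fin 2) : Fin 3 → ℂ :=
  let g := p.1 1 i; let h := p.1 2 i; let c := p.2.2.1 i
  ![Complex.cos h * Complex.cos g - Complex.sin h * c * Complex.sin g,
    Complex.sin h * Complex.cos g + Complex.cos h * c * Complex.sin g,
    rSin p i * Complex.sin g]

def rPerp (p : Reduced ℂ) (i : Fin 2) : Fin 3 → ℂ :=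
  let g := p.1 1 i; let h := p.1 2 i; let c := p.2.2.1 i
  ![-(Complex.cos h * Complex.sin g) - Complex.sin h * c * Complex.cos g,
    -(Complex.sin h * Complex.sin g) + Complex.cos h * c * Complex.cos g,
    rSin p i * Complex.cos g]

def rPos (p : Reduced ℂ) (i : Fin 2) (j : Fin 3) : ℂ :=
  (Complex.cos (rAnomaly p i) - rEcc p i) * rPeri p i j +
    p.2.1 i * Complex.sin (rAnomaly p i) * rPerp p i j

def rDist (p : Reduced ℂ) (i : Fin 2) : ℂ := 1 - rEcc p i * Complex.cos (rAnomaly p i)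

def rInner (p : Reduced ℂ) : ℂ := ∑ j, rPos p 0 j * rPos p 1 j

/-- `‖X₂ - β X₁‖² = ‖X₂‖² (1 + β η)` for the positions `X₁`, `X₂` in units of the semi major
axes. -/
def rEta (p : Reduced ℂ) (β : ℂ) : ℂ := (-2 * rInner p + β * rDist p 0 ^ 2) / rDist p 1 ^ 2

def rRoot (p : Reduced ℂ) (β : ℂ) : ℂ := csqrt (1 + β * rEta p β)

/-- `(1 + ξ)^(-1/2) = 1 - ξ / 2 + β² rTerm` with `ξ = β η`. -/
def rTerm (p : Reduced ℂ) (β : ℂ) : ℂ :=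
  rEta p β ^ 2 * (rRoot p β + 2) / (2 * rRoot p β * (rRoot p β + 1) ^ 2)

/-- The factor in `α = κ (L₁ / L₂)²`. -/
def alphaCoeff (m : Masses) : ℝ := m.μ 1 ^ 2 * m.M 1 / (m.μ 0 ^ 2 * m.M 0)

/-- The bracket in the perturbing function, divided by `α²`. -/
def rBracket (m : Masses) (p : Reduced ℂ) : ℂ :=
  (-((m.σ0 : ℂ) + m.σ1) / 2 * (rDist p 0 ^ 2 / rDist p 1 ^ 2)
    + m.σ0 * rTerm p (m.σ0 * (alphaCoeff m * p.2.2.2 ^ 2))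
    + m.σ1 * rTerm p (-(m.σ1 * (alphaCoeff m * p.2.2.2 ^ 2)))) / rDist p 1

/-- The reduced parameters of real ellipses, with a separate ratio `ρ`. -/
def realPt (x : Phase ℝ) (ρ : ℝ) : Reduced ℂ :=
  (fun k i => (x.1 k i : ℂ), fun i => ((actG x i / actL x i : ℝ) : ℂ),
    fun i => ((actH x i / actG x i : ℝ) : ℂ), (ρ : ℂ))

variable {x : Phase ℝ} {ρ : ℝ}

theorem rEcc_realPt (hx : NonDegenerate x) (i : Fin 2) : rEcc (realPt x ρ) i = ecc x i := by
  have h := (hx i).1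
  rw [rEcc, ecc, realPt, ← csqrt_ofReal (by nlinarith)]
  push_cast
  rfl

theorem ecc_lt_one (hx : NonDegenerate x) (i : Fin 2) : ecc x i < 1 := by
  have h := (hx i).1
  rw [ecc, Real.sqrt_lt' one_pos]
  nlinarith

theorem sqrt_one_sub_ecc_sq (hx : NonDegenerate x) (i : Fin 2) :
    √(1 - ecc x i ^ 2) = actG x i / actL x i := by
  have h := (hx i).1
  rw [ecc, Real.sq_sqrt (by nlinarith), sub_sub_cancel, Real.sqrt_sq h.1.le]

theorem rSin_realPt (hx : NonDegenerate x) (i : Fin 2) :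
    rSin (realPt x ρ) i = Real.sin (incl x i) := by
  have h := (hx i).2
  rw [rSin, incl, Real.sin_arccos, realPt, ← csqrt_ofReal (by nlinarith)]
  push_cast
  rfl

theorem cos_incl (hx : NonDegenerate x) (i : Fin 2) :
    Real.cos (incl x i) = actH x i / actG x i :=
  Real.cos_arccos (hx i).2.1.le (hx i).2.2.le

theorem rAnomaly_realPt (hx : NonDegenerate x) (i : Fin 2) :
    rAnomaly (realPt x ρ) i = eccAnomaly (ecc x i) (ell x i) := by
  rw [rAnomaly, rEcc_realPt hx]
  exact keplerU_ofReal (ecc_nonneg x i) (ecc_lt_one hx i) _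

theorem rDist_realPt (hx : NonDegenerate x) (i : Fin 2) :
    rDist (realPt x ρ) i = unitDist x i := by
  rw [rDist, rAnomaly_realPt hx, rEcc_realPt hx, unitDist]
  push_cast
  rfl

theorem rPos_realPt (hx : NonDegenerate x) (i : Fin 2) (j : Fin 3) :
    rPos (realPt x ρ) i j = (unitPos x i j : ℝ) := by
  have h1 : (realPt x ρ).2.2.1 i = (Real.cos (incl x i) : ℝ) := by
    rw [cos_incl hx]; rfl
  have h2 : (realPt x ρ).2.1 i = (√(1 - ecc x i ^ 2) : ℝ) := by
    rw [sqrt_one_sub_ecc_sq hx]; rfl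
  have h3 : (realPt x ρ).1 1 i = (argPeri x i : ℝ) := rfl
  have h4 : (realPt x ρ).1 2 i = (node x i : ℝ) := rfl
  rw [rPos, rAnomaly_realPt hx, rEcc_realPt hx, h2]
  simp only [rPeri, rPerp, rSin_realPt hx, h1, h3, h4, unitPos, periVec, perpVec]
  fin_cases j <;> simp

theorem rInner_realPt (hx : NonDegenerate x) :
    rInner (realPt x ρ) = (inner ℝ (unitPos x 0) (unitPos x 1) : ℝ) := by
  rw [rInner]
  simp only [rPos_realPt hx, PiLp.inner_apply, RCLike.inner_apply, conj_trivial]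
  push_cast
  exact Finset.sum_congr rfl fun j _ => mul_comm _ _

theorem unitDist_pos (hx : NonDegenerate x) (i : Fin 2) : 0 < unitDist x i := by
  linarith [le_unitDist x i, ecc_lt_one hx i]

/-- At real ellipses the argument of the root is the square of a real number, so the principal
branch returns the quotient of distances. -/
theorem one_add_mul_rEta (hx : NonDegenerate x) (β : ℝ) :
    1 + (β : ℂ) * rEta (realPt x ρ) β =
      ((‖unitPos x 1 - β • unitPos x 0‖ / unitDist x 1) ^ 2 : ℝ) := by
  have h0 := (unitDist_pos hx 1).ne'
  rw [rEta, rInner_realPt hx, rDist_realPt hx, rDist_realPt hx, div_pow, norm_sub_sq_real,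
    norm_smul, mul_pow, norm_unitPos, norm_unitPos, inner_smul_right, Real.norm_eq_abs, sq_abs,
    real_inner_comm]
  have h0' : (unitDist x 1 : ℂ) ≠ 0 := by exact_mod_cast h0
  push_cast
  field_simp
  ring

theorem rRoot_realPt (hx : NonDegenerate x) (β : ℝ) :
    rRoot (realPt x ρ) β = (‖unitPos x 1 - β • unitPos x 0‖ / unitDist x 1 : ℝ) := by
  have h0 := unitDist_pos hx 1
  rw [rRoot, one_add_mul_rEta hx, csqrt_ofReal (sq_nonneg _), Real.sqrt_sq (by positivity)]

/-- The ellipses scaled by `β` and `1` do not meet. -/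
theorem norm_sub_pos {β : ℝ} (hβ : |β| * (1 + ecc x 0) < 1 - ecc x 1) :
    0 < ‖unitPos x 1 - β • unitPos x 0‖ := by
  have h1 := norm_sub_norm_le (unitPos x 1) (β • unitPos x 0)
  rw [norm_smul, norm_unitPos, norm_unitPos, Real.norm_eq_abs] at h1
  have h2 := mul_le_mul_of_nonneg_left (unitDist_le x 0) (abs_nonneg β)
  linarith [le_unitDist x 1]

end Reduced

end LunarThreeBody

namespace LunarThreeBody

open scoped Real Topology
open Set Filter Metric

/-! ### Analyticity of the perturbing function and the complex Hamiltonian -/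

section Perturbation

variable {x : Phase ℝ} {ρ : ℝ}

theorem analyticAt_angle (k : Fin 3) (i : Fin 2) (p : Reduced ℂ) :
    AnalyticAt ℂ (fun p : Reduced ℂ => p.1 k i) p :=
  ((ContinuousLinearMap.proj i : (Fin 2 → ℂ) →L[ℂ] ℂ).comp
    ((ContinuousLinearMap.proj k : (Fin 3 → Fin 2 → ℂ) →L[ℂ] (Fin 2 → ℂ)).comp
      (ContinuousLinearMap.fst ℂ _ ((Fin 2 → ℂ) × (Fin 2 → ℂ) × ℂ)))).analyticAt p

theorem analyticAt_ratioG (i : Fin 2) (p : Reduced ℂ) :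
    AnalyticAt ℂ (fun p : Reduced ℂ => p.2.1 i) p :=
  ((ContinuousLinearMap.proj i : (Fin 2 → ℂ) →L[ℂ] ℂ).comp
    ((ContinuousLinearMap.fst ℂ _ ((Fin 2 → ℂ) × ℂ)).comp
      (ContinuousLinearMap.snd ℂ (Fin 3 → Fin 2 → ℂ) _))).analyticAt p

theorem analyticAt_ratioH (i : Fin 2) (p : Reduced ℂ) :
    AnalyticAt ℂ (fun p : Reduced ℂ => p.2.2.1 i) p :=
  ((ContinuousLinearMap.proj i : (Fin 2 → ℂ) →L[ℂ] ℂ).comp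
    ((ContinuousLinearMap.fst ℂ _ ℂ).comp ((ContinuousLinearMap.snd ℂ (Fin 2 → ℂ) _).comp
      (ContinuousLinearMap.snd ℂ (Fin 3 → Fin 2 → ℂ) _)))).analyticAt p

theorem analyticAt_ratioL (p : Reduced ℂ) :
    AnalyticAt ℂ (fun p : Reduced ℂ => p.2.2.2) p :=
  ((ContinuousLinearMap.snd ℂ (Fin 2 → ℂ) ℂ).comp ((ContinuousLinearMap.snd ℂ (Fin 2 → ℂ) _).comp
      (ContinuousLinearMap.snd ℂ (Fin 3 → Fin 2 → ℂ) _))).analyticAt p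

theorem analyticAt_rEcc (hx : NonDegenerate x) (i : Fin 2) :
    AnalyticAt ℂ (fun p => rEcc p i) (realPt x ρ) := by
  refine analyticAt_csqrt_comp (analyticAt_const.sub ((analyticAt_ratioG i _).pow 2)) ?_
  have h := (hx i).1
  have : (1 : ℂ) - (realPt x ρ).2.1 i ^ 2 = ((1 - (actG x i / actL x i) ^ 2 : ℝ) : ℂ) := by
    simp [realPt]
  rw [this, Complex.ofReal_mem_slitPlane]
  nlinarith

theorem analyticAt_rSin (hx : NonDegenerate x) (i : Fin 2) :
    AnalyticAt ℂ (fun p => rSin p i) (realPt x ρ) := by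
  refine analyticAt_csqrt_comp (analyticAt_const.sub ((analyticAt_ratioH i _).pow 2)) ?_
  have h := (hx i).2
  have : (1 : ℂ) - (realPt x ρ).2.2.1 i ^ 2 = ((1 - (actH x i / actG x i) ^ 2 : ℝ) : ℂ) := by
    simp [realPt]
  rw [this, Complex.ofReal_mem_slitPlane]
  nlinarith

theorem analyticAt_rAnomaly (hx : NonDegenerate x) (i : Fin 2) :
    AnalyticAt ℂ (fun p => rAnomaly p i) (realPt x ρ) := by
  have h1 := analyticAt_keplerU (ecc_nonneg x i) (ecc_lt_one hx i) (ell x i)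
  have h2 : AnalyticAt ℂ (fun p : Reduced ℂ => (rEcc p i, p.1 0 i)) (realPt x ρ) :=
    (analyticAt_rEcc hx i).prod (analyticAt_angle 0 i _)
  refine AnalyticAt.fun_comp (g := fun p : ℂ × ℂ => keplerU p.1 p.2) ?_ h2
  simp only [rEcc_realPt hx]
  exact h1

theorem analyticAt_rPos (hx : NonDegenerate x) (i : Fin 2) (j : Fin 3) :
    AnalyticAt ℂ (fun p => rPos p i j) (realPt x ρ) := by
  have h1 := analyticAt_rEcc (ρ := ρ) hx i
  have h2 := analyticAt_rSin (ρ := ρ) hx i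
  have h3 := analyticAt_rAnomaly (ρ := ρ) hx i
  have h4 : AnalyticAt ℂ (fun p => Complex.cos (rAnomaly p i)) (realPt x ρ) :=
    AnalyticAt.fun_comp Complex.analyticAt_cos h3
  have h5 : AnalyticAt ℂ (fun p => Complex.sin (rAnomaly p i)) (realPt x ρ) :=
    AnalyticAt.fun_comp Complex.analyticAt_sin h3
  have hs : ∀ k, AnalyticAt ℂ (fun p : Reduced ℂ => Complex.sin (p.1 k i)) (realPt x ρ) :=
    fun k => AnalyticAt.fun_comp Complex.analyticAt_sin (analyticAt_angle k i _)
  have hc : ∀ k, AnalyticAt ℂ (fun p : Reduced ℂ => Complex.cos (p.1 k i)) (realPt x ρ) :=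
    fun k => AnalyticAt.fun_comp Complex.analyticAt_cos (analyticAt_angle k i _)
  have hs1 := hs 1
  have hs2 := hs 2
  have hc1 := hc 1
  have hc2 := hc 2
  have hq : AnalyticAt ℂ (fun p : Reduced ℂ => p.2.1 i) (realPt x ρ) := analyticAt_ratioG i _
  have hh : AnalyticAt ℂ (fun p : Reduced ℂ => p.2.2.1 i) (realPt x ρ) := analyticAt_ratioH i _
  have key : ∀ {P R : Reduced ℂ → ℂ}, AnalyticAt ℂ P (realPt x ρ) → AnalyticAt ℂ R (realPt x ρ) →
      AnalyticAt ℂ (fun p => (Complex.cos (rAnomaly p i) - rEcc p i) * P p +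
        p.2.1 i * Complex.sin (rAnomaly p i) * R p) (realPt x ρ) := fun hP hR =>
    ((h4.sub h1).mul hP).add ((hq.mul h5).mul hR)
  refine key ?_ ?_
  · fin_cases j
    · exact (hc2.mul hc1).sub ((hs2.mul hh).mul hs1)
    · exact (hs2.mul hc1).add ((hc2.mul hh).mul hs1)
    · exact h2.mul hs1
  · fin_cases j
    · exact ((hc2.mul hs1).neg).sub ((hs2.mul hh).mul hc1)
    · exact ((hs2.mul hs1).neg).add ((hc2.mul hh).mul hc1)
    · exact h2.mul hc1

theorem analyticAt_rDist (hx : NonDegenerate x) (i : Fin 2) :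
    AnalyticAt ℂ (fun p => rDist p i) (realPt x ρ) :=
  analyticAt_const.sub ((analyticAt_rEcc hx i).mul
    (AnalyticAt.fun_comp Complex.analyticAt_cos (analyticAt_rAnomaly hx i)))

theorem rDist_ne_zero (hx : NonDegenerate x) (i : Fin 2) : rDist (realPt x ρ) i ≠ 0 := by
  rw [rDist_realPt hx]
  exact_mod_cast (unitDist_pos hx i).ne'

theorem analyticAt_rTerm (hx : NonDegenerate x) {β : Reduced ℂ → ℂ} {β₀ : ℝ}
    (hβ : AnalyticAt ℂ β (realPt x ρ)) (hβ0 : β (realPt x ρ) = β₀)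
    (hlt : |β₀| * (1 + ecc x 0) < 1 - ecc x 1) :
    AnalyticAt ℂ (fun p => rTerm p (β p)) (realPt x ρ) := by
  have hI : AnalyticAt ℂ rInner (realPt x ρ) := by
    have : rInner = fun p => ∑ j, rPos p 0 j * rPos p 1 j := rfl
    rw [this]
    exact Finset.analyticAt_fun_sum _ fun j _ =>
      (analyticAt_rPos hx 0 j).mul (analyticAt_rPos hx 1 j)
  have hη : AnalyticAt ℂ (fun p => rEta p (β p)) (realPt x ρ) :=
    (((analyticAt_const (v := (-2 : ℂ))).mul hI).add (hβ.mul ((analyticAt_rDist hx 0).pow 2))).div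
      ((analyticAt_rDist hx 1).pow 2) (pow_ne_zero 2 (rDist_ne_zero hx 1))
  have hpos : 0 < ‖unitPos x 1 - β₀ • unitPos x 0‖ / unitDist x 1 :=
    div_pos (norm_sub_pos hlt) (unitDist_pos hx 1)
  have hS : AnalyticAt ℂ (fun p => rRoot p (β p)) (realPt x ρ) := by
    refine analyticAt_csqrt_comp (analyticAt_const.add (hβ.mul hη)) ?_
    simp only [hβ0, one_add_mul_rEta hx]
    rw [Complex.ofReal_mem_slitPlane]
    positivity
  refine ((hη.pow 2).mul (hS.add analyticAt_const)).div
    (((analyticAt_const (v := (2 : ℂ))).mul hS).mul ((hS.add analyticAt_const).pow 2)) ?_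
  simp only [hβ0, rRoot_realPt hx]
  norm_cast
  positivity

theorem analyticAt_rBracket {m : Masses} (hx : NonDegenerate x)
    (h0 : |m.σ0 * (alphaCoeff m * ρ ^ 2)| * (1 + ecc x 0) < 1 - ecc x 1)
    (h1 : |m.σ1 * (alphaCoeff m * ρ ^ 2)| * (1 + ecc x 0) < 1 - ecc x 1) :
    AnalyticAt ℂ (rBracket m) (realPt x ρ) := by
  have t0 : AnalyticAt ℂ (fun p => rTerm p (m.σ0 * (alphaCoeff m * p.2.2.2 ^ 2)))
      (realPt x ρ) := analyticAt_rTerm hx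
        (analyticAt_const.mul (analyticAt_const.mul ((analyticAt_ratioL _).pow 2)))
      (β₀ := m.σ0 * (alphaCoeff m * ρ ^ 2))
      (by push_cast; rfl) h0
  have t1 : AnalyticAt ℂ (fun p => rTerm p (-(m.σ1 * (alphaCoeff m * p.2.2.2 ^ 2))))
      (realPt x ρ) := analyticAt_rTerm hx
        (analyticAt_const.mul (analyticAt_const.mul ((analyticAt_ratioL _).pow 2))).neg
      (β₀ := -(m.σ1 * (alphaCoeff m * ρ ^ 2)))
      (by push_cast; rfl) (by rwa [abs_neg])
  have hr : AnalyticAt ℂ (fun p => rDist p 0 ^ 2 / rDist p 1 ^ 2) (realPt x ρ) :=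
    ((analyticAt_rDist hx 0).pow 2).div ((analyticAt_rDist hx 1).pow 2)
      (pow_ne_zero 2 (rDist_ne_zero hx 1))
  exact (((analyticAt_const.mul hr).add (analyticAt_const.mul t0)).add
    (analyticAt_const.mul t1)).div (analyticAt_rDist hx 1) (rDist_ne_zero hx 1)

/-- Translation of the angles in the reduced parameters. -/
def rShift (k : Fin 3 → Fin 2 → ℤ) (p : Reduced ℂ) : Reduced ℂ :=
  (fun j i => p.1 j i + 2 * π * k j i, p.2)

/-- No domain is needed: the anomaly enters only through its sine and cosine. -/
theorem rBracket_rShift (m : Masses) (k : Fin 3 → Fin 2 → ℤ) (p : Reduced ℂ) :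
    rBracket m (rShift k p) = rBracket m p := by
  have hper : ∀ (u : ℂ) (k : ℤ), Complex.sin (u + 2 * π * k) = Complex.sin u := fun u k => by
    rw [mul_comm (2 * (π : ℂ))]; exact Complex.sin_periodic.int_mul k u
  have hper' : ∀ (u : ℂ) (k : ℤ), Complex.cos (u + 2 * π * k) = Complex.cos u := fun u k => by
    rw [mul_comm (2 * (π : ℂ))]; exact Complex.cos_periodic.int_mul k u
  have hE : ∀ i, rEcc (rShift k p) i = rEcc p i := fun i => rfl
  have hSi : ∀ i, rSin (rShift k p) i = rSin p i := fun i => rfl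
  have hs : ∀ i, Complex.sin (rAnomaly (rShift k p) i) = Complex.sin (rAnomaly p i) := fun i =>
    (keplerU_add_two_pi (rEcc p i) (p.1 0 i) (k 0 i)).1
  have hc : ∀ i, Complex.cos (rAnomaly (rShift k p) i) = Complex.cos (rAnomaly p i) := fun i =>
    (keplerU_add_two_pi (rEcc p i) (p.1 0 i) (k 0 i)).2
  have hD : ∀ i, rDist (rShift k p) i = rDist p i := fun i => by rw [rDist, rDist, hc, hE]
  have hP : ∀ i, rPeri (rShift k p) i = rPeri p i := fun i => by
    simp only [rPeri, hSi]
    simp only [rShift, hper, hper']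
  have hN : ∀ i, rPerp (rShift k p) i = rPerp p i := fun i => by
    simp only [rPerp, hSi]
    simp only [rShift, hper, hper']
  have hX : ∀ i j, rPos (rShift k p) i j = rPos p i j := fun i j => by
    simp only [rPos, hs, hc, hE, hP, hN]
    rfl
  have hI : rInner (rShift k p) = rInner p := by simp only [rInner, hX]
  have hη : ∀ β, rEta (rShift k p) β = rEta p β := fun β => by simp only [rEta, hI, hD]
  have hT : ∀ β, rTerm (rShift k p) β = rTerm p β := fun β => by simp only [rTerm, rRoot, hη]
  simp only [rBracket, hD, hT]
  rfl

/-- The reduced parameters of a point of the phase space. -/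
def red (z : Phase ℂ) : Reduced ℂ :=
  (z.1, fun i => z.2 1 i / z.2 0 i, fun i => z.2 2 i / z.2 1 i, z.2 0 0 / z.2 0 1)

theorem red_toC (x : Phase ℝ) : red (toC x) = realPt x (actL x 0 / actL x 1) := by
  ext <;> simp [red, realPt, toC, actG, actL, actH]

/-- The outer semi major axis. -/
def outerAxisC (m : Masses) (z : Phase ℂ) : ℂ := z.2 0 1 ^ 2 / ((m.μ 1 : ℂ) ^ 2 * (m.M 1 : ℂ))

/-- The perturbing function on the complex phase space. -/
def pertC (m : Masses) (z : Phase ℂ) : ℂ :=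
  -((m.μ 0 * m.m2 : ℝ) : ℂ) * (alphaC m z ^ 2 / outerAxisC m z) * rBracket m (red z)

/-- The Hamiltonian on the complex phase space. -/
def hamC (m : Masses) (z : Phase ℂ) : ℂ :=
  keplerE (fun i => m.μ i ^ 3 * m.M i ^ 2) 0 z + keplerE (fun i => m.μ i ^ 3 * m.M i ^ 2) 1 z
    + pertC m z

theorem Masses.Positive.μ_pos {m : Masses} (hm : m.Positive) (i : Fin 2) : 0 < m.μ i := by
  obtain ⟨h0, h1, h2⟩ := hm
  fin_cases i <;> simp [Masses.μ] <;> positivity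

theorem Masses.Positive.M_pos {m : Masses} (hm : m.Positive) (i : Fin 2) : 0 < m.M i := by
  obtain ⟨h0, h1, h2⟩ := hm
  fin_cases i <;> simp [Masses.M] <;> positivity

theorem Masses.Positive.σ0_pos {m : Masses} (hm : m.Positive) : 0 < m.σ0 := by
  obtain ⟨h0, h1, h2⟩ := hm
  rw [Masses.σ0]; positivity

theorem Masses.Positive.σ1_pos {m : Masses} (hm : m.Positive) : 0 < m.σ1 := by
  obtain ⟨h0, h1, h2⟩ := hm
  rw [Masses.σ1]; positivity

/-- The vis-viva relation: kinetic plus potential energy is −μM/(2a), and L² = μ²Ma. -/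
theorem kepler_energy {m : Masses} (hm : m.Positive) (hx : NonDegenerate x) (i : Fin 2)
    (hL : 0 < actL x i) :
    ‖momP m x i‖ ^ 2 / (2 * m.μ i) - m.μ i * m.M i / ‖posQ m x i‖ =
      -(m.μ i ^ 3 * m.M i ^ 2) / (2 * actL x i ^ 2) := by
  have hμ := hm.μ_pos i
  have hM := hm.M_pos i
  have ha : 0 < semiAxis m x i := by rw [semiAxis]; positivity
  have hd := unitDist_pos hx i
  rw [posQ_eq, norm_smul, norm_unitPos, Real.norm_of_nonneg ha.le, momP, norm_smul, mul_pow,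
    norm_sq_comb, Real.norm_eq_abs, sq_abs, div_pow, mul_pow, mul_pow, mul_pow,
    Real.sq_sqrt (by positivity), Real.sq_sqrt (by linarith [ecc_sq_le x i]), neg_sq]
  have hsin : Real.sin (eccAnomaly (ecc x i) (ell x i)) ^ 2 =
      1 - Real.cos (eccAnomaly (ecc x i) (ell x i)) ^ 2 := by
    rw [← Real.sin_sq_add_cos_sq (eccAnomaly (ecc x i) (ell x i))]; ring
  rw [hsin]
  have hL2 : actL x i ^ 2 = semiAxis m x i * (m.μ i ^ 2 * m.M i) := by
    rw [semiAxis]; field_simp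
  rw [hL2]
  rw [unitDist] at hd ⊢
  set c := Real.cos (eccAnomaly (ecc x i) (ell x i))
  set e := ecc x i
  set a := semiAxis m x i
  have hd' : 1 - e * c ≠ 0 := hd.ne'
  field_simp
  ring

/-- With S² = 1 + βη, both 1/S − 1 + βη/2 and the remainder equal (S − 1)²(S + 2)/(2S). This exact
identity replaces an expansion in Legendre polynomials, and the remainder is analytic wherever S and
S + 1 do not vanish. -/
theorem inv_root_expansion {S β η : ℂ} (hS : S ≠ 0) (hS1 : S + 1 ≠ 0) (h : 1 + β * η = S ^ 2) :
    1 / S - 1 = -(β * η) / 2 + β ^ 2 * (η ^ 2 * (S + 2) / (2 * S * (S + 1) ^ 2)) := by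
  have h1 : β * η = S ^ 2 - 1 := by linear_combination h
  have h2 : β ^ 2 * (η ^ 2 * (S + 2) / (2 * S * (S + 1) ^ 2)) =
      (β * η) ^ 2 * (S + 2) / (2 * S * (S + 1) ^ 2) := by ring
  rw [h2, h1]
  field_simp
  ring

theorem alpha_eq {m : Masses} (hm : m.Positive) (x : Phase ℝ) :
    alpha m x = alphaCoeff m * (actL x 0 / actL x 1) ^ 2 := by
  have h0 := (hm.μ_pos 0).ne'
  have h1 := (hm.μ_pos 1).ne'
  have h2 := (hm.M_pos 0).ne'
  have h3 := (hm.M_pos 1).ne'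
  rw [alpha, semiAxis, semiAxis, alphaCoeff, div_pow, div_div_div_eq, div_mul_div_comm]
  congr 1
  ring

theorem inv_dist_expansion {m : Masses} (hx : NonDegenerate x) (hL : ∀ i, 0 < actL x i)
    (hm : m.Positive) (σ : ℝ)
    (h0 : |σ * alpha m x| * (1 + ecc x 0) < 1 - ecc x 1) :
    ((1 / ‖posQ m x 1 - σ • posQ m x 0‖ - 1 / ‖posQ m x 1‖ : ℝ) : ℂ) =
      1 / (semiAxis m x 1 * rDist (realPt x ρ) 1) *
        (-((σ * alpha m x : ℝ) * rEta (realPt x ρ) (σ * alpha m x : ℝ)) / 2 +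
          ((σ * alpha m x : ℝ) : ℂ) ^ 2 * rTerm (realPt x ρ) (σ * alpha m x : ℝ)) := by
  set β := σ * alpha m x with hβ
  have ha : ∀ i, 0 < semiAxis m x i := fun i => by
    have := hm.μ_pos i
    have := hm.M_pos i
    have := hL i
    rw [semiAxis]; positivity
  have hd := unitDist_pos hx 1
  have hn := norm_sub_pos h0
  have hpos : posQ m x 1 - σ • posQ m x 0 =
      semiAxis m x 1 • (unitPos x 1 - β • unitPos x 0) := by
    rw [posQ_eq, posQ_eq, smul_sub, smul_smul, smul_smul, hβ, alpha]
    congr 2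
    have := (ha 1).ne'
    field_simp
  have hS := rRoot_realPt (ρ := ρ) hx β
  have hSpos : 0 < ‖unitPos x 1 - β • unitPos x 0‖ / unitDist x 1 := div_pos hn hd
  have hsq : 1 + (β : ℂ) * rEta (realPt x ρ) β = rRoot (realPt x ρ) β ^ 2 := by
    rw [one_add_mul_rEta hx, hS]; push_cast; rfl
  rw [rTerm, ← inv_root_expansion ?_ ?_ hsq, hS, rDist_realPt hx, hpos, posQ_eq, norm_smul,
    norm_smul, norm_unitPos, Real.norm_of_nonneg (ha 1).le]
  · norm_cast
    have := (ha 1).ne'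
    field_simp
  · rw [hS]; exact_mod_cast hSpos.ne'
  · rw [hS]; norm_cast; positivity

theorem alphaC_toC (m : Masses) (x : Phase ℝ) : alphaC m (toC x) = alpha m x := by
  simp [alphaC, alpha, semiAxis, toC, actL]

/-- The Hamiltonian on the complex phase space extends the one in Delaunay variables. -/
theorem hamC_toC {m : Masses} (hm : m.Positive) (hx : NonDegenerate x) (hL : ∀ i, 0 < actL x i)
    (h0 : |m.σ0 * alpha m x| * (1 + ecc x 0) < 1 - ecc x 1)
    (h1 : |m.σ1 * alpha m x| * (1 + ecc x 0) < 1 - ecc x 1) :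
    hamC m (toC x) = F m x ∧ pertC m (toC x) = FPert m (posQ m x) := by
  have hP : pertC m (toC x) = FPert m (posQ m x) := by
    have e0 := inv_dist_expansion (ρ := actL x 0 / actL x 1) hx hL hm m.σ0 h0
    have e1 := inv_dist_expansion (ρ := actL x 0 / actL x 1) hx hL hm (-m.σ1)
      (by rwa [neg_mul, abs_neg])
    rw [neg_smul, sub_neg_eq_add] at e1
    have hF : ((FPert m (posQ m x) : ℝ) : ℂ) = -((m.μ 0 * m.m2 : ℝ) : ℂ) *
        (1 / (m.σ0 : ℂ) * ((1 / ‖posQ m x 1 - m.σ0 • posQ m x 0‖ - 1 / ‖posQ m x 1‖ : ℝ) : ℂ)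
        + 1 / (m.σ1 : ℂ) * ((1 / ‖posQ m x 1 + m.σ1 • posQ m x 0‖ - 1 / ‖posQ m x 1‖ : ℝ) : ℂ)) := by
      rw [FPert]; push_cast; ring
    rw [hF, e0, e1, pertC, alphaC_toC, red_toC, rBracket]
    have hα : (alphaCoeff m : ℂ) * (realPt x (actL x 0 / actL x 1)).2.2.2 ^ 2 = alpha m x := by
      rw [alpha_eq hm]; simp [realPt]
    have ha : outerAxisC m (toC x) = semiAxis m x 1 := by
      simp [outerAxisC, semiAxis, toC, actL]
    rw [hα, ha]
    have hσ0 : (m.σ0 : ℂ) ≠ 0 := by exact_mod_cast hm.σ0_pos.ne'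
    have hσ1 : (m.σ1 : ℂ) ≠ 0 := by exact_mod_cast hm.σ1_pos.ne'
    have hd := rDist_ne_zero (ρ := actL x 0 / actL x 1) hx 1
    have c0 : ((m.σ0 * alpha m x : ℝ) : ℂ) = m.σ0 * alpha m x := by push_cast; ring
    have c1 : ((-m.σ1 * alpha m x : ℝ) : ℂ) = -(m.σ1 * alpha m x) := by push_cast; ring
    rw [c0, c1]
    set p := realPt x (actL x 0 / actL x 1)
    have ha0 : (semiAxis m x 1 : ℂ) ≠ 0 := by
      have := hm.μ_pos 1
      have := hm.M_pos 1
      have := hL 1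
      have : 0 < semiAxis m x 1 := by rw [semiAxis]; positivity
      exact_mod_cast this.ne'
    -- The terms linear in α, which contain the inner product of the positions, enter with weights
    -- σ₀/σ₀ and −σ₁/σ₁ and cancel; a factor α² is left.
    rw [rEta, rEta]
    field_simp
    ring
  refine ⟨?_, hP⟩
  rw [hamC, hP, F, FKep]
  have k0 := kepler_energy hm hx 0 (hL 0)
  have k1 := kepler_energy hm hx 1 (hL 1)
  have e0 : keplerE (fun i => m.μ i ^ 3 * m.M i ^ 2) 0 (toC x) =
      ((-(m.μ 0 ^ 3 * m.M 0 ^ 2) / (2 * actL x 0 ^ 2) : ℝ) : ℂ) := by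
    rw [keplerE]; push_cast; rfl
  have e1 : keplerE (fun i => m.μ i ^ 3 * m.M i ^ 2) 1 (toC x) =
      ((-(m.μ 1 ^ 3 * m.M 1 ^ 2) / (2 * actL x 1 ^ 2) : ℝ) : ℂ) := by
    rw [keplerE]; push_cast; rfl
  rw [e0, e1, ← k0, ← k1]
  push_cast
  ring

end Perturbation

end LunarThreeBody

namespace LunarThreeBody

open scoped Real Topology
open Set Filter Metric

/-! ## Regions bounded by affine walls in the actions -/

section Walls

/-- Bounds for `L₁`, `L₂ / L₁`, `G / L` and `H / G`. -/
structure Walls where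
  lLo : ℝ
  lHi : ℝ
  ratio : ℝ
  qLo : Fin 2 → ℝ
  qHi : Fin 2 → ℝ
  cLo : Fin 2 → ℝ
  cHi : Fin 2 → ℝ

namespace Walls

structure Proper (R : Walls) : Prop where
  lLo_pos : 0 < R.lLo
  lLo_lt : R.lLo < R.lHi
  ratio_pos : 0 < R.ratio
  qLo_pos : ∀ i, 0 < R.qLo i
  qLo_lt : ∀ i, R.qLo i < R.qHi i
  qHi_lt : ∀ i, R.qHi i < 1
  cLo_gt : ∀ i, -1 < R.cLo i
  cLo_lt : ∀ i, R.cLo i < R.cHi i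
  cHi_lt : ∀ i, R.cHi i < 1

/-- The affine functions of the actions whose positivity defines the region. -/
def wall (R : Walls) : Fin 3 ⊕ (Fin 4 × Fin 2) → (Fin 3 → Fin 2 → ℝ) → ℝ
  | .inl 0, y => y 0 0 - R.lLo
  | .inl 1, y => R.lHi - y 0 0
  | .inl 2, y => y 0 1 - R.ratio * y 0 0
  | .inr (0, i), y => y 1 i - R.qLo i * y 0 i
  | .inr (1, i), y => R.qHi i * y 0 i - y 1 i
  | .inr (2, i), y => y 2 i - R.cLo i * y 1 i
  | .inr (3, i), y => R.cHi i * y 1 i - y 2 i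

/-- The region of the actions bounded by the walls. -/
def actions (R : Walls) : Set (Fin 3 → Fin 2 → ℝ) := {y | ∀ w, 0 < R.wall w y}

/-- The region of the phase space bounded by the walls. -/
def region (R : Walls) : Set (Phase ℝ) := {x | x.2 ∈ R.actions}

variable {R : Walls}

theorem forall_wall {P : Fin 3 ⊕ (Fin 4 × Fin 2) → Prop} :
    (∀ w, P w) ↔ (P (.inl 0) ∧ P (.inl 1) ∧ P (.inl 2)) ∧
      ∀ i, P (.inr (0, i)) ∧ P (.inr (1, i)) ∧ P (.inr (2, i)) ∧ P (.inr (3, i)) := by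
  constructor
  · exact fun h => ⟨⟨h _, h _, h _⟩, fun i => ⟨h _, h _, h _, h _⟩⟩
  · rintro ⟨⟨h0, h1, h2⟩, h⟩ (w | ⟨w, i⟩)
    · fin_cases w <;> assumption
    · obtain ⟨a, b, c, d⟩ := h i
      fin_cases w <;> assumption

theorem mem_actions {y : Fin 3 → Fin 2 → ℝ} : y ∈ R.actions ↔
    (R.lLo < y 0 0 ∧ y 0 0 < R.lHi ∧ R.ratio * y 0 0 < y 0 1) ∧
      ∀ i, R.qLo i * y 0 i < y 1 i ∧ y 1 i < R.qHi i * y 0 i ∧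
        R.cLo i * y 1 i < y 2 i ∧ y 2 i < R.cHi i * y 1 i := by
  rw [actions, mem_ofPred_eq, forall_wall]
  simp only [wall, sub_pos]

theorem wall_affine (w) (y p : Fin 3 → Fin 2 → ℝ) (t : ℝ) :
    R.wall w ((1 - t) • y + t • p) = (1 - t) * R.wall w y + t * R.wall w p := by
  revert w
  rw [forall_wall]
  simp only [wall, Pi.add_apply, Pi.smul_apply, smul_eq_mul]
  refine ⟨⟨by ring, by ring, by ring⟩, fun i => ⟨by ring, by ring, by ring, by ring⟩⟩

theorem norm_action_le (v : Fin 3 → Fin 2 → ℝ) (k : Fin 3) (i : Fin 2) : |v k i| ≤ ‖v‖ :=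
  (norm_le_pi_norm (v k) i).trans (norm_le_pi_norm v k)

/-- In the maximum norm the Lipschitz constant of an affine function is the sum of the moduli of its
coefficients: at most 1 + ratio for the wall in L₂/L₁, and at most 2 for all others. -/
theorem Proper.wall_lipschitz (hR : R.Proper) (w) (y y' : Fin 3 → Fin 2 → ℝ) :
    R.wall w y - (2 + R.ratio) * ‖y - y'‖ ≤ R.wall w y' := by
  have hr := hR.ratio_pos
  have key : ∀ k i, y k i - y' k i ≤ ‖y - y'‖ ∧ y' k i - y k i ≤ ‖y - y'‖ := fun k i => by
    have h := abs_le.1 (norm_action_le (y - y') k i)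
    simp only [Pi.sub_apply] at h
    exact ⟨h.2, by linarith [h.1]⟩
  have h0 := norm_nonneg (y - y')
  revert w
  rw [forall_wall]
  simp only [wall]
  refine ⟨⟨?_, ?_, ?_⟩, fun i => ⟨?_, ?_, ?_, ?_⟩⟩
  · nlinarith [(key 0 0).1]
  · nlinarith [(key 0 0).2]
  · nlinarith [(key 0 1).1, (key 0 0).2]
  · nlinarith [(key 1 i).1, (key 0 i).2, hR.qLo_pos i, hR.qLo_lt i, hR.qHi_lt i]
  · nlinarith [(key 1 i).2, (key 0 i).1, hR.qLo_pos i, hR.qLo_lt i, hR.qHi_lt i]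
  · have h1 := hR.cLo_gt i
    have h2 := (hR.cLo_lt i).trans (hR.cHi_lt i)
    have h3 : |R.cLo i * (y 1 i - y' 1 i)| ≤ 1 * ‖y - y'‖ := by
      rw [abs_mul]
      exact mul_le_mul (abs_le.2 ⟨h1.le, h2.le⟩) (norm_action_le (y - y') 1 i) (abs_nonneg _)
        zero_le_one
    nlinarith [(key 2 i).1, (abs_le.1 h3).1]
  · have h1 := (hR.cLo_gt i).trans (hR.cLo_lt i)
    have h2 := hR.cHi_lt i
    have h3 : |R.cHi i * (y 1 i - y' 1 i)| ≤ 1 * ‖y - y'‖ := by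
      rw [abs_mul]
      exact mul_le_mul (abs_le.2 ⟨h1.le, h2.le⟩) (norm_action_le (y - y') 1 i) (abs_nonneg _)
        zero_le_one
    nlinarith [(key 2 i).2, (abs_le.1 h3).2]

theorem continuous_wall (w) : Continuous fun y => R.wall w y := by
  revert w
  rw [forall_wall]
  simp only [wall]
  exact ⟨⟨by fun_prop, by fun_prop, by fun_prop⟩,
    fun i => ⟨by fun_prop, by fun_prop, by fun_prop, by fun_prop⟩⟩

theorem angleInvariant_region : AngleInvariant R.region := fun _ hx _ => hx

theorem Proper.innerBounded (hR : R.Proper) : InnerBounded R.region :=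
  ⟨R.lLo, hR.lLo_pos, R.lHi, fun _ hx => ⟨(mem_actions.1 hx).1.1, (mem_actions.1 hx).1.2.1⟩⟩

/-- A positive lower bound for `L` and `G`. -/
theorem Proper.exists_lower (hR : R.Proper) :
    ∃ a > 0, ∀ y ∈ R.actions, ∀ i, a < y 0 i ∧ a < y 1 i := by
  have hl := hR.lLo_pos
  have hr := hR.ratio_pos
  have h0 := hR.qLo_pos 0
  have h1 := hR.qLo_pos 1
  refine ⟨min (min R.lLo (R.ratio * R.lLo)) (min (R.qLo 0 * R.lLo) (R.qLo 1 * (R.ratio * R.lLo))),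
    by positivity, fun y hy => ?_⟩
  obtain ⟨⟨a0, -, a2⟩, h⟩ := mem_actions.1 hy
  have b1 : R.ratio * R.lLo < y 0 1 := lt_trans (by gcongr) a2
  have g0 : R.qLo 0 * R.lLo < y 1 0 := lt_trans (by gcongr) (h 0).1
  have g1 : R.qLo 1 * (R.ratio * R.lLo) < y 1 1 := lt_trans (by gcongr) (h 1).1
  intro i
  fin_cases i
  · exact ⟨(min_le_left _ _).trans_lt ((min_le_left _ _).trans_lt a0),
      (min_le_right _ _).trans_lt ((min_le_left _ _).trans_lt g0)⟩
  · exact ⟨(min_le_left _ _).trans_lt ((min_le_right _ _).trans_lt b1),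
      (min_le_right _ _).trans_lt ((min_le_right _ _).trans_lt g1)⟩

theorem Proper.pos (hR : R.Proper) {y : Fin 3 → Fin 2 → ℝ} (hy : y ∈ R.actions) (i : Fin 2) :
    0 < y 0 i ∧ 0 < y 1 i := by
  obtain ⟨a, ha, h⟩ := hR.exists_lower
  exact ⟨ha.trans (h y hy i).1, ha.trans (h y hy i).2⟩

end Walls

end Walls

/-! ### The asynchronous region as a region bounded by walls -/

section Asynchronous

theorem Masses.Positive.alphaCoeff_pos {m : Masses} (hm : m.Positive) : 0 < alphaCoeff m := by
  have := hm.μ_pos 0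
  have := hm.μ_pos 1
  have := hm.M_pos 0
  have := hm.M_pos 1
  rw [alphaCoeff]; positivity

theorem alphaMax_pos {m : Masses} (hm : m.Positive) {b : Bounds} (hb : b.Admissible) :
    0 < alphaMax m b := by
  have h0 := hm.σ0_pos
  have h1 := hm.σ1_pos
  have h2 : 0 < 1 - b.eHi 1 := by linarith [(hb.2.2.1 1).2.2]
  rw [alphaMax]; positivity

/-- The walls of the asynchronous region. -/
def asyncWalls (m : Masses) (b : Bounds) : Walls where
  lLo := √(b.aLo * (m.μ 0 ^ 2 * m.M 0))
  lHi := √(b.aHi * (m.μ 0 ^ 2 * m.M 0))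
  ratio := √(alphaCoeff m / alphaMax m b)
  qLo i := √(1 - b.eHi i ^ 2)
  qHi i := √(1 - b.eLo i ^ 2)
  cLo i := Real.cos (b.iHi i)
  cHi i := Real.cos (b.iLo i)

theorem proper_asyncWalls {m : Masses} (hm : m.Positive) {b : Bounds} (hb : b.Admissible) :
    (asyncWalls m b).Proper := by
  have hμ := hm.μ_pos 0
  have hM := hm.M_pos 0
  have hα := alphaMax_pos hm hb
  have hκ := hm.alphaCoeff_pos
  obtain ⟨ha, hab, he, hi⟩ := hb
  have hk : 0 < m.μ 0 ^ 2 * m.M 0 := by positivity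
  refine ⟨?_, ?_, ?_, fun i => ?_, fun i => ?_, fun i => ?_, fun i => ?_, fun i => ?_, fun i => ?_⟩
  · exact Real.sqrt_pos.2 (by positivity)
  · exact Real.sqrt_lt_sqrt (by positivity) (by gcongr)
  · exact Real.sqrt_pos.2 (by positivity)
  · obtain ⟨h1, h2, h3⟩ := he i
    exact Real.sqrt_pos.2 (by nlinarith)
  · obtain ⟨h1, h2, h3⟩ := he i
    exact Real.sqrt_lt_sqrt (by nlinarith) (by nlinarith)
  · obtain ⟨h1, h2, h3⟩ := he i
    simp only [asyncWalls]
    rw [Real.sqrt_lt' one_pos]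
    nlinarith
  · obtain ⟨h1, h2, h3⟩ := hi i
    have := Real.strictAntiOn_cos ⟨by linarith, by linarith⟩ ⟨Real.pi_pos.le, le_rfl⟩ h3
    simpa [asyncWalls] using this
  · obtain ⟨h1, h2, h3⟩ := hi i
    exact Real.strictAntiOn_cos ⟨h1.le, by linarith⟩ ⟨by linarith, h3.le⟩ h2
  · obtain ⟨h1, h2, h3⟩ := hi i
    have := Real.strictAntiOn_cos ⟨le_rfl, Real.pi_pos.le⟩ ⟨by linarith, by linarith⟩ h1
    simpa [asyncWalls] using this

/-- The asynchronous region is bounded by affine walls in the actions. -/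
theorem PStar_eq_region {m : Masses} (hm : m.Positive) {b : Bounds} (hb : b.Admissible) :
    PStar m b = (asyncWalls m b).region := by
  have hR := proper_asyncWalls hm hb
  have hμ := hm.μ_pos 0
  have hM := hm.M_pos 0
  have hα := alphaMax_pos hm hb
  have hκ := hm.alphaCoeff_pos
  have hk : 0 < m.μ 0 ^ 2 * m.M 0 := by positivity
  have ha : ∀ x, 0 < actL x 0 → ((b.aLo < semiAxis m x 0 ↔ (asyncWalls m b).lLo < actL x 0) ∧
      (semiAxis m x 0 < b.aHi ↔ actL x 0 < (asyncWalls m b).lHi)) := fun x h0 => by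
    rw [semiAxis, lt_div_iff₀ hk, div_lt_iff₀ hk]
    exact ⟨(Real.sqrt_lt' h0).symm, (Real.lt_sqrt h0.le).symm⟩
  have he : ∀ x i, 0 < actL x i → 0 < actG x i →
      (b.eLo i < ecc x i ↔ actG x i < (asyncWalls m b).qHi i * actL x i) ∧
      (ecc x i < b.eHi i ↔ (asyncWalls m b).qLo i * actL x i < actG x i) := fun x i hL hG => by
    obtain ⟨h1, h2, h3⟩ := hb.2.2.1 i
    have hq : 0 < actG x i / actL x i := by positivity
    rw [ecc, Real.lt_sqrt h1.le, Real.sqrt_lt' (h1.trans h2), ← div_lt_iff₀ hL, ← lt_div_iff₀ hL]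
    simp only [asyncWalls]
    rw [Real.lt_sqrt hq.le, Real.sqrt_lt' hq]
    exact ⟨lt_sub_comm, sub_lt_comm⟩
  have hi : ∀ x i, 0 < actG x i →
      (b.iLo i < incl x i ∧ incl x i < b.iHi i ↔
        (asyncWalls m b).cLo i * actG x i < actH x i ∧
          actH x i < (asyncWalls m b).cHi i * actG x i) := fun x i hG => by
    obtain ⟨h1, h2, h3⟩ := hb.2.2.2 i
    rw [← div_lt_iff₀ hG, ← lt_div_iff₀ hG, incl]
    simp only [asyncWalls]
    set c := actH x i / actG x i
    constructor
    · rintro ⟨u, v⟩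
      constructor
      · by_contra! hc
        have := Real.antitone_arccos hc
        rw [Real.arccos_cos (by linarith) h3.le] at this
        linarith
      · by_contra! hc
        have := Real.antitone_arccos hc
        rw [Real.arccos_cos h1.le (by linarith)] at this
        linarith
    · rintro ⟨u, v⟩
      have m1 := Real.neg_one_le_cos (b.iHi i)
      have m2 := Real.cos_le_one (b.iLo i)
      constructor
      · have := Real.strictAntiOn_arccos (show c ∈ Icc (-1 : ℝ) 1 from ⟨by linarith, by linarith⟩)
          (show Real.cos (b.iLo i) ∈ Icc (-1 : ℝ) 1 from ⟨by linarith, by linarith⟩) v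
        rwa [Real.arccos_cos h1.le (by linarith)] at this
      · have := Real.strictAntiOn_arccos
          (show Real.cos (b.iHi i) ∈ Icc (-1 : ℝ) 1 from ⟨by linarith, by linarith⟩)
          (show c ∈ Icc (-1 : ℝ) 1 from ⟨by linarith, by linarith⟩) u
        rwa [Real.arccos_cos (by linarith) h3.le] at this
  have hal : ∀ x, 0 < actL x 0 → 0 < actL x 1 →
      (alpha m x < alphaMax m b ↔ (asyncWalls m b).ratio * actL x 0 < actL x 1) :=
    fun x h0 h1 => by
      rw [alpha_eq hm, ← lt_div_iff₀ h0]
      simp only [asyncWalls]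
      rw [Real.sqrt_lt' (by positivity), div_lt_iff₀ hα, ← inv_div (actL x 1), inv_pow,
        ← div_eq_mul_inv, div_lt_iff₀ (by positivity), mul_comm]
  ext x
  constructor
  · rintro ⟨hp, h1, h2, h3, h4⟩
    refine Walls.mem_actions.2 ⟨⟨?_, ?_, ?_⟩, fun i => ⟨?_, ?_, ?_, ?_⟩⟩
    · exact (ha x (hp 0).1).1.1 h1.1
    · exact (ha x (hp 0).1).2.1 h1.2
    · exact (hal x (hp 0).1 (hp 1).1).1 h4
    · exact (he x i (hp i).1 (hp i).2).2.1 (h2 i).2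
    · exact (he x i (hp i).1 (hp i).2).1.1 (h2 i).1
    · exact ((hi x i (hp i).2).1 (h3 i)).1
    · exact ((hi x i (hp i).2).1 (h3 i)).2
  · intro hx
    have hp := hR.pos hx
    obtain ⟨⟨h1, h2, h3⟩, h⟩ := Walls.mem_actions.1 hx
    exact ⟨hp, ⟨(ha x (hp 0).1).1.2 h1, (ha x (hp 0).1).2.2 h2⟩,
      fun i => ⟨(he x i (hp i).1 (hp i).2).1.2 (h i).2.1, (he x i (hp i).1 (hp i).2).2.2 (h i).1⟩,
      fun i => (hi x i (hp i).2).2 (h i).2.2, (hal x (hp 0).1 (hp 1).1).2 h3⟩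

end Asynchronous

end LunarThreeBody

namespace LunarThreeBody

open scoped Real Topology
open Set Filter Metric Asymptotics

/-! ## Uniform extension of the Hamiltonian -/

section Uniform

/-- The ellipses are non degenerate and, scaled by their semi major axes, do not meet. -/
def Good (m : Masses) (r : Reduced ℝ) : Prop :=
  (∀ i, (0 < r.2.1 i ∧ r.2.1 i < 1) ∧ (-1 < r.2.2.1 i ∧ r.2.2.1 i < 1)) ∧
  |m.σ0 * (alphaCoeff m * r.2.2.2 ^ 2)| * (1 + √(1 - r.2.1 0 ^ 2)) < 1 - √(1 - r.2.1 1 ^ 2) ∧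
  |m.σ1 * (alphaCoeff m * r.2.2.2 ^ 2)| * (1 + √(1 - r.2.1 0 ^ 2)) < 1 - √(1 - r.2.1 1 ^ 2)

theorem isOpen_good (m : Masses) : IsOpen {r | Good m r} := by
  simp only [Good]
  refine IsOpen.and ?_ (IsOpen.and ?_ ?_)
  · have h : ∀ i, IsOpen {r : Reduced ℝ | (0 < r.2.1 i ∧ r.2.1 i < 1) ∧
        (-1 < r.2.2.1 i ∧ r.2.2.1 i < 1)} := fun i =>
      ((isOpen_lt (by fun_prop) (by fun_prop)).and (isOpen_lt (by fun_prop) (by fun_prop))).and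
        ((isOpen_lt (by fun_prop) (by fun_prop)).and (isOpen_lt (by fun_prop) (by fun_prop)))
    simp only [ofPred_forall]
    exact isOpen_iInter_of_finite h
  · exact isOpen_lt (by fun_prop) (by fun_prop)
  · exact isOpen_lt (by fun_prop) (by fun_prop)

/-- Real parts of reduced parameters. -/
def reRed (p : Reduced ℂ) : Reduced ℝ :=
  (fun k i => (p.1 k i).re, fun i => (p.2.1 i).re, fun i => (p.2.2.1 i).re, p.2.2.2.re)

/-- Real reduced parameters as complex ones. -/
def castRed (r : Reduced ℝ) : Reduced ℂ :=
  (fun k i => (r.1 k i : ℂ), fun i => (r.2.1 i : ℂ), fun i => (r.2.2.1 i : ℂ), (r.2.2.2 : ℂ))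

theorem continuous_reRed : Continuous reRed := by
  unfold reRed
  fun_prop

theorem continuous_castRed : Continuous castRed := by
  unfold castRed
  fun_prop

/-- Ellipses with given reduced parameters. -/
def ptOf (r : Reduced ℝ) : Phase ℝ :=
  (r.1, ![fun _ => 1, r.2.1, fun i => r.2.2.1 i * r.2.1 i])

theorem realPt_ptOf {m : Masses} {r : Reduced ℝ} (h : Good m r) :
    realPt (ptOf r) r.2.2.2 = castRed r := by
  have hq : ∀ i, (r.2.1 i : ℂ) ≠ 0 := fun i => by exact_mod_cast (h.1 i).1.1.ne'
  ext <;> simp [realPt, ptOf, castRed, actG, actL, actH, hq]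

theorem good_analyticAt {m : Masses} {r : Reduced ℝ} (h : Good m r) :
    AnalyticAt ℂ (rBracket m) (castRed r) := by
  have hq : ∀ i, r.2.1 i ≠ 0 := fun i => (h.1 i).1.1.ne'
  have hn : NonDegenerate (ptOf r) := fun i => by
    simpa [ptOf, actG, actL, actH, hq] using h.1 i
  have he : ∀ i, ecc (ptOf r) i = √(1 - r.2.1 i ^ 2) := fun i => by
    simp [ptOf, ecc, actG, actL]
  rw [← realPt_ptOf h]
  exact analyticAt_rBracket hn (by rw [he, he]; exact h.2.1) (by rw [he, he]; exact h.2.2)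

theorem rShift_sub (k : Fin 3 → Fin 2 → ℤ) (p q : Reduced ℂ) :
    rShift k p - rShift k q = p - q := by
  ext <;> simp [rShift]

theorem analyticAt_rBracket_of_rShift {m : Masses} {k : Fin 3 → Fin 2 → ℤ} {p : Reduced ℂ}
    (h : AnalyticAt ℂ (rBracket m) (rShift k p)) : AnalyticAt ℂ (rBracket m) p := by
  have h1 : rShift k = fun p => p + (fun j i => 2 * (π : ℂ) * k j i, 0) := by
    funext p
    ext <;> simp [rShift]
  have h2 : AnalyticAt ℂ (rShift k) p := by
    rw [h1]
    exact analyticAt_id.add analyticAt_const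
  have h3 : rBracket m = rBracket m ∘ rShift k := by
    funext q
    exact (rBracket_rShift m k q).symm
  rw [h3]
  exact h.comp h2

/-- Every angle is congruent to one in `[0, 2π]`. -/
theorem exists_shift (θ : Fin 3 → Fin 2 → ℝ) :
    ∃ k : Fin 3 → Fin 2 → ℤ, ∀ j i, θ j i + 2 * π * k j i ∈ Icc 0 (2 * π) := by
  refine ⟨fun j i => -toIcoDiv Real.two_pi_pos 0 (θ j i), fun j i => ?_⟩
  have h := toIcoMod_mem_Ico Real.two_pi_pos 0 (θ j i)
  rw [toIcoMod, zero_add, zsmul_eq_mul] at h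
  push_cast
  exact ⟨by linarith [h.1], by linarith [h.2]⟩

/-- The compactness argument in the reduced parameters. -/
theorem exists_uniform (m : Masses) {R : Walls} (hR : R.Proper)
    (hgood : ∀ r : Reduced ℝ, (∀ i, R.qLo i ≤ r.2.1 i ∧ r.2.1 i ≤ R.qHi i) →
      (∀ i, R.cLo i ≤ r.2.2.1 i ∧ r.2.2.1 i ≤ R.cHi i) →
      0 ≤ r.2.2.2 → r.2.2.2 ≤ 1 / R.ratio → Good m r) :
    ∃ δ > 0, ∃ B, ∀ x ∈ R.region, ∀ p, ‖p - red (toC x)‖ ≤ δ →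
      AnalyticAt ℂ (rBracket m) p ∧ ‖rBracket m p‖ ≤ B ∧ Good m (reRed p) := by
  -- The box contains the value 0 of L₁/L₂, that is the limit α → 0. This is what makes the width
  -- uniform although L₂ is unbounded.
  let K : Set (Reduced ℝ) := Icc (fun _ _ => 0, R.qLo, R.cLo, 0)
    (fun _ _ => 2 * π, R.qHi, R.cHi, 1 / R.ratio)
  have hK : IsCompact (castRed '' K) := isCompact_Icc.image continuous_castRed
  have hKg : ∀ r ∈ K, Good m r := fun r hr =>
    hgood r (fun i => ⟨hr.1.2.1 i, hr.2.2.1 i⟩) (fun i => ⟨hr.1.2.2.1 i, hr.2.2.2.1 i⟩)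
      hr.1.2.2.2 hr.2.2.2.2
  have hU : IsOpen ({p | AnalyticAt ℂ (rBracket m) p} ∩ reRed ⁻¹' {r | Good m r}) :=
    (isOpen_analyticAt ℂ _).inter ((isOpen_good m).preimage continuous_reRed)
  obtain ⟨δ, hδ, hsub⟩ := hK.exists_cthickening_subset_open hU (by
    rintro _ ⟨r, hr, rfl⟩
    exact ⟨good_analyticAt (hKg r hr), hKg r hr⟩)
  have hc : ContinuousOn (rBracket m) (cthickening δ (castRed '' K)) := fun p hp =>
    (hsub hp).1.continuousAt.continuousWithinAt
  obtain ⟨B, hB⟩ := hK.cthickening.exists_bound_of_continuousOn hc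
  refine ⟨δ, hδ, B, fun x hx p hp => ?_⟩
  -- Periodicity brings the angles into the compact box.
  obtain ⟨k, hk⟩ := exists_shift x.1
  obtain ⟨⟨h0, -, h2⟩, h⟩ := Walls.mem_actions.1 hx
  have hpos := hR.pos hx
  have hr := hR.ratio_pos
  let r : Reduced ℝ := (fun j i => x.1 j i + 2 * π * k j i, fun i => x.2 1 i / x.2 0 i,
    fun i => x.2 2 i / x.2 1 i, x.2 0 0 / x.2 0 1)
  have hrK : r ∈ K := by
    refine ⟨⟨fun j i => (hk j i).1, fun i => ?_, fun i => ?_, ?_⟩,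
      ⟨fun j i => (hk j i).2, fun i => ?_, fun i => ?_, ?_⟩⟩
    · exact (le_div_iff₀ (hpos i).1).2 (h i).1.le
    · exact (le_div_iff₀ (hpos i).2).2 (h i).2.2.1.le
    · exact div_nonneg (hpos 0).1.le (hpos 1).1.le
    · exact (div_le_iff₀ (hpos i).1).2 (h i).2.1.le
    · exact (div_le_iff₀ (hpos i).2).2 (h i).2.2.2.le
    · refine (div_le_div_iff₀ (hpos 1).1 hr).2 ?_
      linarith
  have hcast : castRed r = rShift k (red (toC x)) := by
    ext <;> simp [r, castRed, rShift, red, toC]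
  have hmem : rShift k p ∈ cthickening δ (castRed '' K) := by
    refine mem_cthickening_of_dist_le _ (castRed r) δ _ ⟨r, hrK, rfl⟩ ?_
    rwa [hcast, dist_eq_norm, rShift_sub]
  refine ⟨analyticAt_rBracket_of_rShift (hsub hmem).1, ?_, ?_⟩
  · rw [← rBracket_rShift m k p]
    exact hB _ hmem
  · exact (hsub hmem).2

/-- Points near real ones have reduced parameters near real ones. -/
theorem exists_red_close {R : Walls} (hR : R.Proper) {δ : ℝ} (hδ : 0 < δ) :
    ∃ s > 0, ∀ x ∈ R.region, ∀ z, ‖z - toC x‖ ≤ s →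
      (∀ i, 0 < (z.2 0 i).re ∧ z.2 1 i ≠ 0) ∧ ‖red z - red (toC x)‖ ≤ δ := by
  obtain ⟨a, ha, hlow⟩ := hR.exists_lower
  have hr := hR.ratio_pos
  -- B bounds the quotients G/L, |H|/G and L₁/L₂. A quotient then moves by at most s(1 + B)/(a/2),
  -- because denominators stay above a/2; s is chosen to make this at most δ.
  set B := 1 + 1 / R.ratio with hBdef
  have hB : 1 ≤ B := by rw [hBdef]; have : 0 < 1 / R.ratio := by positivity
                        linarith
  have hB0 : 0 < B := by linarith
  refine ⟨min (a / 2) (min δ (δ * (a / 2) / (1 + B))), by positivity, fun x hx z hz => ?_⟩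
  set s := min (a / 2) (min δ (δ * (a / 2) / (1 + B))) with hs
  have hs1 : s ≤ a / 2 := min_le_left _ _
  have hs2 : s ≤ δ := (min_le_right _ _).trans (min_le_left _ _)
  have hs3 : s * (1 + B) ≤ δ * (a / 2) := by
    rw [← le_div_iff₀ (by positivity)]
    exact (min_le_right _ _).trans (min_le_right _ _)
  have hco : ∀ k i, ‖z.2 k i - (x.2 k i : ℂ)‖ ≤ s := fun k i =>
    (norm_coord_le (z - toC x) k i).trans hz
  have hpos := hR.pos hx
  obtain ⟨⟨h0, -, h2⟩, h⟩ := Walls.mem_actions.1 hx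
  have hnorm : ∀ k i, a < x.2 k i → a / 2 ≤ (z.2 k i).re := fun k i hk => by
    have h1 := (Complex.abs_re_le_norm _).trans (hco k i)
    rw [Complex.sub_re, Complex.ofReal_re] at h1
    linarith [(abs_le.1 h1).1]
  have key : ∀ (j k : Fin 3) (i l : Fin 2), a < x.2 k l → |x.2 j i| ≤ B * x.2 k l →
      ‖z.2 j i / z.2 k l - (x.2 j i : ℂ) / (x.2 k l : ℂ)‖ ≤ δ := fun j k i l hk hj => by
    have hp : 0 < x.2 k l := ha.trans hk
    have hx0 : (x.2 k l : ℂ) ≠ 0 := by exact_mod_cast hp.ne'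
    have hz1 : a / 2 ≤ ‖z.2 k l‖ := (hnorm k l hk).trans (Complex.re_le_norm _)
    have hz2 : 0 < ‖z.2 k l‖ := by linarith
    have hz0 : z.2 k l ≠ 0 := norm_pos_iff.1 hz2
    have e : z.2 j i / z.2 k l - (x.2 j i : ℂ) / (x.2 k l : ℂ) =
        ((z.2 j i - x.2 j i) - (x.2 j i : ℂ) / x.2 k l * (z.2 k l - x.2 k l)) / z.2 k l := by
      field_simp
      ring
    have hq : ‖(x.2 j i : ℂ) / x.2 k l‖ ≤ B := by
      rw [norm_div, Complex.norm_real, Complex.norm_real, Real.norm_eq_abs, Real.norm_of_nonneg hp.le,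
        div_le_iff₀ hp]
      exact hj
    rw [e, norm_div, div_le_iff₀ hz2]
    calc _ ≤ ‖z.2 j i - x.2 j i‖ + ‖(x.2 j i : ℂ) / x.2 k l‖ * ‖z.2 k l - x.2 k l‖ := by
          rw [← norm_mul]; exact norm_sub_le _ _
      _ ≤ s + B * s := add_le_add (hco j i)
          (mul_le_mul hq (hco k l) (norm_nonneg _) hB0.le)
      _ ≤ δ * (a / 2) := by linarith
      _ ≤ δ * ‖z.2 k l‖ := by gcongr
  refine ⟨fun i => ⟨by linarith [hnorm 0 i (hlow _ hx i).1], fun hz0 => ?_⟩, ?_⟩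
  · have := hnorm 1 i (hlow _ hx i).2
    rw [hz0, Complex.zero_re] at this
    linarith
  · refine norm_prod_le_iff.2 ⟨?_, norm_prod_le_iff.2 ⟨?_, norm_prod_le_iff.2 ⟨?_, ?_⟩⟩⟩
    · exact (norm_fst_le (z - toC x)).trans (hz.trans hs2)
    · refine (pi_norm_le_iff_of_nonneg hδ.le).2 fun i => key 1 0 i i (hlow _ hx i).1 ?_
      rw [abs_of_pos (hpos i).2]
      have := (h i).2.1
      nlinarith [hR.qHi_lt i, (hpos i).1]
    · refine (pi_norm_le_iff_of_nonneg hδ.le).2 fun i => key 2 1 i i (hlow _ hx i).2 ?_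
      have h1 := (h i).2.2.1
      have h2 := (h i).2.2.2
      have h3 := hR.cLo_gt i
      have h4 := hR.cHi_lt i
      have h5 := (hpos i).2
      rw [abs_le]
      constructor <;> nlinarith
    · refine key 0 0 0 1 (hlow _ hx 1).1 ?_
      rw [abs_of_pos (hpos 0).1, hBdef]
      have h3 : x.2 0 0 ≤ 1 / R.ratio * x.2 0 1 := by
        rw [one_div, ← div_eq_inv_mul, le_div_iff₀ hr]
        linarith
      linarith [(hpos 1).1]

end Uniform

end LunarThreeBody

namespace LunarThreeBody

open scoped Real Topology
open Set Filter Metric Asymptotics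

/-! ### Extension of the Hamiltonian and order of the perturbation -/

section Extension

variable {m : Masses} {b : Bounds}

/-- The inner ellipse, scaled by σα, has apocentre below 2σα, which the bound on α keeps below the
outer pericentre 1 − e₂ in units of a₂. -/
theorem good_of_async (hm : m.Positive) (hb : b.Admissible) (r : Reduced ℝ)
    (hq : ∀ i, (asyncWalls m b).qLo i ≤ r.2.1 i ∧ r.2.1 i ≤ (asyncWalls m b).qHi i)
    (hc : ∀ i, (asyncWalls m b).cLo i ≤ r.2.2.1 i ∧ r.2.2.1 i ≤ (asyncWalls m b).cHi i)
    (h0 : 0 ≤ r.2.2.2) (h1 : r.2.2.2 ≤ 1 / (asyncWalls m b).ratio) : Good m r := by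
  have hR := proper_asyncWalls hm hb
  have hκ := hm.alphaCoeff_pos
  have hα := alphaMax_pos hm hb
  have hσ0 := hm.σ0_pos
  have hσ1 := hm.σ1_pos
  have he : ∀ i, √(1 - r.2.1 i ^ 2) ≤ b.eHi i := fun i => by
    obtain ⟨e1, e2, e3⟩ := hb.2.2.1 i
    have h2 := (Real.sqrt_le_left (hR.qLo_pos i |>.trans_le (hq i).1).le).1 (hq i).1
    rw [Real.sqrt_le_left (e1.trans e2).le]
    linarith
  have hρ : alphaCoeff m * r.2.2.2 ^ 2 ≤ alphaMax m b := by
    have hrat : (asyncWalls m b).ratio ^ 2 = alphaCoeff m / alphaMax m b :=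
      Real.sq_sqrt (by positivity)
    calc alphaCoeff m * r.2.2.2 ^ 2 ≤ alphaCoeff m * (1 / (asyncWalls m b).ratio) ^ 2 := by gcongr
      _ = alphaMax m b := by rw [div_pow, hrat]; field_simp
  have hσ : ∀ σ : ℝ, 0 < σ → alphaMax m b ≤ (1 - b.eHi 1) / (2 * σ) →
      |σ * (alphaCoeff m * r.2.2.2 ^ 2)| * (1 + √(1 - r.2.1 0 ^ 2)) <
        1 - √(1 - r.2.1 1 ^ 2) := fun σ hσ hle => by
    have hnn : 0 ≤ σ * (alphaCoeff m * r.2.2.2 ^ 2) := by positivity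
    rw [abs_of_nonneg hnn]
    have h2 : σ * (alphaCoeff m * r.2.2.2 ^ 2) ≤ (1 - b.eHi 1) / 2 := by
      calc _ ≤ σ * ((1 - b.eHi 1) / (2 * σ)) := by gcongr; exact hρ.trans hle
        _ = _ := by field_simp
    have h3 : 0 < 1 - b.eHi 1 := by linarith [(hb.2.2.1 1).2.2]
    have h4 := (hb.2.2.1 0).2.2
    have h5 := he 0
    have h6 := he 1
    have h7 := Real.sqrt_nonneg (1 - r.2.1 0 ^ 2)
    calc _ ≤ (1 - b.eHi 1) / 2 * (1 + √(1 - r.2.1 0 ^ 2)) := by gcongr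
      _ < (1 - b.eHi 1) / 2 * 2 := by gcongr; linarith
      _ ≤ _ := by linarith
  refine ⟨fun i => ⟨⟨(hR.qLo_pos i).trans_le (hq i).1, (hq i).2.trans_lt (hR.qHi_lt i)⟩,
    (hR.cLo_gt i).trans_le (hc i).1, (hc i).2.trans_lt (hR.cHi_lt i)⟩, hσ _ hσ0 ?_, hσ _ hσ1 ?_⟩
  · exact (min_le_right _ _).trans (min_le_left _ _)
  · exact (min_le_right _ _).trans (min_le_right _ _)

theorem analyticAt_act (k : Fin 3) (i : Fin 2) (z : Phase ℂ) :
    AnalyticAt ℂ (fun z : Phase ℂ => z.2 k i) z :=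
  ((ContinuousLinearMap.proj (R := ℂ) (φ := fun _ : Fin 2 => ℂ) i).comp
    ((ContinuousLinearMap.proj (R := ℂ) (φ := fun _ : Fin 3 => Fin 2 → ℂ) k).comp
    (ContinuousLinearMap.snd ℂ (Fin 3 → Fin 2 → ℂ) (Fin 3 → Fin 2 → ℂ)))).analyticAt z

theorem analyticAt_red {z : Phase ℂ} (hL : ∀ i, z.2 0 i ≠ 0) (hG : ∀ i, z.2 1 i ≠ 0) :
    AnalyticAt ℂ red z := by
  refine AnalyticAt.prod analyticAt_fst (AnalyticAt.prod ?_ (AnalyticAt.prod ?_ ?_))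
  · exact AnalyticAt.pi fun i => (analyticAt_act 1 i z).div (analyticAt_act 0 i z) (hL i)
  · exact AnalyticAt.pi fun i => (analyticAt_act 2 i z).div (analyticAt_act 1 i z) (hG i)
  · exact (analyticAt_act 0 0 z).div (analyticAt_act 0 1 z) (hL 1)

theorem analyticAt_keplerE (c : Fin 2 → ℝ) (i : Fin 2) {z : Phase ℂ} (h : z.2 0 i ≠ 0) :
    AnalyticAt ℂ (keplerE c i) z :=
  analyticAt_const.div (analyticAt_const.mul ((analyticAt_act 0 i z).pow 2))
    (mul_ne_zero two_ne_zero (pow_ne_zero 2 h))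

/-- Substituting the actions in α²/a₂ leaves the factor L₁⁴/L₂⁶, the source of the order 6. -/
theorem pertC_eq (hm : m.Positive) (z : Phase ℂ) :
    pertC m z = ((-(m.μ 0 * m.m2) * (alphaCoeff m ^ 2 * (m.μ 1 ^ 2 * m.M 1)) : ℝ) : ℂ) *
      (z.2 0 0 ^ 4 / z.2 0 1 ^ 6) * rBracket m (red z) := by
  have h0 : (m.μ 0 : ℂ) ≠ 0 := by exact_mod_cast (hm.μ_pos 0).ne'
  have h1 : (m.μ 1 : ℂ) ≠ 0 := by exact_mod_cast (hm.μ_pos 1).ne'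
  have h2 : (m.M 0 : ℂ) ≠ 0 := by exact_mod_cast (hm.M_pos 0).ne'
  have h3 : (m.M 1 : ℂ) ≠ 0 := by exact_mod_cast (hm.M_pos 1).ne'
  rw [pertC, alphaC, outerAxisC, alphaCoeff]
  push_cast
  by_cases hL : z.2 0 1 = 0
  · simp [hL]
  field_simp

theorem red_shift (k : Fin 3 → Fin 2 → ℤ) (z : Phase ℂ) : red (shift k z) = rShift k (red z) := by
  ext <;> simp [red, shift, rShift]

theorem pertC_shift (k : Fin 3 → Fin 2 → ℤ) (z : Phase ℂ) :
    pertC m (shift k z) = pertC m z := by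
  rw [pertC, red_shift, rBracket_rShift]
  rfl

/-- The extension of the Hamiltonian to a uniform neighbourhood of the asynchronous region, with
the order of the perturbing function. -/
theorem exists_pertC_bound (hm : m.Positive) (hb : b.Admissible) :
    ∃ s > 0, ∃ C, (∀ z ∈ T (PStar m b) s, (∀ i, z.2 0 i ≠ 0) ∧ AnalyticAt ℂ (pertC m) z ∧
      ‖pertC m z‖ ≤ C * wt 6 z) ∧
      ∀ x, toC x ∈ T (PStar m b) s →
        hamC m (toC x) = F m x ∧ pertC m (toC x) = FPert m (posQ m x) := by
  have hR := proper_asyncWalls hm hb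
  rw [PStar_eq_region hm hb]
  obtain ⟨δ, hδ, B, hB⟩ := exists_uniform m hR (good_of_async hm hb)
  obtain ⟨s, hs, hred⟩ := exists_red_close hR hδ
  set R := asyncWalls m b
  refine ⟨s, hs, |-(m.μ 0 * m.m2) * (alphaCoeff m ^ 2 * (m.μ 1 ^ 2 * m.M 1))| *
    (R.lHi + s) ^ 4 * B, fun z hz => ?_, fun y hy => ?_⟩
  · obtain ⟨x, hx, hxz⟩ := mem_T.1 hz
    obtain ⟨h1, h2⟩ := hred x hx z hxz.le
    obtain ⟨h3, h4, h5⟩ := hB x hx _ h2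
    have hL : ∀ i, z.2 0 i ≠ 0 := fun i h => by
      have := (h1 i).1
      rw [h, Complex.zero_re] at this
      exact lt_irrefl _ this
    refine ⟨hL, ?_, ?_⟩
    · have h6 : AnalyticAt ℂ (fun z => rBracket m (red z)) z :=
        AnalyticAt.fun_comp h3 (analyticAt_red hL fun i => (h1 i).2)
      have : pertC m = fun z => ((-(m.μ 0 * m.m2) * (alphaCoeff m ^ 2 * (m.μ 1 ^ 2 * m.M 1)) : ℝ) : ℂ)
          * (z.2 0 0 ^ 4 / z.2 0 1 ^ 6) * rBracket m (red z) := funext (pertC_eq hm)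
      rw [this]
      exact (analyticAt_const.mul (((analyticAt_act 0 0 z).pow 4).div ((analyticAt_act 0 1 z).pow 6)
        (pow_ne_zero 6 (hL 1)))).mul h6
    · have h7 : ‖z.2 0 0‖ ≤ R.lHi + s := by
        have e1 := (norm_coord_le (z - toC x) 0 0).trans hxz.le
        have e2 : ‖z.2 0 0‖ ≤ ‖(z - toC x).2 0 0‖ + ‖(toC x).2 0 0‖ := by
          have : z.2 0 0 = (z - toC x).2 0 0 + (toC x).2 0 0 := by simp
          rw [this]
          exact norm_add_le _ _
        have e3 : ‖(toC x).2 0 0‖ ≤ R.lHi := by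
          simp only [toC, Complex.norm_real, Real.norm_eq_abs]
          rw [abs_of_pos (hR.pos hx 0).1]
          exact (Walls.mem_actions.1 hx).1.2.1.le
        linarith
      have h8 : wt 6 z = (‖z.2 0 1‖ ^ 6)⁻¹ := by
        rw [wt, zpow_neg]; norm_cast
      rw [pertC_eq hm, norm_mul, norm_mul, norm_div, norm_pow, norm_pow, Complex.norm_real,
        Real.norm_eq_abs, div_eq_mul_inv, ← h8]
      have h9 := wt_nonneg 6 z
      have h10 : 0 ≤ B := (norm_nonneg _).trans h4
      calc _ ≤ |-(m.μ 0 * m.m2) * (alphaCoeff m ^ 2 * (m.μ 1 ^ 2 * m.M 1))| *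
            ((R.lHi + s) ^ 4 * wt 6 z) * B := by gcongr
        _ = _ := by ring
  -- Real points of the complex neighbourhood may lie outside P*, so their non-degeneracy is read
  -- off from the reduced parameters near those of x.
  · obtain ⟨x, hx, hxz⟩ := mem_T.1 hy
    obtain ⟨h1, h2⟩ := hred x hx _ hxz.le
    obtain ⟨-, -, hg⟩ := hB x hx _ h2
    have hL : ∀ i, 0 < actL y i := fun i => by simpa [toC, actL] using (h1 i).1
    have hre : reRed (red (toC y)) = (y.1, fun i => actG y i / actL y i,
        fun i => actH y i / actG y i, actL y 0 / actL y 1) := by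
      rw [red_toC]; rfl
    rw [hre] at hg
    refine hamC_toC hm hg.1 hL ?_ ?_
    · rw [alpha_eq hm]; exact hg.2.1
    · rw [alpha_eq hm]; exact hg.2.2

theorem T_far_subset {A : Set (Phase ℝ)} {s : ℝ} (hs : 0 < s) : ∃ N : ℕ, dom A N ⊆ T A s := by
  obtain ⟨N, hN⟩ := exists_nat_gt (1 / s)
  refine ⟨N, T_mono (fun x hx => hx.1) ?_⟩
  rw [div_le_iff₀ (by positivity)]
  rw [div_lt_iff₀ hs] at hN
  nlinarith

theorem reg_pertC (hm : m.Positive) (hb : b.Admissible) :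
    Reg (PStar m b) (pertC m) ∧ pertC m =O[far (PStar m b)] wt 6 := by
  obtain ⟨s, hs, C, h1, h2⟩ := exists_pertC_bound hm hb
  obtain ⟨N, hN⟩ := T_far_subset (A := PStar m b) hs
  refine ⟨⟨?_, ?_, ?_⟩, ?_⟩
  · exact eventually_far.2 ⟨N, fun z hz => (h1 z (hN hz)).2.1⟩
  · refine eventually_far.2 ⟨N, fun z hz hr => ?_⟩
    obtain ⟨x, rfl⟩ := hr
    rw [(h2 x (hN hz)).2, Complex.ofReal_im]
  · exact Eventually.of_forall fun z k => pertC_shift k z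
  · refine IsBigO.of_bound C (eventually_far.2 ⟨N, fun z hz => ?_⟩)
    rw [Real.norm_of_nonneg (wt_nonneg 6 z)]
    exact (h1 z (hN hz)).2.2

theorem exists_isAnalyticExtension_hamC (hm : m.Positive) (hb : b.Admissible) :
    ∃ s > 0, IsAnalyticExtension (F m) (PStar m b) s (hamC m) ∧
      ∀ z ∈ T (PStar m b) s, ∀ i, z.2 0 i ≠ 0 := by
  obtain ⟨s, hs, C, h1, h2⟩ := exists_pertC_bound hm hb
  refine ⟨s, hs, ⟨fun z hz => ?_, fun x hx => ?_⟩, fun z hz => (h1 z hz).1⟩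
  · obtain ⟨hL, hP, -⟩ := h1 z hz
    exact ((analyticAt_keplerE _ 0 (hL 0)).add (analyticAt_keplerE _ 1 (hL 1))).add hP
  · exact (h2 x (mem_T.2 ⟨x, hx, by simpa using hs⟩)).1

end Extension

end LunarThreeBody

namespace LunarThreeBody

open scoped Real Topology
open Set Filter Metric Asymptotics

/-! ## Transport of normal forms from the far part to the whole region -/

section Transport

namespace Walls

variable (R : Walls)

/-- A direction of the outer actions along which the region is invariant. -/
def outward : Fin 3 → Fin 2 → ℝ :=
  ![![0, 1], ![0, (R.qLo 1 + R.qHi 1) / 2],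
    ![0, (R.cLo 1 + R.cHi 1) / 2 * ((R.qLo 1 + R.qHi 1) / 2)]]

variable {R}

/-- The inner components of `outward` vanish, and its outer ratios are midpoints of the allowed
intervals, so moving along it decreases no wall function. -/
theorem Proper.wall_add_outward (hR : R.Proper) (w) (y : Fin 3 → Fin 2 → ℝ) {t : ℝ} (ht : 0 ≤ t) :
    R.wall w y ≤ R.wall w (y + t • R.outward) := by
  have hq := hR.qLo_lt 1
  have hq0 := hR.qLo_pos 1
  have hc := hR.cLo_lt 1
  revert w
  rw [forall_wall]
  refine ⟨⟨by simp [wall, outward], by simp [wall, outward], by simp [wall, outward, ht]⟩,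
    fun i => ?_⟩
  fin_cases i
  · simp [wall, outward]
  · simp only [Fin.mk_one, wall, outward, Pi.add_apply, Pi.smul_apply, smul_eq_mul,
      Matrix.cons_val_zero, Matrix.cons_val_one, Matrix.cons_val]
    set q := (R.qLo 1 + R.qHi 1) / 2 with hqd
    set c := (R.cLo 1 + R.cHi 1) / 2 with hcd
    have e1 : R.qLo 1 ≤ q := by rw [hqd]; linarith
    have e2 : q ≤ R.qHi 1 := by rw [hqd]; linarith
    have e3 : R.cLo 1 ≤ c := by rw [hcd]; linarith
    have e4 : c ≤ R.cHi 1 := by rw [hcd]; linarith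
    have e5 : 0 ≤ t * q := mul_nonneg ht (by linarith)
    refine ⟨?_, ?_, ?_, ?_⟩
    · nlinarith [mul_le_mul_of_nonneg_left e1 ht]
    · nlinarith [mul_le_mul_of_nonneg_left e2 ht]
    · nlinarith [mul_le_mul_of_nonneg_left e3 e5]
    · nlinarith [mul_le_mul_of_nonneg_left e4 e5]

theorem Proper.add_outward_mem (hR : R.Proper) {y : Fin 3 → Fin 2 → ℝ} (hy : y ∈ R.actions) {t : ℝ}
    (ht : 0 ≤ t) : y + t • R.outward ∈ R.actions := fun w =>
  (hy w).trans_le (hR.wall_add_outward w y ht)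

theorem Proper.norm_outward_le (hR : R.Proper) : ‖toC (0, R.outward)‖ ≤ 1 := by
  have hq := hR.qLo_lt 1
  have hq0 := hR.qLo_pos 1
  have hq1 := hR.qHi_lt 1
  have hc := hR.cLo_lt 1
  have hc0 := hR.cLo_gt 1
  have hc1 := hR.cHi_lt 1
  have h1 : |(R.qLo 1 + R.qHi 1) / 2| ≤ 1 := abs_le.2 ⟨by linarith, by linarith⟩
  have h2 : |(R.cLo 1 + R.cHi 1) / 2| ≤ 1 := abs_le.2 ⟨by linarith, by linarith⟩
  have h3 : |(R.cLo 1 + R.cHi 1) / 2 * ((R.qLo 1 + R.qHi 1) / 2)| ≤ 1 := by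
    rw [abs_mul]
    exact mul_le_one₀ h2 (abs_nonneg _) h1
  refine norm_prod_le_iff.2 ⟨?_, (pi_norm_le_iff_of_nonneg zero_le_one).2 fun k =>
    (pi_norm_le_iff_of_nonneg zero_le_one).2 fun i => ?_⟩
  · refine (pi_norm_le_iff_of_nonneg zero_le_one).2 fun k =>
      (pi_norm_le_iff_of_nonneg zero_le_one).2 fun i => ?_
    simp [toC]
  · simp only [toC, Complex.norm_real, Real.norm_eq_abs]
    fin_cases k <;> fin_cases i
    all_goals simp only [outward]
    · simp
    · simp
    · simp
    · simpa using h1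
    · simp
    · simpa using h3

end Walls

variable {R : Walls}

/-- The length of the translation into the far part. -/
def stretch (Λ : ℝ) (p : ℕ) (w : ℂ) : ℂ := ((Λ ^ (p + 1) : ℝ) : ℂ) * w⁻¹ ^ p

/-- If t ≤ Λ, the second summand is Λ(Λ/t)ᵖ ≥ Λ. -/
theorem lt_add_stretch {Λ t : ℝ} (hΛ : 0 < Λ) (ht : 0 < t) (p : ℕ) :
    Λ ≤ t + Λ ^ (p + 1) * t⁻¹ ^ p := by
  have h0 : 0 ≤ Λ ^ (p + 1) * t⁻¹ ^ p := by positivity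
  rcases le_total Λ t with h | h
  · linarith
  · have h1 : 1 ≤ Λ * t⁻¹ := by
      rw [← div_eq_mul_inv, le_div_iff₀ ht]; linarith
    have h2 : Λ ^ (p + 1) * t⁻¹ ^ p = Λ * (Λ * t⁻¹) ^ p := by ring
    rw [h2]
    have h3 := one_le_pow₀ h1 (n := p)
    nlinarith

/-- In the variable 1/w the stretch is a polynomial on a compact disc, hence uniformly continuous,
although t itself is unbounded. -/
theorem exists_stretch_close {a ε : ℝ} (ha : 0 < a) (hε : 0 < ε) (Λ : ℝ) (p : ℕ) :
    ∃ s > 0, ∀ (t : ℝ) (w : ℂ), a < t → ‖w - t‖ < s → w ≠ 0 ∧ ‖stretch Λ p w - stretch Λ p t‖ < ε := by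
  have hu : UniformContinuousOn (fun u : ℂ => ((Λ ^ (p + 1) : ℝ) : ℂ) * u ^ p)
      (closedBall 0 (2 / a)) :=
    (isCompact_closedBall _ _).uniformContinuousOn_of_continuous (by fun_prop)
  obtain ⟨η, hη, h⟩ := Metric.uniformContinuousOn_iff.1 hu ε hε
  refine ⟨min (a / 2) (η * (a / 2) * (a / 2)), by positivity, fun t w ht hw => ?_⟩
  have ht0 : 0 < t := ha.trans ht
  have h1 : ‖w - t‖ < a / 2 := hw.trans_le (min_le_left _ _)
  have h2 : ‖w - t‖ < η * (a / 2) * (a / 2) := hw.trans_le (min_le_right _ _)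
  have h3 : a / 2 < ‖w‖ := by
    have e1 : ‖(t : ℂ)‖ ≤ ‖w‖ + ‖w - t‖ := by
      have e2 : (t : ℂ) = w - (w - t) := by ring
      conv_lhs => rw [e2]
      exact norm_sub_le _ _
    rw [Complex.norm_real, Real.norm_of_nonneg ht0.le] at e1
    linarith
  have h3' : 0 < ‖w‖ := by linarith
  have hw0 : w ≠ 0 := norm_pos_iff.1 h3'
  have ht0' : (t : ℂ) ≠ 0 := by exact_mod_cast ht0.ne'
  refine ⟨hw0, ?_⟩
  have hin : ∀ u : ℂ, a / 2 < ‖u‖ → u⁻¹ ∈ closedBall (0 : ℂ) (2 / a) := fun u hu => by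
    rw [mem_closedBall, dist_zero_right, norm_inv, inv_le_comm₀ (by linarith) (by positivity),
      inv_div]
    exact hu.le
  have ht' : a / 2 < ‖(t : ℂ)‖ := by
    rw [Complex.norm_real, Real.norm_of_nonneg ht0.le]; linarith
  have := h w⁻¹ (hin w h3) (t : ℂ)⁻¹ (hin _ ht') ?_
  · rwa [dist_eq_norm] at this
  · rw [dist_eq_norm, inv_sub_inv hw0 ht0', norm_div, norm_mul, norm_sub_rev,
      div_lt_iff₀ (by positivity)]
    calc _ < η * (a / 2) * (a / 2) := h2
      _ ≤ η * ‖w‖ * ‖(t : ℂ)‖ := by gcongr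
      _ = _ := by ring

/-- Translation of the outer actions into the far part. -/
def farShift (R : Walls) (Λ : ℝ) (p : ℕ) (z : Phase ℂ) : Phase ℂ :=
  z + stretch Λ p (z.2 0 1) • toC (0, R.outward)

theorem analyticAt_farShift {Λ : ℝ} {p : ℕ} {z : Phase ℂ} (hz : z.2 0 1 ≠ 0) :
    AnalyticAt ℂ (farShift R Λ p) z :=
  analyticAt_id.add ((analyticAt_const.mul (((analyticAt_act 0 1 z).inv hz).pow p)).smul
    analyticAt_const)

theorem farShift_toC (Λ : ℝ) (p : ℕ) (x : Phase ℝ) : farShift R Λ p (toC x) =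
    toC (x + (Λ ^ (p + 1) * (x.2 0 1)⁻¹ ^ p) • (0, R.outward)) := by
  rw [farShift, toC_add, toC_smul, stretch]
  congr 2
  simp [toC]

theorem farShift_translate (Λ : ℝ) (p : ℕ) (z : Phase ℂ) (θ : Fin 3 → Fin 2 → ℝ) :
    farShift R Λ p (z + toC (θ, 0)) = farShift R Λ p z + toC (θ, 0) := by
  have : (z + toC (θ, 0)).2 0 1 = z.2 0 1 := by simp [toC]
  rw [farShift, farShift, this]
  abel

/-- With Λ = N + 1 the image has L₂ > N. Half of the radius 1/(N + 1) is spent on the distance to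
the real point, the other half on the variation of the stretch. -/
theorem exists_farShift_mem (hR : R.Proper) (N p : ℕ) :
    ∃ s > 0, ∀ z ∈ T R.region s, z.2 0 1 ≠ 0 ∧ farShift R (N + 1) p z ∈ dom R.region N := by
  obtain ⟨a, ha, hlow⟩ := hR.exists_lower
  have hN : 0 < 1 / ((N : ℝ) + 1) := by positivity
  obtain ⟨s, hs, h⟩ := exists_stretch_close ha (half_pos hN) ((N : ℝ) + 1) p
  refine ⟨min s (1 / ((N : ℝ) + 1) / 2), by positivity, fun z hz => ?_⟩
  obtain ⟨x, hx, hxz⟩ := mem_T.1 hz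
  have h1 : ‖z.2 0 1 - (x.2 0 1 : ℝ)‖ < s :=
    (norm_coord_le (z - toC x) 0 1).trans_lt (hxz.trans_le (min_le_left _ _))
  obtain ⟨h2, h3⟩ := h _ _ (hlow _ hx 1).1 h1
  refine ⟨h2, mem_T.2 ⟨x + (((N : ℝ) + 1) ^ (p + 1) * (x.2 0 1)⁻¹ ^ p) • (0, R.outward), ⟨?_, ?_⟩,
    ?_⟩⟩
  · have hp := (hR.pos hx 1).1
    exact hR.add_outward_mem (y := x.2) hx (by positivity)
  · have := lt_add_stretch (Λ := (N : ℝ) + 1) (by positivity) (hR.pos hx 1).1 p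
    simp only [Prod.snd_add, Prod.smul_snd, Pi.add_apply, Pi.smul_apply, Walls.outward,
      Matrix.cons_val_zero, Matrix.cons_val_one, smul_eq_mul, mul_one]
    linarith
  · rw [← farShift_toC, farShift, farShift]
    have e : z + stretch (N + 1) p (z.2 0 1) • toC (0, R.outward) -
        (toC x + stretch (N + 1) p ((toC x).2 0 1) • toC (0, R.outward)) =
        (z - toC x) + (stretch (N + 1) p (z.2 0 1) - stretch (N + 1) p (x.2 0 1 : ℝ)) •
          toC (0, R.outward) := by
      rw [sub_smul]
      simp only [toC]
      abel
    rw [e]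
    have h4 := hxz.trans_le (min_le_right _ _)
    calc _ ≤ ‖z - toC x‖ + ‖stretch (N + 1) p (z.2 0 1) - stretch (N + 1) p (x.2 0 1 : ℝ)‖ *
          ‖toC (0, R.outward)‖ := by rw [← norm_smul]; exact norm_add_le _ _
      _ ≤ ‖z - toC x‖ + ‖stretch (N + 1) p (z.2 0 1) - stretch (N + 1) p (x.2 0 1 : ℝ)‖ * 1 := by
          gcongr; exact hR.norm_outward_le
      _ < 1 / ((N : ℝ) + 1) / 2 + 1 / ((N : ℝ) + 1) / 2 * 1 := by gcongr
      _ = _ := by ring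

theorem isBigO_farShift_sub (hR : R.Proper) (Λ : ℝ) (p : ℕ) :
    (fun z => farShift R Λ p z - z) =O[far R.region] wt p := by
  refine IsBigO.of_bound |Λ ^ (p + 1)| (Eventually.of_forall fun z => ?_)
  rw [farShift, add_sub_cancel_left, norm_smul, stretch, norm_mul, Complex.norm_real,
    Real.norm_eq_abs, Real.norm_of_nonneg (wt_nonneg _ _), norm_pow, norm_inv, wt, zpow_neg,
    zpow_natCast, inv_pow]
  exact mul_le_of_le_one_right (by positivity) hR.norm_outward_le

/-- A function that is invariant under infinitesimal changes of an angle is invariant under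
changes of this angle. -/
theorem eq_of_fderiv_eq_zero {A : Set (Phase ℝ)} (hA : AngleInvariant A) {s : ℝ} {Z : Phase ℂ → ℂ}
    {k : Fin 3} {i : Fin 2} (h1 : ∀ z ∈ T A s, AnalyticAt ℂ Z z)
    (h2 : ∀ z ∈ T A s, fderiv ℂ Z z (angDir k i) = 0) {z : Phase ℂ} (hz : z ∈ T A s) (t : ℝ) :
    Z (z + (t : ℂ) • angDir k i) = Z z := by
  have hm : ∀ t : ℝ, z + (t : ℂ) • angDir k i ∈ T A s := fun t => by
    rw [smul_angDir]; exact T_translate hA hz _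
  have hd : ∀ t : ℝ, HasDerivAt (fun t : ℝ => Z (z + (t : ℂ) • angDir k i)) 0 t := fun t => by
    have := hasDerivAt_line (h1 _ (hm t))
    rwa [h2 _ (hm t)] at this
  have := is_const_of_deriv_eq_zero (fun t => (hd t).differentiableAt) (fun t => (hd t).deriv) t 0
  simpa using this

/-- Z is analytic only where L₂ is large. Composing it with `farShift` defines it on the whole
region, and as the displacement has order 3n + 1 and the derivative of Z has order 6, the change has
order 3n + 7. The translation commutes with translations of the angles, so periodicity and
independence of l₁, l₂ survive. -/
theorem exists_transport (hR : R.Proper) {Z : Phase ℂ → ℂ} (hZ : Reg R.region Z)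
    (hZ6 : Z =O[far R.region] wt 6)
    (hind : ∀ i, ∀ᶠ z in far R.region, fderiv ℂ Z z (angDir 0 i) = 0) (n : ℕ) :
    ∃ (Z' : Phase ℂ → ℂ) (s : ℝ), 0 < s ∧
      (∀ z ∈ T R.region s, AnalyticAt ℂ Z' z) ∧
      (∀ x ∈ R.region, (Z' (toC x)).im = 0) ∧
      (∀ x ∈ R.region, ∀ k, Z' (toC (shift k x)) = Z' (toC x)) ∧
      (∀ x ∈ R.region, ∀ y ∈ R.region, x.1 1 = y.1 1 → x.1 2 = y.1 2 → x.2 = y.2 →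
        Z' (toC x) = Z' (toC y)) ∧
      (fun z => Z' z - Z z) =O[far R.region] wt (3 * n + 6) := by
  obtain ⟨N, hN⟩ := eventually_far.1
    (hZ.analytic.and (hZ.real.and (hZ.periodic.and ((hind 0).and (hind 1)))))
  -- The exponent is positive even for n = 0, so the displacement tends to zero.
  obtain ⟨s, hs, hmem⟩ := exists_farShift_mem hR N (3 * n + 1)
  set Θ := farShift R ((N : ℝ) + 1) (3 * n + 1) with hΘ
  have hreal : ∀ x ∈ R.region, Θ (toC x) ∈ dom R.region N := fun x hx =>
    (hmem _ (mem_T.2 ⟨x, hx, by simpa using hs⟩)).2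
  have hdA := angleInvariant_farPart (Walls.angleInvariant_region (R := R)) N
  refine ⟨fun z => Z (Θ z), s, hs, fun z hz => ?_, fun x hx => ?_, fun x hx k => ?_,
    fun x hx y hy e1 e2 e3 => ?_, ?_⟩
  · exact AnalyticAt.fun_comp (hN _ (hmem z hz).2).1 (analyticAt_farShift (hmem z hz).1)
  · exact (hN _ (hreal x hx)).2.1 ⟨_, (farShift_toC _ _ _).symm⟩
  · have e : toC (shift k x) = toC x + toC (fun j i => 2 * π * k j i, 0) := by
      rw [← toC_add]
      congr 1
      ext <;> simp [shift]
    simp only [e, hΘ, farShift_translate]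
    rw [← shift_eq_add]
    exact (hN _ (hreal x hx)).2.2.1 k
  · have e : toC x = toC y + (((x.1 0 0 - y.1 0 0 : ℝ) : ℂ) • angDir 0 0 +
        ((x.1 0 1 - y.1 0 1 : ℝ) : ℂ) • angDir 0 1) := by
      have e4 := congrFun e1
      have e5 := congrFun e2
      ext k i
      · fin_cases k
        · fin_cases i <;> simp [toC, angDir]
        · simp [toC, angDir, e4 i]
        · simp [toC, angDir, e5 i]
      · simp [toC, angDir, e3]
    have e' : Θ (toC x) = Θ (toC y) + ((x.1 0 0 - y.1 0 0 : ℝ) : ℂ) • angDir 0 0 +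
        ((x.1 0 1 - y.1 0 1 : ℝ) : ℂ) • angDir 0 1 := by
      rw [e, smul_angDir, smul_angDir, ← add_assoc, hΘ, farShift_translate, farShift_translate]
    simp only [e']
    have h1 := hreal y hy
    have h2 : Θ (toC y) + ((x.1 0 0 - y.1 0 0 : ℝ) : ℂ) • angDir 0 0 ∈ dom R.region N := by
      rw [smul_angDir]; exact T_translate hdA h1 _
    rw [eq_of_fderiv_eq_zero hdA (fun z hz => (hN z hz).1) (fun z hz => (hN z hz).2.2.2.2) h2,
      eq_of_fderiv_eq_zero hdA (fun z hz => (hN z hz).1) (fun z hz => (hN z hz).2.2.2.1) h1]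
  · have hb := isBigO_farShift_sub hR ((N : ℝ) + 1) (3 * n + 1)
    have ht : Tendsto (fun z => Θ z - z) (far R.region) (𝓝 0) :=
      hb.trans_tendsto (tendsto_wt (by positivity))
    have h := isBigO_comp_sub hZ.analytic (isBigO_fderiv hZ.analytic hZ6)
      (d := fun _ => 0) (d' := fun z => Θ z - z) tendsto_const_nhds ht (by simpa using hb)
    simp only [add_zero, add_sub_cancel] at h
    refine h.trans (isBigO_wt_of_le ?_)
    linarith

end Transport

end LunarThreeBody

namespace LunarThreeBody

open scoped Real Topology
open Set Filter Metric Asymptotics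

/-! ## The relative measure of the part away from the walls -/

section RelMeasure

namespace Walls

variable {R : Walls}

/-- The actions in the far part whose distance to the walls is of larger order than `L₂⁻³`. -/
def core (R : Walls) (N D : ℝ) : Set (Fin 3 → Fin 2 → ℝ) :=
  {y | y ∈ R.actions ∧ N < y 0 1 ∧ ∀ w, D < R.wall w y * y 0 1 ^ 3}

theorem isOpen_actions : IsOpen R.actions := by
  simp only [actions, ofPred_forall]
  exact isOpen_iInter_of_finite fun w => isOpen_lt continuous_const (continuous_wall w)

theorem isOpen_core (N D : ℝ) : IsOpen (R.core N D) := by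
  refine IsOpen.and isOpen_actions (IsOpen.and (isOpen_lt (by fun_prop) (by fun_prop)) ?_)
  simp only [ofPred_forall]
  exact isOpen_iInter_of_finite fun w =>
    isOpen_lt continuous_const ((continuous_wall w).mul (by fun_prop))

/-- An interior point of the region of the actions, with ratio `u` of the outer and inner `L`. -/
def center (R : Walls) (u : ℝ) : Fin 3 → Fin 2 → ℝ :=
  ![![(R.lLo + R.lHi) / 2, 0],
    ![(R.qLo 0 + R.qHi 0) / 2 * ((R.lLo + R.lHi) / 2), 0],
    ![(R.cLo 0 + R.cHi 0) / 2 * ((R.qLo 0 + R.qHi 0) / 2 * ((R.lLo + R.lHi) / 2)), 0]] +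
  ((R.lLo + R.lHi) / 2 * u) • R.outward

theorem center_inner (u : ℝ) : R.center u 0 0 = (R.lLo + R.lHi) / 2 := by
  simp [center, outward]

theorem center_outer (u : ℝ) : R.center u 0 1 = (R.lLo + R.lHi) / 2 * u := by
  simp [center, outward]

theorem Proper.center_mem (hR : R.Proper) : R.center (R.ratio + 1) ∈ R.actions := by
  have h0 := hR.lLo_pos
  have h1 := hR.lLo_lt
  have h2 := hR.ratio_pos
  set l := (R.lLo + R.lHi) / 2 with hl
  have hl0 : 0 < l := by rw [hl]; linarith
  have q0 := hR.qLo_lt 0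
  have q1 := hR.qLo_lt 1
  have q2 := hR.qLo_pos 0
  have q3 := hR.qLo_pos 1
  have c0 := hR.cLo_lt 0
  have c1 := hR.cLo_lt 1
  refine mem_actions.2 ⟨⟨?_, ?_, ?_⟩, fun i => ?_⟩
  · rw [center_inner]; linarith
  · rw [center_inner]; linarith
  · rw [center_inner, center_outer, ← hl]; nlinarith
  · have ho : 0 < l * (R.ratio + 1) := by positivity
    fin_cases i
    · simp only [Fin.zero_eta, center, outward, Pi.add_apply, Pi.smul_apply, smul_eq_mul,
        Matrix.cons_val_zero, Matrix.cons_val_one, Matrix.cons_val, mul_zero, add_zero, ← hl]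
      have e1 : 0 < (R.qLo 0 + R.qHi 0) / 2 * l := by
        have : 0 < (R.qLo 0 + R.qHi 0) / 2 := by linarith
        positivity
      refine ⟨?_, ?_, ?_, ?_⟩
      · gcongr; linarith
      · gcongr; linarith
      · gcongr; linarith
      · gcongr; linarith
    · simp only [Fin.mk_one, center, outward, Pi.add_apply, Pi.smul_apply, smul_eq_mul,
        Matrix.cons_val_zero, Matrix.cons_val_one, Matrix.cons_val, mul_one, zero_add, ← hl]
      have e1 : 0 < (R.qLo 1 + R.qHi 1) / 2 := by linarith
      have e2 : 0 < l * (R.ratio + 1) * ((R.qLo 1 + R.qHi 1) / 2) := by positivity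
      refine ⟨?_, ?_, ?_, ?_⟩
      · nlinarith
      · nlinarith
      · nlinarith
      · nlinarith

/-- `center u` arises from the interior point `center (ratio + 1)` by moving outward, which
decreases none of the finitely many walls; hence a bound independent of u. -/
theorem Proper.exists_le_wall_center (hR : R.Proper) :
    ∃ δ > 0, ∀ u, R.ratio + 1 ≤ u → ∀ w, δ ≤ R.wall w (R.center u) := by
  obtain ⟨w₀, hw₀⟩ := Finite.exists_min fun w => R.wall w (R.center (R.ratio + 1))
  refine ⟨_, hR.center_mem w₀, fun u hu w => (hw₀ w).trans ?_⟩
  have h0 := hR.lLo_pos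
  have h1 := hR.lLo_lt
  have e : R.center u = R.center (R.ratio + 1) +
      ((R.lLo + R.lHi) / 2 * (u - (R.ratio + 1))) • R.outward := by
    simp only [center]
    rw [add_assoc, ← add_smul]
    congr 2
    ring
  rw [e]
  refine hR.wall_add_outward w _ (mul_nonneg (by linarith) (by linarith))

end Walls

/-- The actions with `t₁ < α < t₂`. -/
def alphaShell (κ t₁ t₂ : ℝ) : Set (Fin 3 → Fin 2 → ℝ) :=
  {y | t₁ < κ * (y 0 0 / y 0 1) ^ 2 ∧ κ * (y 0 0 / y 0 1) ^ 2 < t₂}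

variable {R : Walls} {κ t₁ t₂ : ℝ}

theorem mem_alphaShell (hκ : 0 < κ) {y : Fin 3 → Fin 2 → ℝ}
    (hy0 : 0 < y 0 0) (hy1 : 0 < y 0 1) :
    y ∈ alphaShell κ t₁ t₂ ↔ √(t₁ / κ) * y 0 1 < y 0 0 ∧ y 0 0 < √(t₂ / κ) * y 0 1 := by
  rw [← lt_div_iff₀ hy1, ← div_lt_iff₀ hy1, Real.sqrt_lt' (by positivity), Real.lt_sqrt (by positivity),
    div_lt_iff₀' hκ, lt_div_iff₀' hκ]
  rfl

/-- Affine walls turn the homothety towards a centre at depth δ into a lower bound εδ on every wall.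
The shell is a convex cone in (L₁, L₂) and is preserved. Small α forces L₂ to be large, so εδL₂³
exceeds D. -/
theorem homothety_mem_core (hR : R.Proper) (hκ : 0 < κ) (N D : ℝ) {ε : ℝ} (hε : 0 < ε)
    (hε1 : ε < 1) : ∃ η > 0, ∀ t₁ t₂, 0 < t₁ → t₁ < t₂ → t₂ < η →
      ∃ p ∈ R.actions ∩ alphaShell κ t₁ t₂, ∀ y ∈ R.actions ∩ alphaShell κ t₁ t₂,
        (1 - ε) • y + ε • p ∈ R.core N D ∩ alphaShell κ t₁ t₂ := by
  obtain ⟨δ, hδ, hw⟩ := hR.exists_le_wall_center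
  have hl := hR.lLo_pos
  have hl' := hR.lLo_lt
  have hr := hR.ratio_pos
  obtain ⟨B, hB⟩ : ∃ B : ℝ, B = max 1 (max N (D / (ε * δ))) := ⟨_, rfl⟩
  have hB1 : 1 ≤ B := hB ▸ le_max_left _ _
  have hBN : N ≤ B := hB ▸ (le_max_left _ _).trans (le_max_right _ _)
  have hBD : D ≤ ε * δ * B := by
    rw [← div_le_iff₀' (by positivity)]
    exact hB ▸ (le_max_right _ _).trans (le_max_right _ _)
  have hB0 : 0 < B := by linarith
  -- The first bound on t₂ makes u at least ratio + 1; the second forces L₂ > B throughout the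
  -- shell.
  refine ⟨min (κ / (R.ratio + 1) ^ 2) (κ * (R.lLo / B) ^ 2), by positivity,
    fun t₁ t₂ h1 h12 hη => ?_⟩
  have h2 : 0 < t₂ := h1.trans h12
  have hη1 : t₂ < κ / (R.ratio + 1) ^ 2 := hη.trans_le (min_le_left _ _)
  have hη2 : t₂ < κ * (R.lLo / B) ^ 2 := hη.trans_le (min_le_right _ _)
  -- The centre depends on the shell: this u gives it α = (t₁ + t₂)/2, however thin the shell is.
  set u := √(κ / ((t₁ + t₂) / 2)) with hu
  have hupos : 0 < u := Real.sqrt_pos.2 (by positivity)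
  have hu2 : u ^ 2 = κ / ((t₁ + t₂) / 2) := Real.sq_sqrt (by positivity)
  have hur : R.ratio + 1 ≤ u := by
    rw [hu, Real.le_sqrt' (by positivity), le_div_iff₀ (by positivity)]
    rw [lt_div_iff₀ (by positivity)] at hη1
    nlinarith [sq_nonneg (R.ratio + 1)]
  have hpA : R.center u ∈ R.actions := fun w => hδ.trans_le (hw u hur w)
  have hpS : R.center u ∈ alphaShell κ t₁ t₂ := by
    have e : κ * (R.center u 0 0 / R.center u 0 1) ^ 2 = (t₁ + t₂) / 2 := by
      rw [Walls.center_inner, Walls.center_outer, div_pow, mul_pow, hu2]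
      have : R.lLo + R.lHi ≠ 0 := by linarith
      field_simp
    exact ⟨by rw [e]; linarith, by rw [e]; linarith⟩
  refine ⟨R.center u, ⟨hpA, hpS⟩, fun y ⟨hyA, hyS⟩ => ?_⟩
  set y' := (1 - ε) • y + ε • R.center u with hy'
  have hwall : ∀ w, ε * δ < R.wall w y' := fun w => by
    rw [hy', Walls.wall_affine]
    have := mul_pos (sub_pos.2 hε1) (hyA w)
    nlinarith [hw u hur w]
  have hA' : y' ∈ R.actions := fun w => lt_trans (by positivity) (hwall w)
  have hp0 := hR.pos hpA
  have hy0 := hR.pos hyA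
  have h0' := hR.pos hA'
  have hS' : y' ∈ alphaShell κ t₁ t₂ := by
    rw [mem_alphaShell hκ (h0' 0).1 (h0' 1).1]
    rw [mem_alphaShell hκ (hp0 0).1 (hp0 1).1] at hpS
    rw [mem_alphaShell hκ (hy0 0).1 (hy0 1).1] at hyS
    simp only [hy', Pi.add_apply, Pi.smul_apply, smul_eq_mul]
    have a1 := mul_lt_mul_of_pos_left hpS.1 hε
    have a2 := mul_lt_mul_of_pos_left hpS.2 hε
    have a3 := mul_lt_mul_of_pos_left hyS.1 (sub_pos.2 hε1)
    have a4 := mul_lt_mul_of_pos_left hyS.2 (sub_pos.2 hε1)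
    constructor
    · nlinarith
    · nlinarith
  have hBL : B < y' 0 1 := by
    have e1 := ((mem_alphaShell hκ (h0' 0).1 (h0' 1).1).1 hS').2
    have e2 : √(t₂ / κ) < R.lLo / B := by
      rw [Real.sqrt_lt' (by positivity), div_lt_iff₀' hκ]
      exact hη2
    have e3 := (Walls.mem_actions.1 hA').1.1
    have e4 : R.lLo < R.lLo / B * y' 0 1 :=
      e3.trans (e1.trans (mul_lt_mul_of_pos_right e2 (h0' 1).1))
    rw [div_mul_eq_mul_div, lt_div_iff₀ hB0] at e4
    exact lt_of_mul_lt_mul_left e4 hl.le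
  refine ⟨⟨hA', hBN.trans_lt hBL, fun w => ?_⟩, hS'⟩
  have hB3 : B ≤ y' 0 1 ^ 3 := by
    have : 1 ≤ y' 0 1 := hB1.trans hBL.le
    calc B ≤ y' 0 1 := hBL.le
      _ ≤ _ := le_self_pow₀ this (by norm_num)
  calc D ≤ ε * δ * B := hBD
    _ ≤ ε * δ * y' 0 1 ^ 3 := by gcongr
    _ < _ := mul_lt_mul_of_pos_right (hwall w) (by linarith)

theorem isOpen_actions_inter_alphaShell (hR : R.Proper) :
    IsOpen (R.actions ∩ alphaShell κ t₁ t₂) := by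
  have hc : ContinuousOn (fun y : Fin 3 → Fin 2 → ℝ => κ * (y 0 0 / y 0 1) ^ 2) R.actions := by
    refine continuousOn_const.mul (ContinuousOn.pow (ContinuousOn.div (by fun_prop) (by fun_prop)
      fun y hy => (hR.pos hy 1).1.ne') 2)
  exact hc.isOpen_inter_preimage Walls.isOpen_actions (isOpen_Ioo (a := t₁) (b := t₂))

/-- The lower bound t₁ > 0 on α bounds L₂ above, and |H| ≤ G ≤ L bounds the rest. -/
theorem volume_actions_inter_ne_top (hR : R.Proper) (hκ : 0 < κ) (h1 : 0 < t₁) :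
    MeasureTheory.volume (R.actions ∩ alphaShell κ t₁ t₂) ≠ ⊤ := by
  have hsq : 0 < √(t₁ / κ) := Real.sqrt_pos.2 (by positivity)
  have hl : 0 < R.lHi := hR.lLo_pos.trans hR.lLo_lt
  refine ne_top_of_le_ne_top (isCompact_closedBall (0 : Fin 3 → Fin 2 → ℝ)
    (max R.lHi (R.lHi / √(t₁ / κ)))).measure_lt_top.ne (MeasureTheory.measure_mono ?_)
  rintro y ⟨hA, hS⟩
  have hp := hR.pos hA
  obtain ⟨⟨-, a1, -⟩, h⟩ := Walls.mem_actions.1 hA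
  have hS' := ((mem_alphaShell hκ (hp 0).1 (hp 1).1).1 hS).1
  have hL : ∀ i, y 0 i ≤ max R.lHi (R.lHi / √(t₁ / κ)) := fun i => by
    fin_cases i
    · exact a1.le.trans (le_max_left _ _)
    · refine le_trans ?_ (le_max_right _ _)
      rw [le_div_iff₀ hsq]
      simp only [Fin.mk_one]
      linarith
  have hG : ∀ i, y 1 i ≤ y 0 i := fun i => by
    nlinarith [(h i).2.1, hR.qHi_lt i, (hp i).1]
  have hH : ∀ i, |y 2 i| ≤ y 1 i := fun i => by
    rw [abs_le]
    constructor
    · nlinarith [(h i).2.2.1, hR.cLo_gt i, (hp i).2]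
    · nlinarith [(h i).2.2.2, hR.cHi_lt i, (hp i).2]
  have h0 : 0 ≤ max R.lHi (R.lHi / √(t₁ / κ)) := hl.le.trans (le_max_left _ _)
  rw [mem_closedBall, dist_zero_right]
  refine (pi_norm_le_iff_of_nonneg h0).2 fun k => (pi_norm_le_iff_of_nonneg h0).2 fun i => ?_
  rw [Real.norm_eq_abs]
  fin_cases k
  · exact (abs_of_pos (hp i).1).trans_le (hL i)
  · exact (abs_of_pos (hp i).2).trans_le ((hG i).trans (hL i))
  · exact (hH i).trans ((hG i).trans (hL i))

/-- The homothetic image has exactly (1 − ε)ᵈ times the volume and lies in the core, for every ε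
once t₂ is small; inclusion gives the bound by 1. -/
theorem tendsto_volume_core (hR : R.Proper) (hκ : 0 < κ) (N D : ℝ) :
    Tendsto (fun t : ℝ × ℝ => MeasureTheory.volume (R.core N D ∩ alphaShell κ t.1 t.2) /
        MeasureTheory.volume (R.actions ∩ alphaShell κ t.1 t.2))
      (𝓝[{t : ℝ × ℝ | 0 < t.1 ∧ t.1 < t.2}] (0, 0)) (𝓝 1) := by
  refine tendsto_order.2 ⟨fun a ha => ?_, fun a ha => Eventually.of_forall fun t => ?_⟩
  · set d := Module.finrank ℝ (Fin 3 → Fin 2 → ℝ)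
    have hlim : Tendsto (fun ε : ℝ => ENNReal.ofReal ((1 - ε) ^ d)) (𝓝[>] 0) (𝓝 1) := by
      have : Continuous fun ε : ℝ => ENNReal.ofReal ((1 - ε) ^ d) :=
        ENNReal.continuous_ofReal.comp (by fun_prop)
      have h := this.tendsto 0
      simp only [sub_zero, one_pow, ENNReal.ofReal_one] at h
      exact h.mono_left nhdsWithin_le_nhds
    obtain ⟨ε, hεa, hε0, hε1⟩ := ((hlim.eventually (lt_mem_nhds ha)).and
      (Ioo_mem_nhdsGT one_pos)).exists
    obtain ⟨η, hη, h⟩ := homothety_mem_core hR hκ N D hε0 hε1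
    have hev : ∀ᶠ t : ℝ × ℝ in 𝓝[{t : ℝ × ℝ | 0 < t.1 ∧ t.1 < t.2}] (0, 0), t.2 < η :=
      mem_nhdsWithin_of_mem_nhds ((isOpen_lt continuous_snd continuous_const).mem_nhds hη)
    filter_upwards [hev, self_mem_nhdsWithin] with t ht2 ⟨ht0, ht1⟩
    obtain ⟨p, hp, hmem⟩ := h t.1 t.2 ht0 ht1 ht2
    refine hεa.trans_le ?_
    rw [ENNReal.le_div_iff_mul_le
      (Or.inl ((isOpen_actions_inter_alphaShell hR).measure_pos _ ⟨p, hp⟩).ne')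
      (Or.inl (volume_actions_inter_ne_top hR hκ ht0))]
    have himg := MeasureTheory.Measure.addHaar_image_homothety
      (MeasureTheory.volume : MeasureTheory.Measure (Fin 3 → Fin 2 → ℝ)) p (1 - ε)
      (R.actions ∩ alphaShell κ t.1 t.2)
    rw [abs_of_nonneg (pow_nonneg (by linarith) _)] at himg
    rw [← himg]
    refine MeasureTheory.measure_mono ?_
    rintro _ ⟨y, hy, rfl⟩
    have e : AffineMap.homothety p (1 - ε) y = (1 - ε) • y + ε • p := by
      rw [AffineMap.homothety_apply, vsub_eq_sub, vadd_eq_add]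
      module
    rw [e]
    exact hmem y hy
  · refine lt_of_le_of_lt (ENNReal.div_le_of_le_mul ?_) ha
    rw [one_mul]
    exact MeasureTheory.measure_mono fun y hy => ⟨hy.1.1, hy.2⟩

theorem tendsto_relMeasure {m : Masses} (hm : m.Positive) (hR : R.Proper) (N D : ℝ) :
    Tendsto (fun t : ℝ × ℝ => relMeasure m {x | x.2 ∈ R.core N D} R.region t.1 t.2)
      (𝓝[{t : ℝ × ℝ | 0 < t.1 ∧ t.1 < t.2}] (0, 0)) (𝓝 1) := by
  set Box : Set (Fin 3 → Fin 2 → ℝ) :=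
    univ.pi fun _ => univ.pi fun _ => Ico 0 (2 * π) with hBox
  have hvol : MeasureTheory.volume Box = (ENNReal.ofReal (2 * π) ^ 2) ^ 3 := by
    simp [hBox, MeasureTheory.volume_pi_pi]
  have hpi : ENNReal.ofReal (2 * π) ≠ 0 := by
    rw [Ne, ENNReal.ofReal_eq_zero, not_le]
    exact Real.two_pi_pos
  have h0 : MeasureTheory.volume Box ≠ 0 := by
    rw [hvol]; exact pow_ne_zero _ (pow_ne_zero _ hpi)
  have htop : MeasureTheory.volume Box ≠ ⊤ := by
    rw [hvol]; exact ENNReal.pow_ne_top (ENNReal.pow_ne_top ENNReal.ofReal_ne_top)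
  -- All sets are products with the same box of angles, whose volume cancels in the quotient.
  have hshell : ∀ (S : Set (Fin 3 → Fin 2 → ℝ)) (t : ℝ × ℝ), shell m {x | x.2 ∈ S} t.1 t.2 =
      Box ×ˢ (S ∩ alphaShell (alphaCoeff m) t.1 t.2) := fun S t => by
    ext x
    simp only [shell, alpha_eq hm, alphaShell, hBox]
    constructor
    · rintro ⟨h1, h2, h3⟩
      exact ⟨fun k _ i _ => h2 k i, h1, h3⟩
    · rintro ⟨h1, h2, h3⟩
      exact ⟨h2, fun k i => h1 k trivial i trivial, h3⟩
  refine (tendsto_volume_core hR hm.alphaCoeff_pos N D).congr fun t => ?_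
  rw [relMeasure, Walls.region, hshell, hshell, MeasureTheory.Measure.volume_eq_prod,
    MeasureTheory.Measure.prod_prod, MeasureTheory.Measure.prod_prod,
    ENNReal.mul_div_mul_left _ _ h0 htop]

end RelMeasure

end LunarThreeBody

namespace LunarThreeBody

open scoped Real Topology
open Set Filter Metric Asymptotics

/-! ### Assembly: from orders in L₂ to powers of α -/

section Conclusion

variable {m : Masses} {b : Bounds}

theorem norm_alphaC (hm : m.Positive) (z : Phase ℂ) :
    ‖alphaC m z‖ = alphaCoeff m * (‖z.2 0 0‖ / ‖z.2 0 1‖) ^ 2 := by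
  have h0 := hm.μ_pos 0
  have h1 := hm.μ_pos 1
  have h2 := hm.M_pos 0
  have h3 := hm.M_pos 1
  simp only [alphaC, alphaCoeff, norm_div, norm_mul, norm_pow, Complex.norm_real, Real.norm_eq_abs,
    abs_of_pos h0, abs_of_pos h1, abs_of_pos h2, abs_of_pos h3]
  rw [div_pow, div_div_div_eq, div_mul_div_comm]
  congr 1
  ring

/-- Powers of `1 / L₂` are bounded by powers of `α`. -/
theorem wt_le_alphaC (hm : m.Positive) {a : ℝ} (ha : 0 < a) (k : ℕ) {z : Phase ℂ}
    (hz : a ≤ ‖z.2 0 0‖) (hz1 : 0 < ‖z.2 0 1‖) :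
    wt k z ≤ (alphaCoeff m * a ^ 2) ^ (-((k : ℝ) / 2)) * ‖alphaC m z‖ ^ ((k : ℝ) / 2) := by
  have hκ := hm.alphaCoeff_pos
  have hb : 0 < alphaCoeff m * a ^ 2 := by positivity
  have h1 : alphaCoeff m * a ^ 2 * (‖z.2 0 1‖⁻¹) ^ 2 ≤ ‖alphaC m z‖ := by
    rw [norm_alphaC hm, div_eq_mul_inv, mul_pow, ← mul_assoc]
    gcongr
  have h2 : wt k z = ((‖z.2 0 1‖⁻¹) ^ 2) ^ ((k : ℝ) / 2) := by
    rw [← Real.rpow_natCast, ← Real.rpow_mul (by positivity), wt, zpow_neg, zpow_natCast,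
      ← inv_pow, ← Real.rpow_natCast]
    congr 1
    push_cast
    ring
  calc wt k z = (alphaCoeff m * a ^ 2) ^ (-((k : ℝ) / 2)) *
        (alphaCoeff m * a ^ 2 * (‖z.2 0 1‖⁻¹) ^ 2) ^ ((k : ℝ) / 2) := by
        rw [h2, Real.mul_rpow hb.le (by positivity), ← mul_assoc, ← Real.rpow_add hb]
        simp
    _ ≤ _ := by gcongr

theorem norm_actions_sub_le (x y : Phase ℝ) : ‖x.2 - y.2‖ ≤ ‖toC x - toC y‖ := by
  refine (pi_norm_le_iff_of_nonneg (norm_nonneg _)).2 fun k =>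
    (pi_norm_le_iff_of_nonneg (norm_nonneg _)).2 fun i => ?_
  have h := norm_coord_le (toC x - toC y) k i
  have e : (toC x - toC y).2 k i = ((x.2 k i - y.2 k i : ℝ) : ℂ) := by simp [toC]
  rw [e, Complex.norm_real] at h
  exact h

theorem keplerE_congr (c : Fin 2 → ℝ) (i : Fin 2) {z w : Phase ℂ} (h : z.2 = w.2) :
    keplerE c i z = keplerE c i w := by
  rw [keplerE, keplerE, h]

theorem keplerE_toC_im (c : Fin 2 → ℝ) (i : Fin 2) (x : Phase ℝ) :
    (keplerE c i (toC x)).im = 0 := by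
  have : keplerE c i (toC x) = ((-(c i) / (2 * x.2 0 i ^ 2) : ℝ) : ℂ) := by
    simp [keplerE, toC]
  rw [this, Complex.ofReal_im]

/-- F^n is the Kepler energy plus the transported Z, φ is generated by K, and P̃ is the set of far
points at wall value above D/L₂³. Powers of 1/|L₂| become powers of α by `wt_le_alphaC`. -/
theorem exists_normalization (hm : m.Positive) (hb : b.Admissible) {s : ℝ} (hs : 0 < s)
    (hL : ∀ z ∈ T (PStar m b) s, ∀ i, z.2 0 i ≠ 0) (n : ℕ) :
    ∃ (Fn : Phase ℝ → ℝ) (Fnc : Phase ℂ → ℂ) (φ : Phase ℂ → Phase ℂ) (Pt : Set (Phase ℝ))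
      (s'' C C₀ : ℝ),
      0 < s'' ∧ s'' < s ∧
      IsAnalyticExtension Fn (PStar m b) s'' Fnc ∧
      (∀ k, ∀ x ∈ PStar m b, Fn (shift k x) = Fn x) ∧
      (∀ x ∈ PStar m b, ∀ y ∈ PStar m b, x.1 1 = y.1 1 → x.1 2 = y.1 2 → x.2 = y.2 →
        Fn x = Fn y) ∧
      IsOpen Pt ∧ Pt ⊆ PStar m b ∧ (∀ k, ∀ x ∈ Pt, shift k x ∈ Pt) ∧
      IsSymplecto Pt s'' φ ∧
      MapsTo φ (toC '' Pt) (toC '' PStar m b) ∧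
      MapsTo φ (T Pt s'') (T (PStar m b) s) ∧
      (∀ z ∈ T Pt s'', ‖φ z - z‖ ≤ C * ‖alphaC m z‖ ^ ((3 : ℝ) / 2)) ∧
      (∀ z ∈ T Pt s'',
        ‖hamC m (φ z) - Fnc z‖ ≤ C₀ * ‖alphaC m z‖ ^ (3 * ((n : ℝ) + 2) / 2)) ∧
      Tendsto (fun t : ℝ × ℝ => relMeasure m Pt (PStar m b) t.1 t.2)
        (𝓝[{t : ℝ × ℝ | 0 < t.1 ∧ t.1 < t.2}] (0, 0)) (𝓝 1) := by
  have hR := proper_asyncWalls hm hb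
  obtain ⟨hreg, hord⟩ := reg_pertC hm hb
  rw [PStar_eq_region hm hb] at hreg hord hL ⊢
  set R := asyncWalls m b with hRdef
  set c : Fin 2 → ℝ := fun i => m.μ i ^ 3 * m.M i ^ 2 with hc
  have hc0 : ∀ i, c i ≠ 0 := fun i =>
    (mul_pos (pow_pos (hm.μ_pos i) 3) (pow_pos (hm.M_pos i) 2)).ne'
  have hIB := hR.innerBounded
  have hAI : AngleInvariant R.region := Walls.angleInvariant_region
  obtain ⟨K, Z, nf⟩ := exists_isNormalForm hAI hIB hc0 hreg hord n
  obtain ⟨Z', s₁, hs₁, hZ'an, hZ'im, hZ'per, hZ'ind, hZ'ord⟩ :=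
    exists_transport hR nf.regZ nf.ordZ nf.indep n
  obtain ⟨C₁, hC₁, hdef⟩ := nf.ord.exists_pos
  obtain ⟨C₂, hC₂, hZZ⟩ := hZ'ord.exists_pos
  obtain ⟨N₁, φ, χ, C₃, hφan, hφeq, hφinj, hφsym, hφreal, hφest, hφχ⟩ :=
    exists_generatedMap hAI nf.regK nf.ordK hdef.bound
  obtain ⟨a, ha, B, hB, hab⟩ := hIB.eventually
  have hsmall : ∀ᶠ z in far R.region, C₃ * wt 3 z < s / 2 := by
    have h := (tendsto_wt (A := R.region) (k := 3) (by norm_num)).const_mul C₃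
    rw [mul_zero] at h
    exact h.eventually (gt_mem_nhds (half_pos hs))
  obtain ⟨N, hN⟩ := eventually_far.1 ((eventually_far.2 ⟨N₁, fun z hz => hz⟩ :
    ∀ᶠ z in far R.region, z ∈ dom R.region N₁).and
      (hsmall.and (hZZ.bound.and (hab.and (eventually_norm_gt 0)))))
  -- The three bounds keep P̃'s neighbourhood in the domain of φ, leave s/2 for the displacement by
  -- φ, and stay in the domain of the transported Z.
  set s'' := min (1 / ((N : ℝ) + 1)) (min (s / 2) s₁) with hs''
  have hs0 : 0 < s'' := by positivity
  have hs2 : s'' ≤ s / 2 := (min_le_right _ _).trans (min_le_left _ _)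
  have hs3 : s'' ≤ s₁ := (min_le_right _ _).trans (min_le_right _ _)
  -- The Lipschitz constant of the walls times the constant of φ − Id: on P̃ the displacement cannot
  -- reach a wall.
  set D := (2 + R.ratio) * |C₃| with hD
  set Pt : Set (Phase ℝ) := {x | x.2 ∈ R.core N D} with hPt
  have hPtA : Pt ⊆ R.region := fun x hx => hx.1
  have hsub : T Pt s'' ⊆ dom R.region N :=
    T_mono (fun x hx => ⟨hx.1, hx.2.1⟩) (min_le_left _ _)
  have hwt : ∀ k : ℕ, ∀ z ∈ T Pt s'', wt k z ≤
      (alphaCoeff m * a ^ 2) ^ (-((k : ℝ) / 2)) * ‖alphaC m z‖ ^ ((k : ℝ) / 2) := fun k z hz =>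
    wt_le_alphaC hm ha k (hN z (hsub hz)).2.2.2.1.1 (hN z (hsub hz)).2.2.2.2
  set Fnc : Phase ℂ → ℂ := fun z => keplerE c 0 z + keplerE c 1 z + Z' z with hFnc
  refine ⟨fun x => (Fnc (toC x)).re, Fnc, φ, Pt, s'',
    |C₃| * (alphaCoeff m * a ^ 2) ^ (-(3 / 2 : ℝ)),
    (C₁ + C₂) * (alphaCoeff m * a ^ 2) ^ (-(3 * ((n : ℝ) + 2) / 2)), hs0, by linarith,
    ⟨fun z hz => ?_, fun x hx => ?_⟩, fun k x hx => ?_, fun x hx y hy e1 e2 e3 => ?_,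
    (Walls.isOpen_core _ _).preimage continuous_snd, hPtA, fun k x hx => hx,
    ⟨fun z hz => hφan z (hN z (hsub hz)).1, fun k z hz => hφeq k z (hN z (hsub hz)).1,
      hφinj.mono fun z hz => (hN z (hsub hz)).1, fun z hz => hφsym z (hN z (hsub hz)).1⟩,
    ?_, fun z hz => ?_, fun z hz => ?_, fun z hz => ?_, tendsto_relMeasure hm hR N D⟩
  · have h0 := hL z (T_mono subset_rfl (by linarith) hz)
    exact ((analyticAt_keplerE c 0 (h0 0)).add (analyticAt_keplerE c 1 (h0 1))).add
      (hZ'an z (T_mono subset_rfl hs3 hz))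
  · refine Complex.ext (by simp) ?_
    rw [Complex.ofReal_im, hFnc]
    simp [keplerE_toC_im, hZ'im x hx]
  · have e : (toC (shift k x)).2 = (toC x).2 := rfl
    simp only [hFnc]
    rw [hZ'per x hx k, keplerE_congr c 0 e, keplerE_congr c 1 e]
  · have e : (toC x).2 = (toC y).2 := by simp [toC, e3]
    simp only [hFnc]
    rw [hZ'ind x hx y hy e1 e2 e3, keplerE_congr c 0 e, keplerE_congr c 1 e]
  · rintro _ ⟨x, hx, rfl⟩
    have hz : toC x ∈ T Pt s'' := mem_T.2 ⟨x, hx, by simpa using hs0⟩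
    have hd := (hN _ (hsub hz)).1
    obtain ⟨y, hy⟩ := hφreal _ hd ⟨x, rfl⟩
    refine ⟨y, fun w => ?_, hy⟩
    have hp := (hR.pos hx.1 1).1
    have h1 := hφest _ hd
    have h2 : wt 3 (toC x) = (x.2 0 1 ^ 3)⁻¹ := by
      rw [wt, zpow_neg]
      simp only [toC, Complex.norm_real, Real.norm_of_nonneg hp.le]
      norm_cast
    rw [← hy, h2] at h1
    have h3 : ‖x.2 - y.2‖ ≤ |C₃| * (x.2 0 1 ^ 3)⁻¹ := by
      rw [norm_sub_rev]
      refine (norm_actions_sub_le y x).trans (h1.trans ?_)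
      gcongr
      exact le_abs_self _
    have h4 := hR.wall_lipschitz w x.2 y.2
    have h5 := hx.2.2 w
    have h6 : D * (x.2 0 1 ^ 3)⁻¹ < R.wall w x.2 := by
      rw [← div_eq_mul_inv, div_lt_iff₀ (by positivity)]
      exact h5
    have hr := hR.ratio_pos
    have h7 : (2 + R.ratio) * ‖x.2 - y.2‖ ≤ (2 + R.ratio) * (|C₃| * (x.2 0 1 ^ 3)⁻¹) := by gcongr
    rw [hD, mul_assoc] at h6
    linarith
  · have hd := hN _ (hsub hz)
    have e : φ z = z + (φ z - z) := by abel
    rw [e]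
    refine T_add (s := s'') (T_mono hPtA le_rfl hz) ?_
    linarith [hφest z hd.1, hd.2.1]
  · have h1 := hφest z (hN z (hsub hz)).1
    have h2 := hwt 3 z hz
    norm_num only [Nat.cast_ofNat] at h2
    have h3 := wt_nonneg 3 z
    calc ‖φ z - z‖ ≤ |C₃| * wt 3 z := h1.trans (by gcongr; exact le_abs_self _)
      _ ≤ |C₃| * ((alphaCoeff m * a ^ 2) ^ (-(3 / 2 : ℝ)) * ‖alphaC m z‖ ^ ((3 : ℝ) / 2)) := by
          gcongr
      _ = _ := by ring
  · obtain ⟨hd1, -, hd2, -⟩ := hN z (hsub hz)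
    obtain ⟨p1, p2, p3⟩ := hφχ z hd1
    have hact : (χ z).2 = z.2 := by
      conv_rhs => rw [← p2]
      simp [angDisp]
    have hwχ : wt (3 * n + 6) (χ z) = wt (3 * n + 6) z := by rw [wt, wt, hact]
    -- The mixed point χ z has the actions of z, so the Kepler energies agree; the error is the
    -- defect at χ z, up to the change made by the transport.
    have e : hamC m (φ z) - Fnc z = defect c (pertC m) K Z (χ z) - (Z' z - Z z) := by
      rw [defect, ← p3, p2, hamC, hFnc, keplerE_congr c 0 hact, keplerE_congr c 1 hact]
      ring
    rw [Real.norm_of_nonneg (wt_nonneg _ _)] at p1 hd2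
    rw [hwχ] at p1
    have h2 := hwt (3 * n + 6) z hz
    have e2 : (((3 * n + 6 : ℕ) : ℝ)) / 2 = 3 * ((n : ℝ) + 2) / 2 := by push_cast; ring
    have e3 : (((3 * n + 6 : ℕ) : ℤ)) = 3 * n + 6 := by push_cast; ring
    rw [e2, e3] at h2
    rw [e]
    calc _ ≤ ‖defect c (pertC m) K Z (χ z)‖ + ‖Z' z - Z z‖ := norm_sub_le _ _
      _ ≤ C₁ * wt (3 * n + 6) z + C₂ * wt (3 * n + 6) z := add_le_add p1 hd2
      _ = (C₁ + C₂) * wt (3 * n + 6) z := by ring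
      _ ≤ (C₁ + C₂) * ((alphaCoeff m * a ^ 2) ^ (-(3 * ((n : ℝ) + 2) / 2)) *
            ‖alphaC m z‖ ^ (3 * ((n : ℝ) + 2) / 2)) := by
          gcongr
      _ = _ := by ring

end Conclusion

end LunarThreeBody

end

theorem proposition3p1 (m : LunarThreeBody.Masses) (hm : m.Positive)
    (b : LunarThreeBody.Bounds) (hb : b.Admissible) :
    ∃ s : ℝ, 0 < s ∧ ∃ Fc : LunarThreeBody.Phase ℂ → ℂ,
      LunarThreeBody.IsAnalyticExtension (LunarThreeBody.F m) (LunarThreeBody.PStar m b) s Fc ∧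
      ∀ n : ℕ,
        ∃ (Fn : LunarThreeBody.Phase ℝ → ℝ) (Fnc : LunarThreeBody.Phase ℂ → ℂ)
          (φ : LunarThreeBody.Phase ℂ → LunarThreeBody.Phase ℂ)
          (Pt : Set (LunarThreeBody.Phase ℝ)) (s'' C C₀ : ℝ),
          0 < s'' ∧ s'' < s ∧
          -- the Hamiltonian `F^n` on `P*` is analytic, lives on the torus, is free of `l₁, l₂`
          LunarThreeBody.IsAnalyticExtension Fn (LunarThreeBody.PStar m b) s'' Fnc ∧
          (∀ k, ∀ x ∈ LunarThreeBody.PStar m b, Fn (LunarThreeBody.shift k x) = Fn x) ∧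
          (∀ x ∈ LunarThreeBody.PStar m b, ∀ y ∈ LunarThreeBody.PStar m b,
            x.1 1 = y.1 1 → x.1 2 = y.1 2 → x.2 = y.2 → Fn x = Fn y) ∧
          -- the open subset of `P*`, as a set of points with angles modulo `2π`
          IsOpen Pt ∧ Pt ⊆ LunarThreeBody.PStar m b ∧
          (∀ k, ∀ x ∈ Pt, LunarThreeBody.shift k x ∈ Pt) ∧
          -- the symplectomorphism, which takes real points of `Pt` to real points of `P*`
          LunarThreeBody.IsSymplecto Pt s'' φ ∧
          Set.MapsTo φ (LunarThreeBody.toC '' Pt)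
            (LunarThreeBody.toC '' LunarThreeBody.PStar m b) ∧
          Set.MapsTo φ (LunarThreeBody.T Pt s'') (LunarThreeBody.T (LunarThreeBody.PStar m b) s) ∧
          (∀ z ∈ LunarThreeBody.T Pt s'',
            ‖φ z - z‖ ≤ C * ‖LunarThreeBody.alphaC m z‖ ^ ((3 : ℝ) / 2)) ∧
          (∀ z ∈ LunarThreeBody.T Pt s'',
            ‖Fc (φ z) - Fnc z‖ ≤ C₀ * ‖LunarThreeBody.alphaC m z‖ ^ (3 * ((n : ℝ) + 2) / 2)) ∧
          -- the relative measure within `t₁ < α < t₂` tends to `1` as `t₁, t₂` tend to `0`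
          Filter.Tendsto
            (fun t : ℝ × ℝ =>
              LunarThreeBody.relMeasure m Pt (LunarThreeBody.PStar m b) t.1 t.2)
            (nhdsWithin (0, 0) {t : ℝ × ℝ | 0 < t.1 ∧ t.1 < t.2})
            (nhds 1) := by
  obtain ⟨s, hs, hext, hL⟩ := LunarThreeBody.exists_isAnalyticExtension_hamC hm hb
  exact ⟨s, hs, LunarThreeBody.hamC m, hext, LunarThreeBody.exists_normalization hm hb hs hL⟩
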